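/- Let $M$ be a smooth manifold and $E\to M$ a Courant algebroid: a smooth real vector bundle of finite rank with a smooth nondegenerate symmetric bilinear form $\langle\cdot,\cdot\rangle$ on the fibres, a smooth bundle map $\rho:E\to TM$, and an $\mathbb R$-bilinear bracket $[\![\cdot,\cdot]\!]$ on $\Gamma(E)$ such that, for all $e_i,e\in\Gamma(E)$ and $f\in C^\infty(M)$, - $[\![e_1,fe_2]\!]=\rho(e_1)(f)\,e_2+f[\![e_1,e_2]\!]$, - $\rho(e_1)\langle e_2,e_3\rangle=\langle[\![e_1,e_2]\!],e_3\rangle+\langle e_2,[\![e_1,e_3]\!]\rangle$, - $[\![[\![e_1,e_2]\!],e_3]\!]=[\![e_1,[\![e_2,e_3]\!]]\!]-[\![e_2,[\![e_1,e_3]\!]]\!]$, - $[\![e_1,e_2]\!]+[\![e_2,e_1]\!]=\mathcal D\langle e_1,e_2\rangle$, where $\langle\mathcal D f,e\rangle=\rho(e)(f)$. **Cochains.** Let $C^0(E)=C^\infty(M)$. For $k\ge1$ let $C^k(E)$ be the space of maps $\omega:\Gamma(E)^k\to C^\infty(M)$ that are $C^\infty(M)$-linear in the last entry and, for $k\ge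 2$, admit a map $\sigma_\omega:\Gamma(E)^{k-2}\to\mathfrak X(M)$ such that, for $1\le i\le k-1$, $$\omega(\dots,e_i,e_{i+1},\dots)+\omega(\dots,e_{i+1},e_i,\dots)=\sigma_\omega(e_1,\dots,\widehat e_i,\widehat e_{i+1},\dots,e_k)\big(\langle e_i,e_{i+1}\rangle\big).$$ The differential is $$(d_E\omega)(e_0,\dots,e_k)=\sum_{i}(-1)^i\rho(e_i)\,\omega(e_0,\dots,\widehat e_i,\dots,e_k)-\sum_{i<j}(-1)^i\,\omega(e_0,\dots,\widehat e_i,\dots,e_{j-1},[\![e_i,e_j]\!],e_{j+1},\dots,e_k),$$ and $H^k(E)$ is the space of $k$-cocycles modulo the exact $k$-cochains. For maps $\omega$ of $k$ and $\tau$ of $m$ sections of $E$ with values in $\Gamma(\mathrm{End}\,E)$ put $$(\omega\smile\tau)(e_1,\dots,e_{k+m})=\sum_{\pi}\mathrm{sgn}(\pi)\,\omega(e_{\pi(1)},\dots,e_{\pi(k)})\,\tau(e_{\pi(k+1)},\dots,e_{\pi(k+m)}),$$ the sum being over all $(k,m)$-shuffles $\pi$. **Connections.** An $E$-connection on $E$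 is an $\mathbb R$-bilinear map $\nabla:\Gamma(E)\times\Gamma(E)\to\Gamma(E)$, $(e,b)\mapsto\nabla_eb$, such that $\nabla_e(fb)=f\nabla_eb+\rho(e)(f)b$ and $\nabla_{fe}b=f\nabla_eb$. Its curvature is $F_\nabla(e_1,e_2)b=\nabla_{e_1}\nabla_{e_2}b-\nabla_{e_2}\nabla_{e_1}b-\nabla_{[\![e_1,e_2]\!]}b$, and powers of $F_\nabla$ are taken with respect to $\smile$. For a path $\nabla_t$, $t\in[0,1]$, of $E$-connections that is smooth (that is, $\nabla_{t,e}b$ is smooth in $(t,x)\in[0,1]\times M$ for all $e,b\in\Gamma(E)$) and an integer $k\ge1$ put $$\mathrm{cs}_k(\nabla_t)=k\int_0^1\mathrm{tr}\Big(\tfrac{d}{dt}[\nabla_t]\smile F_{\nabla_t}^{\,k-1}\Big)\,dt .$$ A linear connection $\nabla:\mathfrak X(M)\times\Gamma(E)\to\Gamma(E)$ induces the $E$-connection $$\nabla^E_ee'=[\![e,e']\!]+\nabla_{\rho(e')}e-\rho^*\langle\nabla e,e'\rangle ,$$ where $\rho^*:T^*M\to E^*\cong E$ is the dual of $\rho$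 followed by the identification given by $\langle\cdot,\cdot\rangle$. For a positive definite metric $g$ on $E$ let $\nabla^{E,g}$ be the $E$-connection determined by $$g(\nabla^E_{e_1}e_2,e_3)+g(e_2,\nabla^{E,g}_{e_1}e_3)=\rho(e_1)\,g(e_2,e_3).$$ **Theorem.** Let $k$ be odd. There is a class $c_k\in H^{2k-1}(E)$, depending only on the Courant algebroid $E$ and on $k$, such that for every linear connection $\nabla$ on $E$ and every positive definite metric $g$ on $E$, there are smooth paths of $E$-connections from $\nabla^E$ to $\nabla^{E,g}$, and for every such path $\nabla_t$ the form $\mathrm{cs}_k(\nabla_t)$ is a cocycle in $C^{2k-1}(E)$ representing $c_k$. In other words, the Chern–Simons class $[\mathrm{cs}_k(\nabla^E,\nabla^{E,g})]=[\mathrm{cs}_k(\nabla_t)]\in H^{2k-1}(E)$ is well defined and independent of the choice of the linear connection $\nabla$ and the metric $g$. -/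

import Mathlib

open Bundle Set Manifold
open scoped Manifold ContDiff Topology

set_option linter.unusedSectionVars false

noncomputable section

namespace Courant

variable {n : ℕ} {M : Type*} [TopologicalSpace M] [ChartedSpace (EuclideanSpace ℝ (Fin n)) M]
  [IsManifold (𝓡 n) ∞ M]
  {F : Type*} [NormedAddCommGroup F] [NormedSpace ℝ F]
  {E : M → Type*} [TopologicalSpace (TotalSpace F E)] [∀ x, AddCommGroup (E x)]
  [∀ x, Module ℝ (E x)] [∀ x, TopologicalSpace (E x)] [∀ x, IsTopologicalAddGroup (E x)]
  [∀ x, ContinuousSMul ℝ (E x)] [FiberBundle F E] [VectorBundle ℝ F E]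
  [ContMDiffVectorBundle ∞ F E (𝓡 n)]

variable (n F E) in
/-- The space `Γ(E)` of smooth sections. -/
abbrev Sections : Type _ := Cₛ^∞⟮𝓡 n; F, E⟯

/-- Multiplication of a section by a smooth function. -/
instance instSMulSections : SMul C^∞⟮𝓡 n, M; ℝ⟯ (Sections n F E) :=
  ⟨fun f s => ⟨fun x => f x • s x, f.contMDiff.smul_section s.contMDiff⟩⟩

@[simp] theorem smul_sections_apply (f : C^∞⟮𝓡 n, M; ℝ⟯) (s : Sections n F E) (x : M) :
    (f • s) x = f x • s x := rfl

variable [FiniteDimensional ℝ F] [T2Space M]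

/-- Local frames extend to global sections, and sections expand in them after a cut-off. -/
theorem exists_global_frame (x₀ : M) :
    ∃ (ι : Type) (_ : Fintype ι) (s : ι → Sections n F E) (φ : C^∞⟮𝓡 n, M; ℝ⟯)
      (U : Set M), U ∈ 𝓝 x₀ ∧ φ x₀ = 1 ∧
      (∀ x ∈ U, ∃ b : Module.Basis ι ℝ (E x), ∀ i, b i = s i x) ∧
      (∀ (t : Π x, E x) (a : ι → M → ℝ), (∀ x ∈ U, t x = ∑ i, a i x • s i x) →
        (∀ i, ContMDiffAt (𝓡 n) 𝓘(ℝ, ℝ) ∞ (a i) x₀) →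
        ContMDiffAt (𝓡 n) ((𝓡 n).prod 𝓘(ℝ, F)) ∞ (fun x => TotalSpace.mk' F x (t x)) x₀) ∧
      (∀ t : Sections n F E, ∃ c : ι → C^∞⟮𝓡 n, M; ℝ⟯, (φ * φ) • t = ∑ i, c i • s i ∧
        (t x₀ = 0 → ∀ i, c i x₀ = 0)) := by
  classical
  let e := trivializationAt F E x₀
  have hx₀ : x₀ ∈ e.baseSet := FiberBundle.mem_baseSet_trivializationAt F E x₀
  let b := Module.finBasis ℝ F
  have : ContMDiffVectorBundle 1 F E (𝓡 n) := ContMDiffVectorBundle.of_le (n := ∞) (by simp)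
  obtain ⟨f, -, hf⟩ := (SmoothBumpFunction.nhds_basis_tsupport (I := 𝓡 n) x₀).mem_iff.1
    (e.open_baseSet.mem_nhds hx₀)
  let φ : C^∞⟮𝓡 n, M; ℝ⟯ := ⟨f, f.contMDiff⟩
  let s : Fin (Module.finrank ℝ F) → Sections n F E := fun i =>
    ⟨(f : M → ℝ) • e.localFrame b i, ContMDiffOn.smul_section_of_tsupport f.contMDiff.contMDiffOn
      e.open_baseSet hf (e.contMDiffOn_localFrame_baseSet ∞ b i)⟩
  let U : Set M := {x | f x = 1} ∩ e.baseSet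
  have hU : U ∈ 𝓝 x₀ := Filter.inter_mem f.eventuallyEq_one (e.open_baseSet.mem_nhds hx₀)
  have hs : ∀ x ∈ U, ∀ i, s i x = e.localFrame b i x := by
    rintro x ⟨hx, -⟩ i
    change f x • e.localFrame b i x = _
    rw [show f x = 1 from hx, one_smul]
  have hexp : ∀ t : Π x, E x, ∀ x ∈ e.baseSet,
      t x = ∑ i, e.localFrameCoeff (𝓡 n) b i x (t x) • e.localFrame b i x :=
    fun t x hx => e.eq_sum_localFrameCoeff_smul hx
  refine ⟨_, inferInstance, s, φ, U, hU, f.eq_one, ?_, ?_, ?_⟩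
  · intro x hx
    refine ⟨e.basisAt b hx.2, fun i => ?_⟩
    rw [hs x hx, e.localFrame_apply_of_mem_baseSet b hx.2]
  · intro t a ha hsm
    have h1 : ContMDiffAt (𝓡 n) ((𝓡 n).prod 𝓘(ℝ, F)) ∞
        (fun x => TotalSpace.mk' F x (∑ i, a i x • s i x)) x₀ :=
      ContMDiffAt.sum_section (t := fun i x => a i x • s i x) fun i _ =>
        ContMDiffAt.smul_section (hsm i) (s i).contMDiff.contMDiffAt
    refine h1.congr_of_eventuallyEq ?_
    filter_upwards [hU] with x hx
    rw [← ha x hx]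
  · intro t
    let c : Fin (Module.finrank ℝ F) → C^∞⟮𝓡 n, M; ℝ⟯ := fun i =>
      ⟨fun x => f x • e.localFrameCoeff (𝓡 n) b i x (t x), by
        refine contMDiff_of_tsupport fun x hx => ?_
        have hx' : x ∈ e.baseSet := hf (tsupport_smul_subset_left _ _ hx)
        exact f.contMDiffAt.smul (contMDiffAt_localFrameCoeff b hx' t.contMDiff.contMDiffAt i)⟩
    refine ⟨c, ?_, ?_⟩
    · ext x
      have hsum : (∑ i, c i • s i : Sections n F E) x = ∑ i, c i x • s i x := by
        have := congrFun (map_sum (ContMDiffSection.coeAddHom (𝓡 n) F ∞ E)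
          (fun i => c i • s i) Finset.univ) x
        rw [Finset.sum_apply] at this
        exact this
      rw [hsum]
      change (f x * f x) • t x = ∑ i, (f x • e.localFrameCoeff (𝓡 n) b i x (t x)) •
        (f x • e.localFrame b i x)
      by_cases hx : x ∈ e.baseSet
      · conv_lhs => rw [hexp t x hx, Finset.smul_sum]
        refine Finset.sum_congr rfl fun i _ => ?_
        rw [smul_smul, smul_smul, smul_eq_mul]
        ring_nf
      · have : f x = 0 := by
          by_contra h
          exact hx (hf (subset_tsupport _ h))
        simp [this]
    · intro h0 i
      change f x₀ • e.localFrameCoeff (𝓡 n) b i x₀ (t x₀) = 0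
      rw [h0]; simp

/-- A map on sections that is linear over smooth functions at `x` is induced by a linear map on
the fibre over `x`. -/
theorem exists_fiber_map {V : Type*} [AddCommGroup V] [Module ℝ V] (x : M)
    (T : Sections n F E → V) (hadd : ∀ s t, T (s + t) = T s + T t)
    (hsmul : ∀ (f : C^∞⟮𝓡 n, M; ℝ⟯) s, T (f • s) = f x • T s) :
    ∃ φ : E x →ₗ[ℝ] V, ∀ s, φ (s x) = T s := by
  classical
  obtain ⟨ι, _, s, φ, U, hU, hφ, hb, -, hexp⟩ := exists_global_frame (n := n) (F := F) (E := E) x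
  have hconst : ∀ (c : ℝ) (t : Sections n F E), T (c • t) = c • T t := by
    intro c t
    let f : C^∞⟮𝓡 n, M; ℝ⟯ := ⟨fun _ => c, contMDiff_const⟩
    exact hsmul f t
  let L : Sections n F E →ₗ[ℝ] V :=
    { toFun := T
      map_add' := hadd
      map_smul' := hconst }
  have hL : ∀ t, L t = T t := fun _ => rfl
  let ev : Sections n F E →ₗ[ℝ] E x :=
    { toFun := fun t => t x
      map_add' := fun _ _ => rfl
      map_smul' := fun _ _ => rfl }
  have hev : Function.Surjective ev := by
    intro v
    obtain ⟨b, hb⟩ := hb x (mem_of_mem_nhds hU)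
    refine ⟨∑ i, b.repr v i • s i, ?_⟩
    rw [map_sum]
    conv_rhs => rw [← b.sum_repr v]
    refine Finset.sum_congr rfl fun i _ => ?_
    rw [map_smul, hb]; rfl
  have hker : ∀ t, ev t = 0 → L t = 0 := by
    intro t ht
    obtain ⟨c, hc, hc0⟩ := hexp t
    have h1 : L ((φ * φ) • t) = L t := by
      rw [hL, hsmul]
      change (φ x * φ x) • _ = _
      rw [hφ]; simp [hL]
    rw [← h1, hc, map_sum]
    refine Finset.sum_eq_zero fun i _ => ?_
    rw [hL, hsmul, hc0 ht, zero_smul]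
  obtain ⟨σ, hσ⟩ := ev.exists_rightInverse_of_surjective (LinearMap.range_eq_top.2 hev)
  refine ⟨L ∘ₗ σ, fun t => ?_⟩
  have h2 : ev (σ (t x) - t) = 0 := by
    rw [map_sub, show ev (σ (t x)) = t x from LinearMap.congr_fun hσ (t x)]
    exact sub_self _
  have h3 := hker _ h2
  rw [map_sub, sub_eq_zero] at h3
  exact h3

theorem exists_section_eq (x : M) (v : E x) : ∃ s : Sections n F E, s x = v := by
  obtain ⟨ι, _, s, φ, U, hU, hφ, hb, -, -⟩ := exists_global_frame (n := n) (F := F) (E := E) x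
  obtain ⟨b, hb⟩ := hb x (mem_of_mem_nhds hU)
  refine ⟨∑ i, b.repr v i • s i, ?_⟩
  have := congrFun (map_sum (ContMDiffSection.coeAddHom (𝓡 n) F ∞ E)
    (fun i => b.repr v i • s i) Finset.univ) x
  rw [Finset.sum_apply] at this
  refine this.trans ?_
  conv_rhs => rw [← b.sum_repr v]
  refine Finset.sum_congr rfl fun i _ => ?_
  rw [hb]; rfl

theorem contMDiffAt_det {ι : Type*} [Fintype ι] [DecidableEq ι] {G : M → Matrix ι ι ℝ} {x : M}
    (h : ∀ i j, ContMDiffAt (𝓡 n) 𝓘(ℝ, ℝ) ∞ (fun y => G y i j) x) :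
    ContMDiffAt (𝓡 n) 𝓘(ℝ, ℝ) ∞ (fun y => (G y).det) x := by
  simp only [Matrix.det_apply']
  refine contMDiffAt_finsetSum fun σ _ => ?_
  exact contMDiffAt_const.mul (contMDiffAt_finsetProd fun i _ => h _ _)

theorem exists_represents {V : Type*} [AddCommGroup V] [Module ℝ V] [TopologicalSpace V]
    [FiniteDimensional ℝ V] (B : V →L[ℝ] V →L[ℝ] ℝ)
    (hnd : ∀ v, (∀ w, B v w = 0) → v = 0) (φ : V →ₗ[ℝ] ℝ) : ∃ v, ∀ w, B v w = φ w := by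
  let b : V →ₗ[ℝ] Module.Dual ℝ V :=
    { toFun := fun v => (B v : V →ₗ[ℝ] ℝ)
      map_add' := fun v w => by ext; simp
      map_smul' := fun c w => by ext; simp }
  have hinj : Function.Injective b := by
    rw [← LinearMap.ker_eq_bot, LinearMap.ker_eq_bot']
    intro v hv
    exact hnd v fun w => LinearMap.congr_fun hv w
  obtain ⟨v, hv⟩ := (LinearMap.injective_iff_surjective_of_finrank_eq_finrank
    (Subspace.dual_finrank_eq (K := ℝ) (V := V)).symm).1 hinj φ
  exact ⟨v, fun w => LinearMap.congr_fun hv w⟩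

/-- A smooth nondegenerate bilinear form identifies sections with functionals on sections that are
linear over smooth functions. -/
theorem exists_section_of_functional (B : ∀ x, E x →L[ℝ] E x →L[ℝ] ℝ)
    (hB : ∀ s t : Sections n F E, ContMDiff (𝓡 n) 𝓘(ℝ, ℝ) ∞ fun x => B x (s x) (t x))
    (hnd : ∀ x v, (∀ w, B x v w = 0) → v = 0)
    (T : Sections n F E → M → ℝ) (hT : ∀ s, ContMDiff (𝓡 n) 𝓘(ℝ, ℝ) ∞ (T s))
    (hadd : ∀ s t x, T (s + t) x = T s x + T t x)
    (hsmul : ∀ (f : C^∞⟮𝓡 n, M; ℝ⟯) s x, T (f • s) x = f x * T s x) :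
    ∃ u : Sections n F E, ∀ s x, B x (u x) (s x) = T s x := by
  classical
  have key : ∀ x, ∃ v : E x, ∀ s : Sections n F E, B x v (s x) = T s x := by
    intro x
    obtain ⟨φ, hφ⟩ := exists_fiber_map (n := n) (F := F) (E := E) x (fun s => T s x)
      (fun s t => hadd s t x) (fun f s => hsmul f s x)
    have : FiniteDimensional ℝ (E x) := VectorBundle.finiteDimensional ℝ F E x
    obtain ⟨v, hv⟩ := exists_represents (B x) (hnd x) φ
    exact ⟨v, fun s => (hv (s x)).trans (hφ s)⟩
  choose u hu using key
  refine ⟨⟨u, fun x₀ => ?_⟩, fun s x => hu x s⟩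
  obtain ⟨ι, _, s, φ, U, hU, -, hb, hsm, -⟩ :=
    exists_global_frame (n := n) (F := F) (E := E) x₀
  let G : M → Matrix ι ι ℝ := fun x i j => B x (s j x) (s i x)
  let lam : M → ι → ℝ := fun x i => T (s i) x
  have hG : ∀ i j, ContMDiff (𝓡 n) 𝓘(ℝ, ℝ) ∞ fun x => G x i j := fun i j => hB _ _
  have hdet : ∀ x ∈ U, (G x).det ≠ 0 := by
    intro x hx h0
    obtain ⟨v, hv, hGv⟩ := Matrix.exists_mulVec_eq_zero_iff.2 h0
    obtain ⟨b, hb⟩ := hb x hx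
    have hz : ∑ j, v j • b j = 0 := by
      refine hnd x _ fun w => ?_
      rw [← b.sum_repr w, map_sum]
      refine Finset.sum_eq_zero fun i _ => ?_
      have := congrFun hGv i
      simp only [Matrix.mulVec, dotProduct, G, Pi.zero_apply] at this
      rw [map_smul, map_sum, _root_.sum_apply]
      simp only [map_smul, _root_.smul_apply, hb, smul_eq_mul]
      rw [← mul_zero (b.repr w i), ← this]
      congr 1
      exact Finset.sum_congr rfl fun j _ => mul_comm _ _
    exact hv (funext fun j => Fintype.linearIndependent_iff.1 b.linearIndependent v hz j)
  refine hsm u (fun i x => ((G x).updateCol i (lam x)).det / (G x).det) ?_ ?_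
  · intro x hx
    obtain ⟨b, hb⟩ := hb x hx
    rw [← b.sum_repr (u x)]
    refine Finset.sum_congr rfl fun i _ => ?_
    rw [hb]
    congr 1
    rw [eq_div_iff (hdet x hx), ← Matrix.cramer_apply]
    have hlam : lam x = (G x).mulVec (b.repr (u x)) := by
      funext k
      simp only [lam, Matrix.mulVec, dotProduct, G]
      rw [← hu x (s k)]
      conv_lhs => rw [← b.sum_repr (u x), map_sum, _root_.sum_apply]
      simp only [map_smul, _root_.smul_apply, hb, smul_eq_mul]
      exact Finset.sum_congr rfl fun j _ => mul_comm _ _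
    rw [hlam, ← Matrix.det_smul_inv_mulVec_eq_cramer _ _ (isUnit_iff_ne_zero.2 (hdet x hx)),
      Matrix.mulVec_mulVec, Matrix.nonsing_inv_mul _ (isUnit_iff_ne_zero.2 (hdet x hx)),
      Matrix.one_mulVec, Pi.smul_apply, smul_eq_mul, mul_comm]
  · intro i
    refine ContMDiffAt.div₀ (contMDiffAt_det fun k l => ?_)
      (contMDiffAt_det fun k l => (hG k l).contMDiffAt) (hdet x₀ (mem_of_mem_nhds hU))
    simp only [Matrix.updateCol_apply]
    split_ifs
    · exact (hT _).contMDiffAt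
    · exact (hG k l).contMDiffAt

/-! ### Courant algebroids -/

theorem contMDiff_form {B : ∀ x, E x →L[ℝ] E x →L[ℝ] ℝ}
    (hB : ContMDiff (𝓡 n) ((𝓡 n).prod 𝓘(ℝ, F →L[ℝ] F →L[ℝ] ℝ)) ∞
      (fun x => TotalSpace.mk' (F →L[ℝ] F →L[ℝ] ℝ) x (B x))) (s t : Sections n F E) :
    ContMDiff (𝓡 n) 𝓘(ℝ, ℝ) ∞ fun x => B x (s x) (t x) := by
  have h : ContMDiff (𝓡 n) ((𝓡 n).prod 𝓘(ℝ, ℝ)) ∞ (fun x =>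
      TotalSpace.mk' ℝ (E := Bundle.Trivial M ℝ) x (B x (s x) (t x))) :=
    ContMDiff.clm_bundle_apply₂ (F₁ := F) (F₂ := F) hB s.contMDiff t.contMDiff
  exact fun x => ((Bundle.contMDiffAt_section _).1 (h x))

theorem mdifferentiable_of_contMDiff {f : M → ℝ} (hf : ContMDiff (𝓡 n) 𝓘(ℝ, ℝ) ∞ f) (x : M) :
    MDifferentiableAt (𝓡 n) 𝓘(ℝ, ℝ) f x :=
  hf.mdifferentiable (by simp) x

/-- The derivative of a smooth function along a smooth vector field is smooth. -/
theorem contMDiff_mvfderiv_apply {f : M → ℝ} (hf : ContMDiff (𝓡 n) 𝓘(ℝ, ℝ) ∞ f)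
    (X : Cₛ^∞⟮𝓡 n; EuclideanSpace ℝ (Fin n), (TangentSpace (𝓡 n) : M → Type _)⟯) :
    ContMDiff (𝓡 n) 𝓘(ℝ, ℝ) ∞ fun x => mvfderiv (𝓡 n) f x (X x) :=
  (contMDiff_snd_tangentBundle_modelSpace ℝ 𝓘(ℝ, ℝ)).comp
    ((hf.contMDiff_tangentMap (m := ∞) (by simp)).comp X.contMDiff)

variable (n F E) in
/-- A Courant algebroid structure on the smooth vector bundle `E → M`: a smooth nondegenerate
symmetric bilinear form on the fibres, a smooth bundle map `ρ : E → TM` and a bracket on `Γ(E)`.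
`mvfderiv (𝓡 n) f x (anchor x v)` is the derivative of the function `f` along `ρ(v)`. -/
structure CourantAlgebroid where
  pairing (x : M) : E x →L[ℝ] E x →L[ℝ] ℝ
  pairing_symm (x : M) (v w : E x) : pairing x v w = pairing x w v
  pairing_nondegenerate (x : M) (v : E x) : (∀ w, pairing x v w = 0) → v = 0
  contMDiff_pairing : ContMDiff (𝓡 n) ((𝓡 n).prod 𝓘(ℝ, F →L[ℝ] F →L[ℝ] ℝ)) ∞
    (fun x => TotalSpace.mk' (F →L[ℝ] F →L[ℝ] ℝ) x (pairing x))
  anchor (x : M) : E x →L[ℝ] TangentSpace (𝓡 n) x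
  contMDiff_anchor :
    ContMDiff (𝓡 n) ((𝓡 n).prod 𝓘(ℝ, F →L[ℝ] EuclideanSpace ℝ (Fin n))) ∞
      (fun x => TotalSpace.mk' (F →L[ℝ] EuclideanSpace ℝ (Fin n))
        (E := fun x => E x →L[ℝ] TangentSpace (𝓡 n) x) x (anchor x))
  bracket : Sections n F E →ₗ[ℝ] Sections n F E →ₗ[ℝ] Sections n F E
  /-- `⟦e₁, f e₂⟧ = ρ(e₁)(f) e₂ + f ⟦e₁, e₂⟧` -/
  bracket_leibniz (e₁ e₂ : Sections n F E) (f : C^∞⟮𝓡 n, M; ℝ⟯) (x : M) :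
    bracket e₁ (f • e₂) x =
      mvfderiv (𝓡 n) f x (anchor x (e₁ x)) • e₂ x + f x • bracket e₁ e₂ x
  /-- `ρ(e₁)⟨e₂, e₃⟩ = ⟨⟦e₁, e₂⟧, e₃⟩ + ⟨e₂, ⟦e₁, e₃⟧⟩` -/
  pairing_invariant (e₁ e₂ e₃ : Sections n F E) (x : M) :
    mvfderiv (𝓡 n) (fun y => pairing y (e₂ y) (e₃ y)) x (anchor x (e₁ x)) =
      pairing x (bracket e₁ e₂ x) (e₃ x) + pairing x (e₂ x) (bracket e₁ e₃ x)
  bracket_jacobi (e₁ e₂ e₃ : Sections n F E) :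
    bracket (bracket e₁ e₂) e₃ = bracket e₁ (bracket e₂ e₃) - bracket e₂ (bracket e₁ e₃)
  /-- `⟦e₁, e₂⟧ + ⟦e₂, e₁⟧ = 𝒟⟨e₁, e₂⟩`, where `⟨𝒟 f, e⟩ = ρ(e)(f)` -/
  bracket_symm (e₁ e₂ e : Sections n F E) (x : M) :
    pairing x (bracket e₁ e₂ x + bracket e₂ e₁ x) (e x) =
      mvfderiv (𝓡 n) (fun y => pairing y (e₁ y) (e₂ y)) x (anchor x (e x))

namespace CourantAlgebroid

variable (A : CourantAlgebroid n F E)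

/-- The smooth function `⟨s, t⟩`. -/
def pairFun (s t : Sections n F E) : C^∞⟮𝓡 n, M; ℝ⟯ :=
  ⟨fun x => A.pairing x (s x) (t x), contMDiff_form A.contMDiff_pairing s t⟩

/-- The section `ρ(e)` of the tangent bundle. -/
def anchorSection (e : Sections n F E) :
    Cₛ^∞⟮𝓡 n; EuclideanSpace ℝ (Fin n), (TangentSpace (𝓡 n) : M → Type _)⟯ :=
  ⟨fun x => A.anchor x (e x), A.contMDiff_anchor.clm_bundle_apply e.contMDiff⟩

/-- The derivative `ρ(e)(f)` of a function `f` along `ρ(e)`. -/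
def lieDeriv (e : Sections n F E) (f : M → ℝ) (x : M) : ℝ :=
  mvfderiv (𝓡 n) f x (A.anchor x (e x))

theorem exists_coanchor (x : M) (α : TangentSpace (𝓡 n) x →ₗ[ℝ] ℝ) :
    ∃ v : E x, ∀ w, A.pairing x v w = α (A.anchor x w) := by
  have : FiniteDimensional ℝ (E x) := VectorBundle.finiteDimensional ℝ F E x
  exact exists_represents (A.pairing x) (A.pairing_nondegenerate x)
    (α ∘ₗ (A.anchor x : E x →ₗ[ℝ] TangentSpace (𝓡 n) x))

/-- The map `ρ^* : T^*M → E^* ≅ E`, characterised by `⟨ρ^* α, w⟩ = α(ρ(w))`. -/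
def coanchor (x : M) (α : TangentSpace (𝓡 n) x →ₗ[ℝ] ℝ) : E x :=
  (A.exists_coanchor x α).choose

theorem pairing_coanchor (x : M) (α : TangentSpace (𝓡 n) x →ₗ[ℝ] ℝ) (w : E x) :
    A.pairing x (A.coanchor x α) w = α (A.anchor x w) :=
  (A.exists_coanchor x α).choose_spec w

theorem eq_of_pairing {x : M} {v w : E x} (h : ∀ u, A.pairing x v u = A.pairing x w u) :
    v = w := by
  rw [← sub_eq_zero]
  refine A.pairing_nondegenerate x _ fun u => ?_
  rw [map_sub, _root_.sub_apply, h, sub_self]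

/-- An `E`-connection on `E`. -/
structure EConnection where
  toFun : Sections n F E →ₗ[ℝ] Sections n F E →ₗ[ℝ] Sections n F E
  leibniz (e b : Sections n F E) (f : C^∞⟮𝓡 n, M; ℝ⟯) (x : M) :
    toFun e (f • b) x = f x • toFun e b x + A.lieDeriv e f x • b x
  smul_left (e b : Sections n F E) (f : C^∞⟮𝓡 n, M; ℝ⟯) : toFun (f • e) b = f • toFun e b


variable {A} in
/-- An `E`-connection is a map `Γ(E) × Γ(E) → Γ(E)`, written `D e b`. -/
instance : CoeFun A.EConnection fun _ => Sections n F E → (Sections n F E →ₗ[ℝ] Sections n F E) :=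
  ⟨fun D => ⇑D.toFun⟩

theorem contMDiff_lieDeriv (e : Sections n F E) {f : M → ℝ}
    (hf : ContMDiff (𝓡 n) 𝓘(ℝ, ℝ) ∞ f) : ContMDiff (𝓡 n) 𝓘(ℝ, ℝ) ∞ (A.lieDeriv e f) :=
  contMDiff_mvfderiv_apply hf (A.anchorSection e)

theorem lieDeriv_add (e : Sections n F E) {f h : M → ℝ} (hf : ContMDiff (𝓡 n) 𝓘(ℝ, ℝ) ∞ f)
    (hh : ContMDiff (𝓡 n) 𝓘(ℝ, ℝ) ∞ h) (x : M) :
    A.lieDeriv e (fun y => f y + h y) x = A.lieDeriv e f x + A.lieDeriv e h x := by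
  have := mvfderiv_add (mdifferentiable_of_contMDiff hf x) (mdifferentiable_of_contMDiff hh x)
  exact congrArg (fun L => L (A.anchor x (e x))) this

theorem lieDeriv_mul (e : Sections n F E) {f h : M → ℝ} (hf : ContMDiff (𝓡 n) 𝓘(ℝ, ℝ) ∞ f)
    (hh : ContMDiff (𝓡 n) 𝓘(ℝ, ℝ) ∞ h) (x : M) :
    A.lieDeriv e (fun y => f y * h y) x = f x * A.lieDeriv e h x + h x * A.lieDeriv e f x := by
  have := mvfderiv_mul (mdifferentiable_of_contMDiff hf x) (mdifferentiable_of_contMDiff hh x)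
  exact congrArg (fun L => L (A.anchor x (e x))) this

theorem lieDeriv_const (e : Sections n F E) (c : ℝ) (x : M) :
    A.lieDeriv e (fun _ => c) x = 0 := by
  unfold lieDeriv
  rw [mvfderiv_const]; rfl

/-! ### The connection `∇^E` -/

section Bott

variable (cov : CovariantDerivative (𝓡 n) F E) [hcov : CovariantDerivative.ContMDiffCovariantDerivative cov ∞]

theorem cov_add (e e' : Sections n F E) (x : M) : cov (e + e' : Sections n F E) x =
    cov e x + cov e' x :=
  cov.isCovariantDerivativeOnUniv.add e.mdifferentiableAt e'.mdifferentiableAt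

theorem cov_smul (f : C^∞⟮𝓡 n, M; ℝ⟯) (e : Sections n F E) (x : M)
    (v : TangentSpace (𝓡 n) x) : cov (f • e : Sections n F E) x v =
      f x • cov e x v + mvfderiv (𝓡 n) f x v • e x := by
  have := cov.isCovariantDerivativeOnUniv.leibniz (x := x) (g := f) e.mdifferentiableAt
    (mdifferentiable_of_contMDiff f.contMDiff x)
  exact congrArg (fun L => L v) this

theorem contMDiff_cov (e e' : Sections n F E) :
    ContMDiff (𝓡 n) ((𝓡 n).prod 𝓘(ℝ, F)) ∞
      (fun x => TotalSpace.mk' F x (cov e x (A.anchor x (e' x)))) := by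
  have h := hcov.contMDiff.contMDiff (σ := e) (by
    rw [contMDiffOn_univ]; exact e.contMDiff)
  rw [contMDiffOn_univ] at h
  exact ContMDiff.clm_bundle_apply (F₁ := EuclideanSpace ℝ (Fin n)) h
    (A.anchorSection e').contMDiff

/-- `⟨∇ e, e'⟩` as a covector at `x`: the map `X ↦ ⟨∇_X e, e'⟩`. -/
def covPairing (e e' : Sections n F E) (x : M) : TangentSpace (𝓡 n) x →ₗ[ℝ] ℝ where
  toFun X := A.pairing x (cov e x X) (e' x)
  map_add' X Y := by simp
  map_smul' c X := by simp

theorem contMDiff_coanchor (e e' : Sections n F E) :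
    ContMDiff (𝓡 n) ((𝓡 n).prod 𝓘(ℝ, F)) ∞
      (fun x => TotalSpace.mk' F x (A.coanchor x (A.covPairing cov e e' x))) := by
  let c (s : Sections n F E) : Sections n F E := ⟨_, A.contMDiff_cov cov e s⟩
  obtain ⟨u, hu⟩ := exists_section_of_functional A.pairing
    (contMDiff_form A.contMDiff_pairing) A.pairing_nondegenerate
    (fun s x => A.pairing x (c s x) (e' x))
    (fun s => contMDiff_form A.contMDiff_pairing _ _)
    (fun s t x => by simp [c])
    (fun f s x => by simp [c])
  have hux : ∀ x, u x = A.coanchor x (A.covPairing cov e e' x) := by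
    intro x
    refine A.eq_of_pairing fun w => ?_
    obtain ⟨s, rfl⟩ := exists_section_eq (n := n) (F := F) x w
    rw [hu, pairing_coanchor]
    rfl
  simp only [← hux]
  exact u.contMDiff

/-- The section `⟦e, e'⟧ + ∇_{ρ(e')} e - ρ^*⟨∇ e, e'⟩`. -/
def bottFun (e e' : Sections n F E) : Sections n F E :=
  A.bracket e e' + ⟨fun x => cov e x (A.anchor x (e' x)), A.contMDiff_cov cov e e'⟩ -
    ⟨fun x => A.coanchor x (A.covPairing cov e e' x), A.contMDiff_coanchor cov e e'⟩

theorem pairing_bottFun (e e' : Sections n F E) (x : M) (w : E x) :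
    A.pairing x (A.bottFun cov e e' x) w = A.pairing x (A.bracket e e' x) w +
      A.pairing x (cov e x (A.anchor x (e' x))) w -
        A.pairing x (cov e x (A.anchor x w)) (e' x) := by
  have : A.bottFun cov e e' x = A.bracket e e' x + cov e x (A.anchor x (e' x)) -
    A.coanchor x (A.covPairing cov e e' x) := rfl
  rw [this, map_sub, map_add, _root_.sub_apply, _root_.add_apply, pairing_coanchor]
  rfl

theorem bottFun_smul_left (f : C^∞⟮𝓡 n, M; ℝ⟯) (e e' : Sections n F E) :
    A.bottFun cov (f • e) e' = f • A.bottFun cov e e' := by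
  ext x
  refine A.eq_of_pairing fun w => ?_
  obtain ⟨s, rfl⟩ := exists_section_eq (n := n) (F := F) x w
  rw [smul_sections_apply, map_smul, _root_.smul_apply, pairing_bottFun, pairing_bottFun,
    cov_smul, cov_smul]
  have h1 := A.bracket_symm (f • e) e' s x
  have h2 := A.bracket_symm e e' s x
  have h3 : mvfderiv (𝓡 n) (fun y => A.pairing y ((f • e) y) (e' y)) x (A.anchor x (s x)) =
      f x * mvfderiv (𝓡 n) (fun y => A.pairing y (e y) (e' y)) x (A.anchor x (s x)) +
        A.pairing x (e x) (e' x) * mvfderiv (𝓡 n) f x (A.anchor x (s x)) := by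
    have := A.lieDeriv_mul s f.contMDiff (A.pairFun e e').contMDiff x
    simp only [smul_sections_apply, map_smul, _root_.smul_apply, smul_eq_mul]
    exact this
  rw [h3, A.bracket_leibniz] at h1
  simp only [map_add, map_smul, _root_.add_apply, _root_.smul_apply, smul_eq_mul] at h1 h2 ⊢
  linear_combination h1 - f x * h2

theorem bottFun_add_left (e₁ e₂ e' : Sections n F E) :
    A.bottFun cov (e₁ + e₂) e' = A.bottFun cov e₁ e' + A.bottFun cov e₂ e' := by
  ext x
  refine A.eq_of_pairing fun w => ?_
  rw [ContMDiffSection.coe_add, Pi.add_apply, map_add, _root_.add_apply]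
  simp only [pairing_bottFun, ContMDiffSection.coe_add, Pi.add_apply, map_add,
    LinearMap.add_apply, _root_.add_apply]
  have h := cov_add cov e₁ e₂ x
  rw [ContMDiffSection.coe_add] at h
  simp only [h, _root_.add_apply, map_add]
  ring

theorem bottFun_leibniz (e e' : Sections n F E) (f : C^∞⟮𝓡 n, M; ℝ⟯) (x : M) :
    A.bottFun cov e (f • e') x = f x • A.bottFun cov e e' x + A.lieDeriv e f x • e' x := by
  refine A.eq_of_pairing fun w => ?_
  rw [map_add, map_smul, map_smul, _root_.add_apply, _root_.smul_apply, _root_.smul_apply,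
    pairing_bottFun, pairing_bottFun, A.bracket_leibniz]
  simp only [smul_sections_apply, map_add, map_smul, _root_.add_apply, _root_.smul_apply,
    smul_eq_mul, lieDeriv]
  ring

theorem bottFun_add_right (e e₁ e₂ : Sections n F E) :
    A.bottFun cov e (e₁ + e₂) = A.bottFun cov e e₁ + A.bottFun cov e e₂ := by
  ext x
  refine A.eq_of_pairing fun w => ?_
  rw [ContMDiffSection.coe_add, Pi.add_apply, map_add, _root_.add_apply]
  simp only [pairing_bottFun, ContMDiffSection.coe_add, Pi.add_apply, map_add, _root_.add_apply]
  ring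

/-- The `E`-connection `∇^E_e e' = ⟦e, e'⟧ + ∇_{ρ(e')} e - ρ^*⟨∇ e, e'⟩` on `E` induced by a
smooth linear connection `∇` on `E`. -/
def bott : A.EConnection where
  toFun := LinearMap.mk₂ ℝ (A.bottFun cov) (A.bottFun_add_left cov)
    (fun c e e' => by
      let f : C^∞⟮𝓡 n, M; ℝ⟯ := ⟨fun _ => c, contMDiff_const⟩
      exact A.bottFun_smul_left cov f e e')
    (A.bottFun_add_right cov)
    (fun c e e' => by
      let f : C^∞⟮𝓡 n, M; ℝ⟯ := ⟨fun _ => c, contMDiff_const⟩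
      ext x
      refine (A.bottFun_leibniz cov e e' f x).trans ?_
      have : A.lieDeriv e f x = 0 := A.lieDeriv_const e c x
      rw [this, zero_smul, add_zero]
      rfl)
  leibniz e b f x := A.bottFun_leibniz cov e b f x
  smul_left e b f := A.bottFun_smul_left cov f e b

end Bott

/-! ### The adjoint connection -/

section Adjoint

variable {A} (D : A.EConnection) (g : ContMDiffRiemannianMetric (𝓡 n) ∞ F E)

theorem eq_of_metric {x : M} {v w : E x} (h : ∀ u, g.inner x v u = g.inner x w u) : v = w := by
  by_contra hne
  have := g.pos x (v - w) (sub_ne_zero.2 hne)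
  rw [map_sub (g.inner x), _root_.sub_apply, h, sub_self] at this
  exact lt_irrefl _ this

theorem exists_adjoint (e b : Sections n F E) : ∃ u : Sections n F E, ∀ s x,
    g.inner x (u x) (s x) =
      A.lieDeriv e (fun y => g.inner y (b y) (s y)) x - g.inner x (b x) (D e s x) := by
  have hsm := contMDiff_form (n := n) (F := F) g.contMDiff
  refine exists_section_of_functional g.inner hsm (fun x v hv => ?_) _ (fun s => ?_) ?_ ?_
  · by_contra hne
    exact (g.pos x v hne).ne' (hv v)
  · exact (A.contMDiff_lieDeriv e (hsm b s)).sub (hsm b _)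
  · intro s t x
    have := A.lieDeriv_add e (hsm b s) (hsm b t) x
    simp only [map_add, ContMDiffSection.coe_add, Pi.add_apply] at this ⊢
    rw [this]
    ring
  · intro f s x
    have := A.lieDeriv_mul e f.contMDiff (hsm b s) x
    simp only [smul_sections_apply, map_smul, D.leibniz, map_add, smul_eq_mul] at this ⊢
    rw [this]
    ring

/-- The section `∇^g_e b`. -/
def adjointFun (e b : Sections n F E) : Sections n F E := (exists_adjoint D g e b).choose

theorem inner_adjointFun (e b s : Sections n F E) (x : M) : g.inner x (adjointFun D g e b x) (s x) =
    A.lieDeriv e (fun y => g.inner y (b y) (s y)) x - g.inner x (b x) (D e s x) :=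
  (exists_adjoint D g e b).choose_spec s x

theorem adjointFun_smul_left (f : C^∞⟮𝓡 n, M; ℝ⟯) (e b : Sections n F E) :
    adjointFun D g (f • e) b = f • adjointFun D g e b := by
  ext x
  refine eq_of_metric g fun w => ?_
  obtain ⟨s, rfl⟩ := exists_section_eq (n := n) (F := F) x w
  rw [inner_adjointFun, D.smul_left, smul_sections_apply f (adjointFun D g e b),
    map_smul (g.inner x), _root_.smul_apply, inner_adjointFun]
  simp only [smul_sections_apply, map_smul, smul_eq_mul, lieDeriv]
  ring

theorem adjointFun_add_left (e₁ e₂ b : Sections n F E) :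
    adjointFun D g (e₁ + e₂) b = adjointFun D g e₁ b + adjointFun D g e₂ b := by
  ext x
  refine eq_of_metric g fun w => ?_
  obtain ⟨s, rfl⟩ := exists_section_eq (n := n) (F := F) x w
  rw [ContMDiffSection.coe_add, Pi.add_apply, map_add, _root_.add_apply]
  simp only [inner_adjointFun, lieDeriv, map_add, LinearMap.add_apply, ContMDiffSection.coe_add,
    Pi.add_apply]
  ring

theorem adjointFun_leibniz (e b : Sections n F E) (f : C^∞⟮𝓡 n, M; ℝ⟯) (x : M) :
    adjointFun D g e (f • b) x = f x • adjointFun D g e b x + A.lieDeriv e f x • b x := by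
  refine eq_of_metric g fun w => ?_
  obtain ⟨s, rfl⟩ := exists_section_eq (n := n) (F := F) x w
  have := A.lieDeriv_mul e f.contMDiff (contMDiff_form (n := n) (F := F) g.contMDiff b s) x
  rw [map_add, map_smul, map_smul, _root_.add_apply, _root_.smul_apply, _root_.smul_apply]
  simp only [inner_adjointFun, smul_sections_apply, map_smul, _root_.smul_apply, smul_eq_mul]
    at this ⊢
  rw [this]
  ring

theorem adjointFun_add_right (e b₁ b₂ : Sections n F E) :
    adjointFun D g e (b₁ + b₂) = adjointFun D g e b₁ + adjointFun D g e b₂ := by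
  ext x
  refine eq_of_metric g fun w => ?_
  obtain ⟨s, rfl⟩ := exists_section_eq (n := n) (F := F) x w
  have hsm := contMDiff_form (n := n) (F := F) g.contMDiff
  have := A.lieDeriv_add e (hsm b₁ s) (hsm b₂ s) x
  rw [ContMDiffSection.coe_add, Pi.add_apply, map_add, _root_.add_apply]
  simp only [inner_adjointFun, map_add, _root_.add_apply, ContMDiffSection.coe_add,
    Pi.add_apply] at this ⊢
  rw [this]
  ring

/-- The adjoint `∇^g` of an `E`-connection `∇` on `E` with respect to a positive definite
metric `g`. -/
def EConnection.adjoint : A.EConnection where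
  toFun := LinearMap.mk₂ ℝ (adjointFun D g) (adjointFun_add_left D g)
    (fun c e e' => by
      let f : C^∞⟮𝓡 n, M; ℝ⟯ := ⟨fun _ => c, contMDiff_const⟩
      exact adjointFun_smul_left D g f e e')
    (adjointFun_add_right D g)
    (fun c e e' => by
      let f : C^∞⟮𝓡 n, M; ℝ⟯ := ⟨fun _ => c, contMDiff_const⟩
      ext x
      refine (adjointFun_leibniz D g e e' f x).trans ?_
      have : A.lieDeriv e f x = 0 := A.lieDeriv_const e c x
      rw [this, zero_smul, add_zero]
      rfl)
  leibniz e b f x := adjointFun_leibniz D g e b f x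
  smul_left e b f := adjointFun_smul_left D g f e b

/-- The defining property `g(∇_{e₁} e₂, e₃) + g(e₂, ∇^g_{e₁} e₃) = ρ(e₁) g(e₂, e₃)`. -/
theorem EConnection.adjoint_spec (e₁ e₂ e₃ : Sections n F E) (x : M) :
    g.inner x (D e₁ e₂ x) (e₃ x) + g.inner x (e₂ x) (D.adjoint g e₁ e₃ x) =
      A.lieDeriv e₁ (fun y => g.inner y (e₂ y) (e₃ y)) x := by
  have h := inner_adjointFun D g e₁ e₃ e₂ x
  rw [g.symm x (e₂ x)]
  change _ + g.inner x (adjointFun D g e₁ e₃ x) (e₂ x) = _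
  rw [h, g.symm x (e₃ x)]
  simp only [g.symm _ (e₃ _)]
  ring

end Adjoint

/-! ### Cochains and cohomology -/

/-- The condition that `α` has a symbol: exchanging two adjacent arguments changes the sign of `α`
up to a term `σ(…)⟨eᵢ, eᵢ₊₁⟩`, where `σ` takes values in the vector fields on `M`, regarded as
derivations of the algebra of smooth functions. -/
def HasSymbol : (k : ℕ) → ((Fin k → Sections n F E) → M → ℝ) → Prop
  | 0, _ => True
  | 1, _ => True
  | k + 2, α => ∃ σ : (Fin k → Sections n F E) →
      Derivation ℝ C^∞⟮𝓡 n, M; ℝ⟯ C^∞⟮𝓡 n, M; ℝ⟯,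
      ∀ (e : Fin (k + 2) → Sections n F E) (i : Fin (k + 1)) (x : M),
        α e x + α (e ∘ Equiv.swap i.castSucc i.succ) x =
          σ (fun j => e (i.castSucc.succAbove (i.succAbove j)))
            (A.pairFun (e i.castSucc) (e i.succ)) x

/-- The `k`-cochains on `E`. For `k = 0` these are the smooth functions on `M`. -/
structure IsCochain (k : ℕ) (α : (Fin k → Sections n F E) → M → ℝ) : Prop where
  contMDiff : ∀ e, ContMDiff (𝓡 n) 𝓘(ℝ, ℝ) ∞ (α e)
  map_add_last : ∀ (i : Fin k), (i : ℕ) + 1 = k → ∀ (e : Fin k → Sections n F E) s t x,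
    α (Function.update e i (s + t)) x =
      α (Function.update e i s) x + α (Function.update e i t) x
  map_smul_last : ∀ (i : Fin k), (i : ℕ) + 1 = k → ∀ (e : Fin k → Sections n F E)
    (f : C^∞⟮𝓡 n, M; ℝ⟯) s x,
    α (Function.update e i (f • s)) x = f x * α (Function.update e i s) x
  hasSymbol : A.HasSymbol k α

variable {A}

theorem HasSymbol.add : ∀ {k : ℕ} {α τ : (Fin k → Sections n F E) → M → ℝ},
    A.HasSymbol k α → A.HasSymbol k τ → A.HasSymbol k (α + τ)
  | 0, _, _, _, _ => trivial
  | 1, _, _, _, _ => trivial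
  | k + 2, α, τ, ⟨σ, hσ⟩, ⟨σ', hσ'⟩ => by
    refine ⟨fun e => σ e + σ' e, fun e i x => ?_⟩
    have h1 := hσ e i x
    have h2 := hσ' e i x
    simp only [Pi.add_apply, Derivation.add_apply, ContMDiffMap.coe_add]
    rw [← h1, ← h2]
    ring

theorem HasSymbol.smul (c : ℝ) : ∀ {k : ℕ} {α : (Fin k → Sections n F E) → M → ℝ},
    A.HasSymbol k α → A.HasSymbol k (c • α)
  | 0, _, _ => trivial
  | 1, _, _ => trivial
  | k + 2, α, ⟨σ, hσ⟩ => by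
    refine ⟨fun e => c • σ e, fun e i x => ?_⟩
    have h1 := hσ e i x
    simp only [Pi.smul_apply, Derivation.smul_apply, ContMDiffMap.coe_smul, smul_eq_mul]
    rw [← h1]
    ring

theorem HasSymbol.zero : ∀ {k : ℕ}, A.HasSymbol k 0
  | 0 => trivial
  | 1 => trivial
  | k + 2 => ⟨fun _ => 0, fun _ _ _ => by simp⟩

variable (A)

/-- The space `C^k(E)`. -/
def cochains (k : ℕ) : Submodule ℝ ((Fin k → Sections n F E) → M → ℝ) where
  carrier := {α | A.IsCochain k α}
  add_mem' {α τ} hα hτ :=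
    { contMDiff := fun e => (hα.contMDiff e).add (hτ.contMDiff e)
      map_add_last := fun i hi e s t x => by
        simp only [Pi.add_apply, hα.map_add_last i hi, hτ.map_add_last i hi]; ring
      map_smul_last := fun i hi e f s x => by
        simp only [Pi.add_apply, hα.map_smul_last i hi, hτ.map_smul_last i hi]; ring
      hasSymbol := hα.hasSymbol.add hτ.hasSymbol }
  zero_mem' :=
    { contMDiff := fun _ => contMDiff_const
      map_add_last := fun i hi e s t x => by simp
      map_smul_last := fun i hi e f s x => by simp
      hasSymbol := HasSymbol.zero }
  smul_mem' c α hα :=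
    { contMDiff := fun e => contMDiff_const.mul (hα.contMDiff e)
      map_add_last := fun i hi e s t x => by
        simp only [Pi.smul_apply, smul_eq_mul, hα.map_add_last i hi]; ring
      map_smul_last := fun i hi e f s x => by
        simp only [Pi.smul_apply, smul_eq_mul, hα.map_smul_last i hi]; ring
      hasSymbol := hα.hasSymbol.smul c }

/-- The differential, by the Cartan formula
`(d α)(e₀, …, eₖ) = ∑ᵢ (-1)ⁱ ρ(eᵢ) α(e₀, …, êᵢ, …, eₖ)
  - ∑_{i < j} (-1)ⁱ α(e₀, …, êᵢ, …, ⟦eᵢ, eⱼ⟧, …, eₖ)`, with the bracket in the place of `eⱼ`. -/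
def d (k : ℕ) (α : (Fin k → Sections n F E) → M → ℝ) :
    (Fin (k + 1) → Sections n F E) → M → ℝ := fun e x =>
  (∑ i : Fin (k + 1), (-1) ^ (i : ℕ) * A.lieDeriv (e i) (α fun j => e (i.succAbove j)) x) -
    ∑ i : Fin (k + 1), ∑ j : Fin (k + 1) with i < j, (-1) ^ (i : ℕ) *
      α (fun l => Function.update e j (A.bracket (e i) (e j)) (i.succAbove l)) x

theorem d_add {k : ℕ} {α τ : (Fin k → Sections n F E) → M → ℝ} (hα : A.IsCochain k α)
    (hτ : A.IsCochain k τ) : A.d k (α + τ) = A.d k α + A.d k τ := by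
  funext e x
  have h : ∀ i : Fin (k + 1), A.lieDeriv (e i) ((α + τ) fun j => e (i.succAbove j)) x =
      A.lieDeriv (e i) (α fun j => e (i.succAbove j)) x +
        A.lieDeriv (e i) (τ fun j => e (i.succAbove j)) x := fun i =>
    A.lieDeriv_add (e i) (hα.contMDiff _) (hτ.contMDiff _) x
  simp only [Pi.add_apply] at h
  simp only [d, Pi.add_apply, h, mul_add, Finset.sum_add_distrib]
  ring

theorem d_smul (c : ℝ) {k : ℕ} {α : (Fin k → Sections n F E) → M → ℝ} (hα : A.IsCochain k α) :
    A.d k (c • α) = c • A.d k α := by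
  funext e x
  have h : ∀ i : Fin (k + 1), A.lieDeriv (e i) ((c • α) fun j => e (i.succAbove j)) x =
      c * A.lieDeriv (e i) (α fun j => e (i.succAbove j)) x := by
    intro i
    have := A.lieDeriv_mul (e i) (f := fun _ => c) contMDiff_const
      (hα.contMDiff fun j => e (i.succAbove j)) x
    rw [lieDeriv_const, mul_zero, add_zero] at this
    exact this
  simp only [Pi.smul_apply] at h
  simp only [d, Pi.smul_apply, h, smul_eq_mul, mul_sub, Finset.mul_sum]
  congr 1
  · exact Finset.sum_congr rfl fun i _ => by ring
  · exact Finset.sum_congr rfl fun i _ => Finset.sum_congr rfl fun j _ => by ring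

theorem d_zero (k : ℕ) : A.d k 0 = 0 := by
  have := A.d_smul 0 (A.cochains k).zero_mem
  rwa [zero_smul, zero_smul] at this

/-- The `k`-cocycles. -/
def cocycles (k : ℕ) : Submodule ℝ ((Fin k → Sections n F E) → M → ℝ) where
  carrier := {α | α ∈ A.cochains k ∧ A.d k α = 0}
  add_mem' {α τ} hα hτ :=
    ⟨add_mem hα.1 hτ.1, by rw [A.d_add hα.1 hτ.1, hα.2, hτ.2, add_zero]⟩
  zero_mem' := ⟨zero_mem _, A.d_zero k⟩
  smul_mem' c α hα := ⟨Submodule.smul_mem _ c hα.1, by rw [A.d_smul c hα.1, hα.2, smul_zero]⟩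

/-- The exact `k`-cochains. -/
def coboundaries : (k : ℕ) → Submodule ℝ ((Fin k → Sections n F E) → M → ℝ)
  | 0 => ⊥
  | k + 1 =>
    { carrier := {α | α ∈ A.cochains (k + 1) ∧ ∃ η ∈ A.cochains k, A.d k η = α}
      add_mem' := by
        rintro _ _ ⟨h, η, hη, rfl⟩ ⟨h', η', hη', rfl⟩
        exact ⟨add_mem h h', η + η', add_mem hη hη', A.d_add hη hη'⟩
      zero_mem' := ⟨zero_mem _, 0, zero_mem _, A.d_zero k⟩
      smul_mem' := by
        rintro c _ ⟨h, η, hη, rfl⟩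
        exact ⟨Submodule.smul_mem _ c h, c • η, Submodule.smul_mem _ c hη, A.d_smul c hη⟩ }

/-- The cohomology `H^k(E)`. -/
abbrev Cohomology (k : ℕ) : Type _ :=
  A.cocycles k ⧸ (A.coboundaries k).submoduleOf (A.cocycles k)

/-! ### Chern–Simons forms -/

open Classical in
/-- The endomorphism of the fibre over `x` induced by an operator on sections that is linear over
smooth functions, i.e. the unique `φ` with `φ (s x) = T s x` for all sections `s`. -/
def fiberEnd (T : Sections n F E → Π x, E x) (x : M) : Module.End ℝ (E x) :=
  if h : ∃ φ : Module.End ℝ (E x), ∀ s : Sections n F E, φ (s x) = T s x then h.choose else 0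

/-- The permutations `ς` with `ς(1) < ⋯ < ς(p)` and `ς(p+1) < ⋯ < ς(p+q)`. -/
def shuffles (p q : ℕ) : Set (Equiv.Perm (Fin (p + q))) :=
  {ς | StrictMono (fun i => ς (Fin.castAdd q i)) ∧ StrictMono (fun j => ς (Fin.natAdd p j))}

open Classical in
/-- The product of cochains `(α ⌣ τ)(e₁, …) = ∑_ς sgn(ς) α(e_{ς(1)}, …) τ(e_{ς(p+1)}, …)`, summed
over `(p, q)`-shuffles. The values lie in a ring `R`; here this is the ring of families of
endomorphisms of the fibres of `E`. -/
def cup {R : Type*} [Ring R] {p q m : ℕ} (h : p + q = m) (α : (Fin p → Sections n F E) → R)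
    (τ : (Fin q → Sections n F E) → R) : (Fin m → Sections n F E) → R := fun e =>
  ∑ ς : Equiv.Perm (Fin (p + q)) with ς ∈ shuffles p q, ((Equiv.Perm.sign ς : ℤˣ) : ℤ) •
    (α (fun i => e (Fin.cast h (ς (Fin.castAdd q i)))) *
      τ (fun j => e (Fin.cast h (ς (Fin.natAdd p j)))))

variable {A}

namespace EConnection

/-- The curvature `F(e₁, e₂) b = ∇_{e₁} ∇_{e₂} b - ∇_{e₂} ∇_{e₁} b - ∇_{⟦e₁, e₂⟧} b`, as a
`2`-cochain with values in the endomorphisms of the fibres. -/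
def curvature (D : A.EConnection) : (Fin 2 → Sections n F E) → Π x, Module.End ℝ (E x) :=
  fun e => fiberEnd fun b =>
    (D (e 0) (D (e 1) b) - D (e 1) (D (e 0) b) - D (A.bracket (e 0) (e 1)) b : Sections n F E)

/-- The power `F^p` of the curvature with respect to the product of cochains. -/
def curvaturePow (D : A.EConnection) :
    (p : ℕ) → (Fin (2 * p) → Sections n F E) → Π x, Module.End ℝ (E x)
  | 0 => fun _ => 1
  | p + 1 => cup (by ring) (D.curvaturePow p) D.curvature

end EConnection

/-- The velocity `d/dt ∇_t` at time `t` of a path of `E`-connections parametrised by `[0, 1]`, as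
a `1`-cochain with values in the endomorphisms of the fibres. -/
def velocity (γ : ℝ → A.EConnection) (t : ℝ) :
    (Fin 1 → Sections n F E) → Π x, Module.End ℝ (E x) :=
  fun e => fiberEnd fun b x => derivWithin (fun r => γ r (e 0) b x) (Icc 0 1) t

/-- The Chern–Simons form `cs_k(∇_t) = k ∫₀¹ tr(d/dt ∇_t ⌣ F_{∇_t}^{k-1}) dt`, of degree
`2k - 1`. -/
def csForm (k : ℕ) (hk : 0 < k) (γ : ℝ → A.EConnection) :
    (Fin (2 * k - 1) → Sections n F E) → M → ℝ := fun e x =>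
  k * ∫ t in (0 : ℝ)..1, LinearMap.trace ℝ (E x)
    (cup (show 1 + 2 * (k - 1) = 2 * k - 1 by omega)
      (velocity γ t) ((γ t).curvaturePow (k - 1)) e x)

/-- `γ` restricts to a smooth path of `E`-connections on `[0, 1]` from `D₀` to `D₁`: the section
`∇_{t, e} b` depends smoothly on `(t, x) ∈ [0, 1] × M` for all sections `e` and `b`. -/
structure IsSmoothPath (γ : ℝ → A.EConnection) (D₀ D₁ : A.EConnection) : Prop where
  contMDiffOn : ∀ e b : Sections n F E,
    ContMDiffOn (𝓘(ℝ, ℝ).prod (𝓡 n)) ((𝓡 n).prod 𝓘(ℝ, F)) ∞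
      (fun p : ℝ × M => TotalSpace.mk' F p.2 (γ p.1 e b p.2)) (Icc 0 1 ×ˢ univ)
  source : γ 0 = D₀
  target : γ 1 = D₁

/-- The Chern–Simons class `[cs_k(D₀, D₁)]` is well defined and equal to `c`: there are smooth
paths from `D₀` to `D₁`, and the Chern–Simons form of every such path is a cocycle representing
`c`. -/
def IsChernSimonsClass (k : ℕ) (hk : 0 < k) (D₀ D₁ : A.EConnection)
    (c : A.Cohomology (2 * k - 1)) : Prop :=
  (∃ γ, IsSmoothPath γ D₀ D₁) ∧ ∀ γ, IsSmoothPath γ D₀ D₁ →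
    ∃ h : csForm k hk γ ∈ A.cocycles (2 * k - 1), Submodule.Quotient.mk ⟨csForm k hk γ, h⟩ = c

end CourantAlgebroid

end Courant

end

/-! A smooth family of `E`-connections `∇_p`, with `p` in a vector space `P`, is one connection over
`P × M`. The Leibniz algebra `Γ(E) × P`, with bracket `([a, b], 0)`, acts on `C^∞(P × M)` by `ρ(a) +
∂_τ`, and `∇_{(a,τ)} = ∇_{p,a} + ∂_τ` (`familyConnection`). By the Bianchi identity and because the
trace turns `[∇, T]` into the derivative of `tr T`, the form `ω = tr(F^k)` is closed
(`diff_familyChern`).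

The mixed curvature is `F(∂_τ, a) = ∂_τ ∇_a`, so for a path the integrand of `cs_k` is `ι_{∂_t} ω`
on arguments in `Γ(E)`. As `∂_t` commutes with `Γ(E)`, Cartan's formula gives `d ι_{∂_t} ω = ∂_t ω`,
and `d cs_k` is the difference of `tr(F^k)` at the two ends. Both ends vanish for odd `k`: `∇^E`
preserves the pairing, so its curvature is skew and odd powers have trace zero; passing to the
`g`-adjoint changes `tr(F^k)` by the factor `(-1)^k` (`chern_adjoint`).

Given two sets of choices, fill a square of connections. Its left and right sides are the given
paths, its bottom side joins the two connections `∇^E` through connections preserving the pairing,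
its top side consists of the adjoints of the bottom side for a path of metrics. Closedness of `ω` in
two parameter directions (`diff_contract_contract_familyChern`), integrated over the square, shows
that the difference of the two Chern–Simons forms is the contribution of top minus bottom, up to an
exact term. On the bottom `ω` vanishes as a form over `ℝ × M`. On the top, the adjoint taken over `ℝ
× M` also has `tr(F^k) = 0`, but it differs from the top family by an endomorphism `u` in the
parameter direction, since the metric varies; this changes `ι_{∂_t} ω` by `k d tr(u F^{k-1})`
(`contract_chern_of_agree`), so the top is exact as well. This is `exists_primitive`.

The cochains are neither skew nor multilinear over functions. Forms are therefore functions on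
lists, with product, Lie derivative and differential defined by their contraction with the first
argument, and the symbol is followed through products, traces and integrals. The symbol of `F` is `f
↦ -∇_{𝒟f}`, a derivation in `f`. A path that is smooth only on `[0, 1]` is composed with `ramp` to
give a family over all of `ℝ`. -/

noncomputable section

/-! ### Forms on lists: shuffle product, Cartan calculus, symbols, adjoints -/

namespace Courant

/-- Inhomogeneous cochains on `G` with values in `R`: functions of finite lists of elements
of `G`. -/
@[ext] structure Form (G R : Type*) where
  toFun : List G → R

namespace Form

instance {G R : Type*} : CoeFun (Form G R) fun _ => List G → R := ⟨Form.toFun⟩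

variable {G G' R R' : Type*}

section Basic

variable [Ring R] [Ring R']

theorem toFun_injective : Function.Injective (Form.toFun : Form G R → List G → R) :=
  fun _ _ h => Form.ext h

instance : Zero (Form G R) := ⟨⟨0⟩⟩
instance : Add (Form G R) := ⟨fun α β => ⟨α.toFun + β.toFun⟩⟩
instance : Sub (Form G R) := ⟨fun α β => ⟨α.toFun - β.toFun⟩⟩
instance : Neg (Form G R) := ⟨fun α => ⟨-α.toFun⟩⟩
instance : SMul ℕ (Form G R) := ⟨fun n α => ⟨n • α.toFun⟩⟩
instance : SMul ℤ (Form G R) := ⟨fun n α => ⟨n • α.toFun⟩⟩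

instance : AddCommGroup (Form G R) :=
  toFun_injective.addCommGroup _ rfl (fun _ _ => rfl) (fun _ => rfl) (fun _ _ => rfl)
    (fun _ _ => rfl) (fun _ _ => rfl)

theorem ext' {α β : Form G R} (h : ∀ l, α l = β l) : α = β := Form.ext (funext h)

@[simp] theorem add_apply (α β : Form G R) (l : List G) : (α + β) l = α l + β l := rfl
@[simp] theorem sub_apply (α β : Form G R) (l : List G) : (α - β) l = α l - β l := rfl
@[simp] theorem neg_apply (α : Form G R) (l : List G) : (-α) l = -α l := rfl
@[simp] theorem zero_apply (l : List G) : (0 : Form G R) l = 0 := rfl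

/-- Contraction with `a` in the first argument. -/
def contract (a : G) : Form G R →+ Form G R where
  toFun α := ⟨fun l => α (a :: l)⟩
  map_zero' := rfl
  map_add' _ _ := rfl

@[simp] theorem contract_apply (a : G) (α : Form G R) (l : List G) :
    contract a α l = α (a :: l) := rfl

/-- The grading involution. -/
def bar : Form G R →+ Form G R where
  toFun α := ⟨fun l => (-1) ^ l.length * α l⟩
  map_zero' := by ext; simp
  map_add' α β := by refine ext' fun l => ?_; simp [mul_add]

theorem bar_apply (α : Form G R) (l : List G) : bar α l = (-1) ^ l.length * α l := rfl

@[simp] theorem bar_nil (α : Form G R) : bar α [] = α [] := by simp [bar_apply]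

@[simp] theorem bar_cons (α : Form G R) (a : G) (l : List G) :
    bar α (a :: l) = -bar (contract a α) l := by
  simp [bar_apply, pow_succ]

@[simp] theorem contract_bar (a : G) (α : Form G R) :
    contract a (bar α) = -bar (contract a α) := by
  refine ext' fun l => ?_; simp

@[simp] theorem bar_bar (α : Form G R) : bar (bar α) = α := by
  refine ext' fun l => ?_
  simp only [bar_apply, ← mul_assoc, ← pow_add, ← two_mul]
  simp

/-- The value of the product of two forms on a list. -/
def mulAux : List G → Form G R → Form G R → R
  | [], α, β => α [] * β []
  | a :: l, α, β => mulAux l (contract a α) β + mulAux l (bar α) (contract a β)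

/-- The signed shuffle product. -/
instance : Mul (Form G R) := ⟨fun α β => ⟨fun l => mulAux l α β⟩⟩

/-- The form of degree zero with value `1`. -/
instance : One (Form G R) := ⟨⟨fun l => match l with | [] => 1 | _ :: _ => 0⟩⟩

@[simp] theorem mul_nil (α β : Form G R) : (α * β) [] = α [] * β [] := rfl

theorem mul_cons (α β : Form G R) (a : G) (l : List G) :
    (α * β) (a :: l) = (contract a α * β) l + (bar α * contract a β) l := rfl

@[simp] theorem one_nil : (1 : Form G R) [] = 1 := rfl
@[simp] theorem contract_one (a : G) : contract a (1 : Form G R) = 0 := rfl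

theorem zero_mul_aux (l : List G) : ∀ β : Form G R, ((0 : Form G R) * β) l = 0 := by
  induction l with
  | nil => simp
  | cons a l ih => intro β; simp [mul_cons, ih]

theorem mul_zero_aux (l : List G) : ∀ β : Form G R, (β * (0 : Form G R)) l = 0 := by
  induction l with
  | nil => simp
  | cons a l ih => intro β; simp [mul_cons, ih]

theorem add_mul_aux (l : List G) : ∀ α β γ : Form G R,
    ((α + β) * γ) l = (α * γ) l + (β * γ) l := by
  induction l with
  | nil => intros; simp [add_mul]
  | cons a l ih => intros; simp only [mul_cons, map_add, ih]; abel

theorem mul_add_aux (l : List G) : ∀ α β γ : Form G R,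
    (α * (β + γ)) l = (α * β) l + (α * γ) l := by
  induction l with
  | nil => intros; simp [mul_add]
  | cons a l ih => intros; simp only [mul_cons, map_add, ih]; abel

instance : NonUnitalNonAssocRing (Form G R) :=
  { (inferInstance : AddCommGroup (Form G R)), (inferInstance : Mul (Form G R)) with
    zero_mul := fun β => ext' fun l => zero_mul_aux l β
    mul_zero := fun β => ext' fun l => mul_zero_aux l β
    right_distrib := fun α β γ => ext' fun l => add_mul_aux l α β γ
    left_distrib := fun α β γ => ext' fun l => mul_add_aux l α β γ }

/-- The recursion that defines the shuffle product: the first argument goes to `α`, or moves past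
`α` to `β`, which costs the sign in `bar`. Identities for products follow from it by induction on
the list. -/
theorem contract_mul (a : G) (α β : Form G R) :
    contract a (α * β) = contract a α * β + bar α * contract a β := rfl

theorem bar_mul (α β : Form G R) : bar (α * β) = bar α * bar β := by
  refine ext' fun l => ?_
  induction l generalizing α β with
  | nil => simp
  | cons a l ih =>
    have h1 := ih (contract a α) β
    have h2 := ih (bar α) (contract a β)
    rw [bar_cons, contract_mul, map_add, add_apply, h1, h2, mul_cons]
    simp only [contract_bar, neg_mul, mul_neg, neg_apply]
    abel

theorem mul_assoc_aux (l : List G) : ∀ α β γ : Form G R,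
    (α * β * γ) l = (α * (β * γ)) l := by
  induction l with
  | nil => intros; simp [mul_assoc]
  | cons a l ih =>
    intro α β γ
    simp only [mul_cons, contract_mul, add_mul, mul_add, add_apply, ih, bar_mul]
    abel

theorem one_mul_aux (l : List G) : ∀ α : Form G R, (1 * α) l = α l := by
  induction l with
  | nil => simp
  | cons a l ih =>
    intro α
    have : bar (1 : Form G R) = 1 := by
      refine ext' fun l => ?_; cases l <;> simp [contract_one]; rfl
    simp only [mul_cons, contract_one, zero_mul, this, ih]; simp

theorem mul_one_aux (l : List G) : ∀ α : Form G R, (α * 1) l = α l := by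
  induction l with
  | nil => simp
  | cons a l ih =>
    intro α
    simp only [mul_cons, contract_one, mul_zero, ih]; simp

instance : Ring (Form G R) :=
  { (inferInstance : NonUnitalNonAssocRing (Form G R)), (inferInstance : One (Form G R)) with
    mul_assoc := fun α β γ => ext' fun l => mul_assoc_aux l α β γ
    one_mul := fun α => ext' fun l => one_mul_aux l α
    mul_one := fun α => ext' fun l => mul_one_aux l α }

theorem bar_pow {α : Form G R} (h : bar α = α) (k : ℕ) : bar (α ^ k) = α ^ k := by
  induction k with
  | zero => refine ext' fun l => ?_; cases l <;> simp [contract_one]; rfl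
  | succ k ih => rw [pow_succ, bar_mul, ih, h]

/-- The form with value `c` in degree zero and no other component. -/
def ofDegreeZero (c : R) : Form G R := ⟨fun l => match l with | [] => c | _ :: _ => 0⟩

@[simp] theorem ofDegreeZero_nil (c : R) : (ofDegreeZero c : Form G R) [] = c := rfl

/-- Restriction along a map of arguments and change of coefficients. -/
def mapHom (j : G' → G) (φ : R →+* R') : Form G R →+* Form G' R' where
  toFun α := ⟨fun l => φ (α (l.map j))⟩
  map_zero' := by ext; simp
  map_add' α β := by ext; simp
  map_one' := by refine ext' fun l => ?_; cases l <;> simp; exact map_zero φ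
  map_mul' α β := by
    refine ext' fun l => ?_
    induction l generalizing α β with
    | nil => simp
    | cons a l ih =>
      have ih' : ∀ α β : Form G R, φ ((α * β) (l.map j)) =
        ((⟨fun l => φ (α (l.map j))⟩ : Form G' R') * ⟨fun l => φ (β (l.map j))⟩) l := ih
      change φ ((α * β) (j a :: l.map j)) = _
      rw [mul_cons, map_add, ih', ih', mul_cons]
      have : (⟨fun l => φ (bar α (l.map j))⟩ : Form G' R') = bar ⟨fun l => φ (α (l.map j))⟩ :=
        ext' fun l => by simp [bar_apply]
      rw [this]
      rfl

theorem mapHom_apply (j : G' → G) (φ : R →+* R') (α : Form G R) (l : List G') :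
    mapHom j φ α l = φ (α (l.map j)) := rfl

/-- Composition with an additive map on the coefficients. -/
def comp {V : Type*} [Ring V] (t : R →+ V) : Form G R →+ Form G V where
  toFun α := ⟨fun l => t (α l)⟩
  map_zero' := by ext; simp
  map_add' α β := by ext; simp

@[simp] theorem comp_apply {V : Type*} [Ring V] (t : R →+ V) (α : Form G R) (l : List G) :
    comp t α l = t (α l) := rfl

theorem contract_comp {V : Type*} [Ring V] (t : R →+ V) (a : G) (α : Form G R) :
    contract a (comp t α) = comp t (contract a α) := rfl

/-! ### Traces of products -/

/-- Graded cyclicity of the trace. The even and the odd case are proved together because contracting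
`α` with an argument exchanges them. -/
theorem trace_mul_comm_aux {V : Type*} [AddCommGroup V] (t : R →+ V)
    (ht : ∀ a b, t (a * b) = t (b * a)) (l : List G) : ∀ α β : Form G R,
    (bar α = α → t ((α * β) l) = t ((β * α) l)) ∧
      (bar α = -α → t ((α * β) l) = t ((bar β * α) l)) := by
  induction l with
  | nil => intro α β; simp [ht]
  | cons a l ih =>
    intro α β
    constructor
    · intro h
      have h' : bar (contract a α) = -contract a α := by
        rw [← neg_eq_iff_eq_neg, ← contract_bar, h]
      simp only [mul_cons, map_add, h]
      rw [(ih _ _).2 h', (ih _ _).1 h, add_comm]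
    · intro h
      have h' : bar (contract a α) = contract a α := by
        have := congrArg (contract a) h
        rwa [contract_bar, map_neg, neg_inj] at this
      simp only [mul_cons, map_add, h, bar_bar, contract_bar, neg_mul, neg_apply, map_neg]
      have := (ih α (contract a β)).2 h
      rw [(ih _ _).1 h', this, add_comm]

theorem trace_mul_comm {V : Type*} [AddCommGroup V] (t : R →+ V)
    (ht : ∀ a b, t (a * b) = t (b * a)) {α : Form G R} (h : bar α = α) (β : Form G R)
    (l : List G) : t ((α * β) l) = t ((β * α) l) :=
  (trace_mul_comm_aux t ht l α β).1 h

/-- The contraction of a power is the sum of the terms `α^i (ι_a α) α^{k-i}`, which all have the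
same trace by cyclicity. The factor `α^j` on the left makes the induction close. -/
theorem trace_mul_contract_pow {V : Type*} [AddCommGroup V] (t : R →+ V)
    (ht : ∀ a b, t (a * b) = t (b * a)) {α : Form G R} (h : bar α = α) (a : G) (k j : ℕ)
    (l : List G) : t ((α ^ j * contract a (α ^ (k + 1))) l) =
      (k + 1) • t ((contract a α * α ^ (k + j)) l) := by
  induction k generalizing j with
  | zero =>
    simp only [zero_add, pow_one, one_smul]
    exact trace_mul_comm t ht (bar_pow h j) _ l
  | succ k ih =>
    have h1 : α ^ j * contract a (α ^ (k + 1 + 1)) =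
        α ^ j * (contract a α * α ^ (k + 1)) + α ^ (j + 1) * contract a (α ^ (k + 1)) := by
      rw [pow_succ' α (k + 1), contract_mul, h, mul_add, pow_succ α j, mul_assoc (α ^ j) α]
    rw [h1, add_apply, map_add, ih, trace_mul_comm t ht (bar_pow h j), mul_assoc, ← pow_add,
      show k + (j + 1) = k + 1 + j by ring, ← succ_nsmul']

theorem trace_contract_pow {V : Type*} [AddCommGroup V] (t : R →+ V)
    (ht : ∀ a b, t (a * b) = t (b * a)) {α : Form G R} (h : bar α = α) (a : G) (k : ℕ)
    (l : List G) : t (contract a (α ^ (k + 1)) l) = (k + 1) • t ((contract a α * α ^ k) l) := by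
  simpa using trace_mul_contract_pow t ht h a k 0 l

end Basic

/-! ### The Lie derivative and the differential -/

section Differential

variable [Ring R] (br : G → G → G) (L : G → R → R)

/-- The value of the Lie derivative of a form on a list. -/
def lieAux (a : G) : List G → Form G R → R
  | [], α => L a (α [])
  | b :: l, α => lieAux a l (contract b α) - α (br a b :: l)

/-- The Lie derivative. -/
def lie (a : G) (α : Form G R) : Form G R := ⟨fun l => lieAux br L a l α⟩

/-- The value of the differential of a form on a list. -/
def diffAux : List G → Form G R → R
  | [], _ => 0
  | a :: l, α => lie br L a α l - diffAux l (contract a α)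

/-- The differential. -/
def diff (α : Form G R) : Form G R := ⟨fun l => diffAux br L l α⟩

@[simp] theorem lie_nil (a : G) (α : Form G R) : lie br L a α [] = L a (α []) := rfl

/-- The commutation rule `ι_b L_a = L_a ι_b - ι_{[a,b]}`, which is the definition of the Lie
derivative. -/
theorem contract_lie (a b : G) (α : Form G R) :
    contract b (lie br L a α) = lie br L a (contract b α) - contract (br a b) α := rfl

theorem lie_cons (a b : G) (α : Form G R) (l : List G) :
    lie br L a α (b :: l) = lie br L a (contract b α) l - α (br a b :: l) := rfl

@[simp] theorem diff_nil (α : Form G R) : diff br L α [] = 0 := rfl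

/-- Cartan's formula `ι_a d + d ι_a = L_a`, which is the definition of the differential. No symmetry
of the bracket enters. -/
theorem contract_diff (a : G) (α : Form G R) :
    contract a (diff br L α) = lie br L a α - diff br L (contract a α) := rfl

theorem diff_cons (a : G) (α : Form G R) (l : List G) :
    diff br L α (a :: l) = lie br L a α l - diff br L (contract a α) l := rfl

section
variable {br L} (hadd : ∀ a r s, L a (r + s) = L a r + L a s)
include hadd

theorem lie_add (a : G) (α β : Form G R) :
    lie br L a (α + β) = lie br L a α + lie br L a β := by
  refine ext' fun l => ?_
  induction l generalizing α β with
  | nil => simp [hadd]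
  | cons b l ih => simp only [lie_cons, map_add, ih, add_apply]; abel

theorem diff_add (α β : Form G R) : diff br L (α + β) = diff br L α + diff br L β := by
  refine ext' fun l => ?_
  induction l generalizing α β with
  | nil => simp
  | cons b l ih => simp only [diff_cons, map_add, ih, add_apply, lie_add hadd]; abel

theorem lie_neg (a : G) (α : Form G R) : lie br L a (-α) = -lie br L a α :=
  map_neg (AddMonoidHom.mk' (lie br L a) (lie_add hadd a)) α

theorem diff_neg (α : Form G R) : diff br L (-α) = -diff br L α :=
  map_neg (AddMonoidHom.mk' (diff br L) (diff_add hadd)) α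

theorem lie_bar (a : G) (α : Form G R) : lie br L a (bar α) = bar (lie br L a α) := by
  refine ext' fun l => ?_
  induction l generalizing α with
  | nil => simp
  | cons b l ih =>
    rw [lie_cons, contract_bar, lie_neg hadd, neg_apply, ih, bar_cons, bar_cons, contract_lie,
      map_sub, sub_apply]
    abel

theorem diff_bar (α : Form G R) : diff br L (bar α) = -bar (diff br L α) := by
  refine ext' fun l => ?_
  induction l generalizing α with
  | nil => simp
  | cons b l ih =>
    rw [diff_cons, contract_bar, diff_neg hadd, neg_apply, ih, neg_apply, neg_apply, bar_cons,
      contract_diff, map_sub, sub_apply, lie_bar hadd]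
    abel

variable (hmul : ∀ a r s, L a (r * s) = L a r * s + r * L a s)
include hmul

theorem lie_mul (a : G) (α β : Form G R) :
    lie br L a (α * β) = lie br L a α * β + α * lie br L a β := by
  refine ext' fun l => ?_
  induction l generalizing α β with
  | nil => simp [hmul]
  | cons b l ih =>
    rw [lie_cons, contract_mul, lie_add hadd, add_apply, ih, ih]
    simp only [add_apply, sub_apply, mul_cons, lie_bar hadd, contract_lie, sub_mul, mul_sub]
    abel

/-- By Cartan's formula, contraction with the first argument reduces the graded Leibniz rule to
`lie_mul` and to the same rule for the contracted forms. -/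
theorem diff_mul (α β : Form G R) :
    diff br L (α * β) = diff br L α * β + bar α * diff br L β := by
  refine ext' fun l => ?_
  induction l generalizing α β with
  | nil => simp
  | cons b l ih =>
    rw [diff_cons, contract_mul, diff_add hadd, add_apply, ih, ih]
    simp only [add_apply, sub_apply, neg_apply, mul_cons, lie_mul hadd hmul, contract_diff,
      sub_mul, mul_sub, bar_bar, contract_bar, diff_bar hadd, neg_mul]
    abel

theorem diff_pow {α : Form G R} (hd : diff br L α = 0) (k : ℕ) :
    diff br L (α ^ (k + 1)) = 0 := by
  induction k with
  | zero => simpa using hd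
  | succ k ih => rw [pow_succ, diff_mul hadd hmul, ih, hd]; simp

end

variable {V : Type*} [Ring V] (L' : G → V → V) (t : R →+ V) (ht : ∀ a r, t (L a r) = L' a (t r))
include ht

theorem lie_comp (a : G) (α : Form G R) : lie br L' a (comp t α) = comp t (lie br L a α) := by
  refine ext' fun l => ?_
  induction l generalizing α with
  | nil => simp [ht]
  | cons b l ih => rw [lie_cons, contract_comp, ih]; simp [lie_cons]

theorem diff_comp (α : Form G R) : diff br L' (comp t α) = comp t (diff br L α) := by
  refine ext' fun l => ?_
  induction l generalizing α with
  | nil => simp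
  | cons b l ih =>
    rw [diff_cons, contract_comp, ih, lie_comp br L L' t ht]; simp [diff_cons]

end Differential

/-! ### Symbols and linearity in the last argument -/

section Symbol

variable {C : Type*} [Ring R] (pair : G → G → C)

/-- `σ` is a symbol of `α`: exchanging two adjacent arguments changes the sign of `α` up to a term
depending on their pairing. -/
def HasSymbol (α : Form G R) (σ : C → Form G R) : Prop :=
  ∀ u a b v, α (u ++ a :: b :: v) + α (u ++ b :: a :: v) = σ (pair a b) (u ++ v)

variable {pair}

theorem HasSymbol.contract {α : Form G R} {σ : C → Form G R} (h : HasSymbol pair α σ) (c : G) :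
    HasSymbol pair (Form.contract c α) (fun f => Form.contract c (σ f)) :=
  fun u a b v => h (c :: u) a b v

theorem HasSymbol.bar {α : Form G R} {σ : C → Form G R} (h : HasSymbol pair α σ) :
    HasSymbol pair (Form.bar α) (fun f => Form.bar (σ f)) := by
  intro u a b v
  rw [bar_apply, bar_apply, bar_apply, ← h]
  simp only [List.length_append, List.length_cons, pow_add, mul_add]
  simp

/-- When `ι_b ι_a + ι_a ι_b` is applied to a product, the terms with one contraction on each factor
cancel. A symbol uses up two arguments, so moving it past `α` produces no sign. -/
theorem HasSymbol.mul {α β : Form G R} {σ τ : C → Form G R} (hα : HasSymbol pair α σ)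
    (hβ : HasSymbol pair β τ) : HasSymbol pair (α * β) (fun f => σ f * β + α * τ f) := by
  intro u
  induction u generalizing α β σ τ with
  | nil =>
    intro a b v
    have h1 : Form.contract b (Form.contract a α) + Form.contract a (Form.contract b α) =
        σ (pair a b) := by refine ext' fun l => ?_; exact hα [] a b l
    have h2 : Form.contract b (Form.contract a β) + Form.contract a (Form.contract b β) =
        τ (pair a b) := by refine ext' fun l => ?_; exact hβ [] a b l
    simp only [List.nil_append, mul_cons, add_apply, bar_bar, ← h1, ← h2, add_mul,
      mul_add, contract_bar, neg_mul, neg_apply]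
    abel
  | cons c u ih =>
    intro a b v
    have h1 := ih (hα.contract c) hβ a b v
    have h2 := ih hα.bar (hβ.contract c) a b v
    simp only [List.cons_append, mul_cons, add_apply] at h1 h2 ⊢
    rw [add_add_add_comm, h1, h2]
    abel

theorem HasSymbol.comp {V : Type*} [Ring V] {α : Form G R} {σ : C → Form G R}
    (h : HasSymbol pair α σ) (t : R →+ V) :
    HasSymbol pair (Form.comp t α) (fun f => Form.comp t (σ f)) := by
  intro u a b v
  simp only [comp_apply, ← map_add, h u a b v]

end Symbol

/-! ### Adjoint forms -/

section Adjoint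

variable [Ring R] {V W : Type*} [AddCommGroup V] [Module R V] [AddCommGroup W]
  (B : V →+ V →+ W)

/-- The values of `α` and `β` are adjoint to each other with respect to `B`. -/
def IsAdjointPair (α β : Form G R) : Prop := ∀ l v w, B (α l • v) w = B v (β l • w)

variable {B}

theorem IsAdjointPair.contract {α β : Form G R} (h : IsAdjointPair B α β) (a : G) :
    IsAdjointPair B (contract a α) (contract a β) := fun l => h (a :: l)

/-- Adjunction reverses the order of a product. The sign of the reversal depends on the parity of
`α`, and the two parities are exchanged by contraction, as for the trace. -/
theorem IsAdjointPair.mul_aux (l : List G) : ∀ {α β α' β' : Form G R}, IsAdjointPair B α α' →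
    IsAdjointPair B β β' → ∀ v w,
    (Form.bar α = α → B ((α * β) l • v) w = B v ((β' * α') l • w)) ∧
      (Form.bar α = -α → B ((α * β) l • v) w = B v ((Form.bar β' * α') l • w)) := by
  induction l with
  | nil =>
    intro α β α' β' hα hβ v w
    simp [mul_smul, hα [] _ _, hβ [] _ _]
  | cons a l ih =>
    intro α β α' β' hα hβ v w
    constructor
    · intro h
      have h' : Form.bar (Form.contract a α) = -Form.contract a α := by
        rw [← neg_eq_iff_eq_neg, ← contract_bar, h]
      simp only [mul_cons, add_smul, map_add, AddMonoidHom.add_apply, h]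
      rw [(ih (hα.contract a) hβ v w).2 h', (ih hα (hβ.contract a) v w).1 h, add_comm]
    · intro h
      have h' : Form.bar (Form.contract a α) = Form.contract a α := by
        have := congrArg (Form.contract a) h
        rwa [contract_bar, map_neg, neg_inj] at this
      simp only [mul_cons, add_smul, map_add, AddMonoidHom.add_apply, h, bar_bar, contract_bar,
        neg_mul, neg_apply, map_neg, neg_smul, AddMonoidHom.neg_apply]
      rw [(ih (hα.contract a) hβ v w).1 h', (ih hα (hβ.contract a) v w).2 h, add_comm]

theorem IsAdjointPair.pow {α β : Form G R} (h : IsAdjointPair B α β) (hα : Form.bar α = α)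
    (k : ℕ) : IsAdjointPair B (α ^ k) (β ^ k) := by
  induction k with
  | zero =>
    intro l v w
    rw [pow_zero, pow_zero]
    cases l with
    | nil => simp
    | cons a l => change B ((0 : R) • v) w = B v ((0 : R) • w); simp
  | succ k ih =>
    intro l v w
    rw [pow_succ', pow_succ]
    exact (IsAdjointPair.mul_aux l h ih v w).1 hα

end Adjoint

end Form

end Courant

end

/-! ### Derivation symbols, and connections along a Leibniz algebra -/

noncomputable section

namespace Courant

namespace Form

variable {G R : Type*}

section Vanishing

variable [Ring R] {br : G → G → G} {L : G → R → R}

theorem lie_eq_zero_of_length (hL : ∀ a, L a 0 = 0) (a : G) {α : Form G R} {l : List G}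
    (h : ∀ l', l'.length = l.length → α l' = 0) : lie br L a α l = 0 := by
  induction l generalizing α with
  | nil => simp [h [] rfl, hL]
  | cons b l ih =>
    rw [lie_cons, ih fun l' hl => h (b :: l') (by simp [hl]), h (br a b :: l) (by simp), sub_zero]

/-- The differential raises the degree by one. Identities for differentials of forms in a single
degree need only be checked on lists of one length. -/
theorem diff_eq_zero_of_length (hL : ∀ a, L a 0 = 0) {α : Form G R} {l : List G}
    (h : ∀ l', l'.length + 1 = l.length → α l' = 0) : diff br L α l = 0 := by
  induction l generalizing α with
  | nil => simp
  | cons b l ih =>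
    rw [diff_cons, lie_eq_zero_of_length hL b fun l' hl => h l' (by simp [hl]),
      ih fun l' hl => h (b :: l') (by simp [hl]), sub_zero]

end Vanishing

section Smul

variable {S : Type*} [CommRing S] [Ring R] [Algebra S R]

/-- Pointwise multiplication of a form by a scalar. -/
instance : SMul S (Form G R) := ⟨fun f α => ⟨fun l => f • α l⟩⟩

@[simp] theorem smul_apply (f : S) (α : Form G R) (l : List G) : (f • α) l = f • α l := rfl

theorem contract_smul (a : G) (f : S) (α : Form G R) :
    contract a (f • α) = f • contract a α := rfl

theorem bar_smul (f : S) (α : Form G R) : bar (f • α) = f • bar α :=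
  ext' fun l => by simp [bar_apply]

theorem smul_mul (f : S) (α β : Form G R) : (f • α) * β = f • (α * β) := by
  refine ext' fun l => ?_
  induction l generalizing α β with
  | nil => simp
  | cons a l ih =>
    rw [mul_cons, contract_smul, bar_smul, ih, ih]
    simp [mul_cons]

theorem mul_smul' (f : S) (α β : Form G R) : α * (f • β) = f • (α * β) := by
  refine ext' fun l => ?_
  induction l generalizing α β with
  | nil => simp
  | cons a l ih =>
    rw [mul_cons, contract_smul, ih, ih]
    simp [mul_cons]

end Smul

/-! ### Symbols that are derivations -/

section Derivation

variable {k C S : Type*} [CommRing k] [CommRing C] [Algebra k C] [CommRing S] [Ring R]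
  [Algebra S R] (ι : C →+* S)

variable (k) in
/-- `σ` is a derivation from `C` to the forms with values in an algebra over `C`. -/
structure IsDerivation (σ : C → Form G R) : Prop where
  map_add : ∀ f g, σ (f + g) = σ f + σ g
  map_mul : ∀ f g, σ (f * g) = ι f • σ g + ι g • σ f
  map_algebraMap : ∀ c : k, σ (algebraMap k C c) = 0

variable {ι}

theorem IsDerivation.mul {σ τ : C → Form G R} (hσ : IsDerivation k ι σ)
    (hτ : IsDerivation k ι τ) (α β : Form G R) :
    IsDerivation k ι (fun f => σ f * β + α * τ f) where
  map_add f g := by rw [hσ.map_add, hτ.map_add, add_mul, mul_add]; abel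
  map_mul f g := by
    rw [hσ.map_mul, hτ.map_mul, add_mul, mul_add]
    simp only [smul_mul, mul_smul']
    refine ext' fun l => ?_
    simp only [add_apply, smul_apply, smul_add]
    abel
  map_algebraMap c := by rw [hσ.map_algebraMap, hτ.map_algebraMap]; simp

theorem IsDerivation.contract {σ : C → Form G R} (hσ : IsDerivation k ι σ) (a : G) :
    IsDerivation k ι (fun f => Form.contract a (σ f)) where
  map_add f g := by rw [hσ.map_add, AddMonoidHom.map_add]
  map_mul f g := by rw [hσ.map_mul, AddMonoidHom.map_add]; rfl
  map_algebraMap c := by rw [hσ.map_algebraMap, map_zero]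

theorem IsDerivation.comp {σ : C → Form G R} (hσ : IsDerivation k ι σ) (t : R →+ S)
    (ht : ∀ (f : S) r, t (f • r) = f * t r) :
    IsDerivation k ι (fun f => Form.comp t (σ f)) where
  map_add f g := by rw [hσ.map_add, AddMonoidHom.map_add]
  map_mul f g := by
    rw [hσ.map_mul, AddMonoidHom.map_add]
    refine ext' fun l => ?_
    simp [ht]
  map_algebraMap c := by rw [hσ.map_algebraMap, map_zero]

theorem IsDerivation.zero : IsDerivation k ι (fun _ => (0 : Form G R)) where
  map_add f g := by simp
  map_mul f g := by refine ext' fun l => ?_; simp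
  map_algebraMap c := rfl

variable (k ι) in
/-- The form has a symbol that is a derivation. -/
def HasDerivationSymbol (pair : G → G → C) (α : Form G R) : Prop :=
  ∃ σ, HasSymbol pair α σ ∧ IsDerivation k ι σ

variable {pair : G → G → C}

theorem HasDerivationSymbol.mul {α β : Form G R} (hα : HasDerivationSymbol k ι pair α)
    (hβ : HasDerivationSymbol k ι pair β) : HasDerivationSymbol k ι pair (α * β) := by
  obtain ⟨σ, h1, h2⟩ := hα
  obtain ⟨τ, h3, h4⟩ := hβ
  exact ⟨_, h1.mul h3, h2.mul h4 α β⟩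

theorem HasDerivationSymbol.ofDegreeZero (c : R) :
    HasDerivationSymbol k ι pair (ofDegreeZero c) :=
  ⟨fun _ => 0, fun u a b v => by cases u <;> simp [Form.ofDegreeZero], IsDerivation.zero⟩

theorem HasDerivationSymbol.pow {α : Form G R} (hα : HasDerivationSymbol k ι pair α) (m : ℕ) :
    HasDerivationSymbol k ι pair (α ^ m) := by
  induction m with
  | zero => exact HasDerivationSymbol.ofDegreeZero 1
  | succ m ih => rw [pow_succ]; exact ih.mul hα

theorem HasDerivationSymbol.contract {α : Form G R} (hα : HasDerivationSymbol k ι pair α)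
    (a : G) : HasDerivationSymbol k ι pair (Form.contract a α) := by
  obtain ⟨σ, h1, h2⟩ := hα
  exact ⟨_, h1.contract a, h2.contract a⟩

theorem HasDerivationSymbol.comp {α : Form G R} (hα : HasDerivationSymbol k ι pair α)
    (t : R →+ S) (ht : ∀ (f : S) r, t (f • r) = f * t r) :
    HasDerivationSymbol k ι pair (Form.comp t α) := by
  obtain ⟨σ, h1, h2⟩ := hα
  exact ⟨_, h1.comp t, h2.comp t ht⟩

end Derivation

/-! ### Linearity in the last argument -/

section LastLinear

variable {Γ C S : Type*} [Add Γ] [SMul C Γ] [CommRing C] [CommRing S] [Ring R]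
  [Algebra S R] (ι : C →+* S) (j : Γ → G)

/-- The form is linear over `C` in the last argument. -/
structure IsLastLinear (α : Form G R) : Prop where
  map_add : ∀ l a b, α (l ++ [j (a + b)]) = α (l ++ [j a]) + α (l ++ [j b])
  map_smul : ∀ l f a, α (l ++ [j (f • a)]) = ι f • α (l ++ [j a])

variable {ι j}

theorem IsLastLinear.contract {α : Form G R} (h : IsLastLinear ι j α) (c : G) :
    IsLastLinear ι j (Form.contract c α) :=
  ⟨fun l => h.map_add (c :: l), fun l => h.map_smul (c :: l)⟩

theorem IsLastLinear.bar {α : Form G R} (h : IsLastLinear ι j α) :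
    IsLastLinear ι j (Form.bar α) :=
  ⟨fun l a b => by simp [bar_apply, h.map_add, mul_add],
    fun l f a => by simp [bar_apply, h.map_smul]⟩

/-- In every shuffle the last argument remains the last argument of one of the two factors. -/
theorem IsLastLinear.mul {α β : Form G R} (hα : IsLastLinear ι j α) (hβ : IsLastLinear ι j β) :
    IsLastLinear ι j (α * β) := by
  constructor
  · intro l
    induction l generalizing α β with
    | nil =>
      intro a b
      have h1 := hα.map_add [] a b
      have h2 := hβ.map_add [] a b
      simp only [List.nil_append] at h1 h2
      simp only [List.nil_append, mul_cons, mul_nil, contract_apply, h1, h2, add_mul, mul_add]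
      abel
    | cons c l ih =>
      intro a b
      rw [List.cons_append, List.cons_append, List.cons_append, mul_cons, mul_cons, mul_cons,
        ih (hα.contract c) hβ, ih hα.bar (hβ.contract c)]
      abel
  · intro l
    induction l generalizing α β with
    | nil =>
      intro f a
      have h1 := hα.map_smul [] f a
      have h2 := hβ.map_smul [] f a
      simp only [List.nil_append] at h1 h2
      simp [mul_cons, h1, h2]
    | cons c l ih =>
      intro f a
      rw [List.cons_append, List.cons_append, mul_cons, mul_cons, ih (hα.contract c) hβ,
        ih hα.bar (hβ.contract c), smul_add]

theorem IsLastLinear.ofDegreeZero (c : R) : IsLastLinear ι j (ofDegreeZero c) :=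
  ⟨fun l a b => by cases l <;> simp [Form.ofDegreeZero],
    fun l a b => by cases l <;> simp [Form.ofDegreeZero]⟩

theorem IsLastLinear.pow {α : Form G R} (hα : IsLastLinear ι j α) (m : ℕ) :
    IsLastLinear ι j (α ^ m) := by
  induction m with
  | zero => exact IsLastLinear.ofDegreeZero 1
  | succ m ih => rw [pow_succ]; exact ih.mul hα

theorem IsLastLinear.comp {α : Form G R} (hα : IsLastLinear ι j α) (t : R →+ S)
    (ht : ∀ (f : S) r, t (f • r) = f * t r) : IsLastLinear ι j (Form.comp t α) :=
  ⟨fun l a b => by simp [hα.map_add], fun l f a => by simp [hα.map_smul, ht]⟩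

end LastLinear

end Form

/-! ### Connections along a Leibniz algebra acting by derivations -/

/-- A Leibniz algebra `G` acting on the commutative ring `S` by derivations. -/
structure LeibnizAction (G S : Type*) [AddCommGroup G] [CommRing S] where
  br : G → G → G
  jacobi : ∀ a b c, br (br a b) c = br a (br b c) - br b (br a c)
  act : G → S → S
  act_add : ∀ a f g, act a (f + g) = act a f + act a g
  act_mul : ∀ a f g, act a (f * g) = act a f * g + f * act a g
  act_br : ∀ a b f, act (br a b) f = act a (act b f) - act b (act a f)

/-- A connection on the `S`-module `V` along `G`. -/
structure LeibnizConnection {G S : Type*} [AddCommGroup G] [CommRing S]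
    (𝒜 : LeibnizAction G S) (V : Type*) [AddCommGroup V] [Module S V] where
  toFun : G →+ V →+ V
  leibniz : ∀ a f v, toFun a (f • v) = 𝒜.act a f • v + f • toFun a v

namespace LeibnizConnection

variable {G S V : Type*} [AddCommGroup G] [CommRing S] {𝒜 : LeibnizAction G S}
  [AddCommGroup V] [Module S V] (D : LeibnizConnection 𝒜 V)

instance : CoeFun (LeibnizConnection 𝒜 V) fun _ => G → V →+ V := ⟨fun D => D.toFun⟩

/-- The commutator `[∇_a, T]`. -/
def ad (a : G) (T : Module.End S V) : Module.End S V where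
  toFun v := D a (T v) - T (D a v)
  map_add' v w := by simp only [map_add]; abel
  map_smul' f v := by
    simp only [map_smul, D.leibniz, map_add, RingHom.id_apply, smul_sub]; abel

@[simp] theorem ad_apply (a : G) (T : Module.End S V) (v : V) :
    D.ad a T v = D a (T v) - T (D a v) := rfl

theorem ad_add (a : G) (T U : Module.End S V) : D.ad a (T + U) = D.ad a T + D.ad a U := by
  ext v; simp only [ad_apply, LinearMap.add_apply, map_add]; abel

theorem ad_mul (a : G) (T U : Module.End S V) :
    D.ad a (T * U) = D.ad a T * U + T * D.ad a U := by
  ext v; simp only [ad_apply, LinearMap.add_apply, Module.End.mul_apply, map_sub]; abel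

theorem ad_zero (a : G) : D.ad a 0 = 0 := by ext v; simp

/-- The curvature endomorphism `[∇_a, ∇_b] - ∇_{[a, b]}`. -/
def curvEnd (a b : G) : Module.End S V where
  toFun v := D a (D b v) - D b (D a v) - D (𝒜.br a b) v
  map_add' v w := by simp only [map_add]; abel
  -- The terms in which `f` is differentiated cancel because the action is compatible with brackets
  -- (`act_br`).
  map_smul' f v := by
    simp only [D.leibniz, map_add, RingHom.id_apply, smul_sub, 𝒜.act_br, sub_smul]; abel

@[simp] theorem curvEnd_apply (a b : G) (v : V) :
    D.curvEnd a b v = D a (D b v) - D b (D a v) - D (𝒜.br a b) v := rfl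

/-- The curvature as a form. -/
def curv : Form G (Module.End S V) :=
  ⟨fun l => match l with
    | [a, b] => D.curvEnd a b
    | _ => 0⟩

@[simp] theorem curv_pair (a b : G) : D.curv [a, b] = D.curvEnd a b := rfl

theorem curv_of_length {l : List G} (h : l.length ≠ 2) : D.curv l = 0 := by
  match l with
  | [] => rfl
  | [_] => rfl
  | [_, _] => exact absurd rfl h
  | _ :: _ :: _ :: _ => rfl

theorem bar_curv : Form.bar D.curv = D.curv := by
  refine Form.ext' fun l => ?_
  rw [Form.bar_apply]
  by_cases h : l.length = 2
  · rw [h]; simp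
  · rw [D.curv_of_length h, mul_zero]

/-- The Bianchi identity. -/
theorem diff_curv : Form.diff 𝒜.br D.ad D.curv = 0 := by
  refine Form.ext' fun l => ?_
  by_cases h : l.length = 3
  · obtain ⟨a, b, c, rfl⟩ := List.length_eq_three.1 h
    ext v
    -- On three arguments all composites of connections cancel in pairs, and the iterated brackets
    -- cancel by the Leibniz identity `𝒜.jacobi`.
    simp only [Form.diff_cons, Form.diff_nil, Form.lie_cons, Form.lie_nil, Form.contract_apply,
      curv_pair, LinearMap.sub_apply, ad_apply, curvEnd_apply, map_sub, 𝒜.jacobi,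
      AddMonoidHom.sub_apply, Form.zero_apply, LinearMap.zero_apply, sub_zero]
    abel
  · exact Form.diff_eq_zero_of_length D.ad_zero fun l' hl =>
      D.curv_of_length fun h' => h (by omega)

section Chern

variable (tr : Module.End S V →+ S)

/-- The form `tr(F^k)`. -/
def chern (k : ℕ) : Form G S := Form.comp tr (D.curv ^ k)

/-- The hypothesis on `tr` lets `d` pass through the trace as the covariant differential, which
kills powers of the curvature by the Bianchi identity. -/
theorem diff_chern (hder : ∀ a T, tr (D.ad a T) = 𝒜.act a (tr T)) (k : ℕ) :
    Form.diff 𝒜.br 𝒜.act (D.chern tr (k + 1)) = 0 := by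
  rw [chern, Form.diff_comp 𝒜.br D.ad 𝒜.act tr hder, Form.diff_pow D.ad_add D.ad_mul D.diff_curv,
    map_zero]

/-- For `a` the parameter direction this becomes the Chern–Simons integrand, including its factor
`k`. -/
theorem contract_chern (htr : ∀ T U, tr (T * U) = tr (U * T)) (k : ℕ) (a : G) (l : List G) :
    Form.contract a (D.chern tr (k + 1)) l =
      (k + 1) • tr ((Form.contract a D.curv * D.curv ^ k) l) :=
  Form.trace_contract_pow tr htr D.bar_curv a k l

end Chern

section Adjoint

variable {W : Type*} [AddCommGroup W] [Module S W] {D' : LeibnizConnection 𝒜 V}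
  {B : V →+ V →+ S}

/-- Moving both connections of a commutator across `B` reverses their order and hence the sign. The
derivatives of `B v w` cancel by `act_br`. -/
theorem isAdjointPair_curv (h : ∀ a v w, B (D a v) w + B v (D' a w) = 𝒜.act a (B v w)) :
    Form.IsAdjointPair B D.curv (-D'.curv) := by
  have h' : ∀ a v w, B (D a v) w = 𝒜.act a (B v w) - B v (D' a w) := fun a v w => by
    rw [← h]; abel
  intro l v w
  by_cases hl : l.length = 2
  · obtain ⟨a, b, rfl⟩ := List.length_eq_two.1 hl
    have hs : ∀ a f g, 𝒜.act a (f - g) = 𝒜.act a f - 𝒜.act a g := fun a f g =>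
      map_sub (AddMonoidHom.mk' (𝒜.act a) (𝒜.act_add a)) f g
    simp only [curv_pair, Form.neg_apply, neg_smul, Module.End.smul_def, curvEnd_apply, map_sub,
      AddMonoidHom.sub_apply, h', hs, 𝒜.act_br, map_neg]
    abel
  · simp [D.curv_of_length hl, D'.curv_of_length hl]

/-- The power `(-F')^k` is adjoint to `F^k`, because the curvature is an even form, and adjoint
endomorphisms have the same trace. -/
theorem chern_adjoint (h : ∀ a v w, B (D a v) w + B v (D' a w) = 𝒜.act a (B v w))
    (tr : Module.End S V →+ S)
    (hadj : ∀ T T' : Module.End S V, (∀ v w, B (T v) w = B v (T' w)) → tr T = tr T')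
    {k : ℕ} (hk : Odd k) (l : List G) : D'.chern tr k l = -D.chern tr k l := by
  have := (D.isAdjointPair_curv h).pow D.bar_curv k l
  have h2 := hadj _ _ this
  rw [hk.neg_pow, Form.neg_apply, map_neg] at h2
  rw [chern, chern, Form.comp_apply, Form.comp_apply, h2, neg_neg]

end Adjoint

section Comparison

variable {Γ : Type*} {D' : LeibnizConnection 𝒜 V} {j : Γ → G}

/-- Two connections that agree along `Γ` and differ by `u` along `s`, where `s` commutes
with `Γ`. -/
theorem contract_chern_of_agree (tr : Module.End S V →+ S)
    (htr : ∀ T U, tr (T * U) = tr (U * T)) (hder : ∀ a T, tr (D.ad a T) = 𝒜.act a (tr T))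
    (hj : ∀ a, D (j a) = D' (j a)) (hbr : ∀ a b, ∃ c, 𝒜.br (j a) (j b) = j c) (s : G)
    (hs : ∀ a, 𝒜.br s (j a) = 0) (u : Module.End S V) (hu : ∀ v, D' s v = D s v + u v)
    (k : ℕ) (l : List Γ) :
    Form.contract s (D.chern tr (k + 1)) (l.map j) =
      Form.contract s (D'.chern tr (k + 1)) (l.map j) +
        (k + 1) • Form.diff 𝒜.br 𝒜.act
          (Form.comp tr (Form.ofDegreeZero u * D.curv ^ k)) (l.map j) := by
  let φ : Form G (Module.End S V) →+* Form Γ (Module.End S V) := Form.mapHom j (RingHom.id _)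
  have hφ : ∀ α l, φ α l = α (l.map j) := fun _ _ => rfl
  -- On arguments from `Γ` the curvature involves the connection only along `Γ`, since `Γ` is closed
  -- under brackets.
  have h1 : φ D.curv = φ D'.curv := by
    refine Form.ext' fun l => ?_
    rw [hφ, hφ]
    by_cases hl : l.length = 2
    · obtain ⟨a, b, rfl⟩ := List.length_eq_two.1 hl
      obtain ⟨c, hc⟩ := hbr a b
      ext v
      simp [hj, hc]
    · rw [D.curv_of_length (by simpa using hl), D'.curv_of_length (by simpa using hl)]
  -- As `s` commutes with `Γ`, `F'(s, a) = [∇_s + u, ∇_a] = F(s, a) - [∇_a, u]`, and `[∇_a, u]` is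
  -- the covariant differential of `u`.
  have h2 : φ (Form.contract s D.curv) = φ (Form.contract s D'.curv) +
      φ (Form.diff 𝒜.br D.ad (Form.ofDegreeZero u)) := by
    refine Form.ext' fun l => ?_
    rw [Form.add_apply, hφ, hφ, hφ]
    by_cases hl : l.length = 1
    · obtain ⟨a, rfl⟩ := List.length_eq_one_iff.1 hl
      ext v
      simp [hj, hs, Form.diff_cons, hu]
      abel
    · rw [Form.contract_apply, Form.contract_apply, D.curv_of_length (by simpa using hl),
        D'.curv_of_length (by simpa using hl), Form.diff_eq_zero_of_length D.ad_zero, add_zero]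
      intro l' hl'
      match l' with
      | [] => simp at hl'; omega
      | _ :: _ => rfl
  rw [D.contract_chern tr htr, D'.contract_chern tr htr, ← smul_add]
  congr 1
  -- By the Leibniz rule only `u` is differentiated. The power of the curvature is covariantly
  -- closed, also for `k = 0`, where it is the identity.
  have h3 : Form.diff 𝒜.br 𝒜.act (Form.comp tr (Form.ofDegreeZero u * D.curv ^ k)) =
      Form.comp tr (Form.diff 𝒜.br D.ad (Form.ofDegreeZero u) * D.curv ^ k) := by
    have h0 : Form.diff 𝒜.br D.ad (D.curv ^ k) = 0 := by
      cases k with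
      | zero =>
        refine Form.ext' fun l => ?_
        by_cases hl : l.length = 1
        · obtain ⟨a, rfl⟩ := List.length_eq_one_iff.1 hl
          ext v
          simp [Form.diff_cons]
        · refine Form.diff_eq_zero_of_length D.ad_zero fun l' hl' => ?_
          match l' with
          | [] => simp at hl'; omega
          | _ :: _ => rfl
      | succ k => exact Form.diff_pow D.ad_add D.ad_mul D.diff_curv k
    rw [Form.diff_comp 𝒜.br D.ad 𝒜.act tr hder, Form.diff_mul D.ad_add D.ad_mul, h0, mul_zero,
      add_zero]
  rw [h3, Form.comp_apply, ← map_add]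
  congr 1
  rw [← hφ, ← hφ, ← hφ, map_mul, map_mul, map_mul, map_pow, map_pow, h1, h2, add_mul, Form.add_apply]

end Comparison

section Regularity

variable {k C : Type*} [CommRing k] [CommRing C] [Algebra k C] {ι : C →+* S}

/-- Commutators cancel in `F(a, b) + F(b, a) = -∇_{[a,b] + [b,a]}`, so the symbol is `f ↦ -∇_{dd
f}`. It is linear over `S` because `dd f` acts by zero, and a derivation because `∇_{dd f}` is one
in `f`. -/
theorem hasDerivationSymbol_curv {pair : G → G → C} (dd : C → G)
    (hsymm : ∀ a b, 𝒜.br a b + 𝒜.br b a = dd (pair a b))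
    (hact : ∀ f g, 𝒜.act (dd f) g = 0) (hadd : ∀ f g, dd (f + g) = dd f + dd g)
    (hmul : ∀ f g v, D (dd (f * g)) v = ι f • D (dd g) v + ι g • D (dd f) v)
    (hconst : ∀ c : k, dd (algebraMap k C c) = 0) :
    Form.HasDerivationSymbol k ι pair D.curv := by
  let T : C → Module.End S V := fun f =>
    { toFun := fun v => -D (dd f) v
      map_add' := fun v w => by rw [map_add, neg_add]
      map_smul' := fun g v => by rw [D.leibniz, hact, zero_smul, zero_add, smul_neg]; rfl }
  have hT : ∀ f v, T f v = -D (dd f) v := fun _ _ => rfl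
  refine ⟨fun f => Form.ofDegreeZero (T f), ?_, ?_, ?_, ?_⟩
  · intro u a b v
    by_cases h : u.length + v.length = 0
    · obtain rfl : u = [] := List.length_eq_zero_iff.1 (by omega)
      obtain rfl : v = [] := List.length_eq_zero_iff.1 (by omega)
      ext w
      simp only [List.nil_append, curv_pair, LinearMap.add_apply, curvEnd_apply,
        Form.ofDegreeZero_nil, hT, ← hsymm, map_add, AddMonoidHom.add_apply]
      abel
    · rw [D.curv_of_length (by simp; omega), D.curv_of_length (by simp; omega)]
      cases u with
      | nil => cases v with
        | nil => simp at h
        | cons => simp [Form.ofDegreeZero]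
      | cons => simp [Form.ofDegreeZero]
  · intro f g
    refine Form.ext' fun l => ?_
    cases l with
    | nil => ext v; simp [hT, hadd]; abel
    | cons => simp [Form.ofDegreeZero]
  · intro f g
    refine Form.ext' fun l => ?_
    cases l with
    | nil => ext v; simp [hT, hmul]; abel
    | cons => simp [Form.ofDegreeZero]
  · intro c
    refine Form.ext' fun l => ?_
    cases l with
    | nil => ext v; simp [hT, hconst]
    | cons => simp [Form.ofDegreeZero]

/-- The derivative of the coefficient `f` occurs in `∇_a ∇_{f x}` and in `∇_{[a, f x]}` and cancels.
-/
theorem isLastLinear_curv {Γ : Type*} [Add Γ] [SMul C Γ] {j : Γ → G}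
    (hj : ∀ a b, j (a + b) = j a + j b)
    (hbr : ∀ a x y, 𝒜.br a (j x + j y) = 𝒜.br a (j x) + 𝒜.br a (j y))
    (hD : ∀ f x v, D (j (f • x)) v = ι f • D (j x) v)
    (hDbr : ∀ a f x v, D (𝒜.br a (j (f • x))) v =
      ι f • D (𝒜.br a (j x)) v + 𝒜.act a (ι f) • D (j x) v) :
    Form.IsLastLinear ι j D.curv := by
  constructor
  · intro l x y
    by_cases hl : l.length = 1
    · obtain ⟨a, rfl⟩ := List.length_eq_one_iff.1 hl
      ext v
      simp only [List.cons_append, List.nil_append, curv_pair, LinearMap.add_apply, curvEnd_apply,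
        hj, hbr, map_add, AddMonoidHom.add_apply]
      abel
    · rw [D.curv_of_length, D.curv_of_length, D.curv_of_length, add_zero] <;> simpa using hl
  · intro l f x
    by_cases hl : l.length = 1
    · obtain ⟨a, rfl⟩ := List.length_eq_one_iff.1 hl
      ext v
      simp only [List.cons_append, List.nil_append, curv_pair, LinearMap.smul_apply, curvEnd_apply,
        hD, hDbr, D.leibniz, smul_sub]
      abel
    · rw [D.curv_of_length, D.curv_of_length, smul_zero] <;> simpa using hl

end Regularity

end LeibnizConnection

end Courant

end

/-! ### Forms of fixed degree: sums over shuffles and the explicit differential -/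

noncomputable section

namespace Courant

namespace Form

variable {G R : Type*} [Ring R]

/-- The form given by a function of `p` arguments. -/
def ofFun {p : ℕ} (α : (Fin p → G) → R) : Form G R :=
  ⟨fun l => if h : l.length = p then α fun i => l.get (i.cast h.symm) else 0⟩

theorem ofFun_ofFn {p : ℕ} (α : (Fin p → G) → R) (e : Fin p → G) :
    ofFun α (List.ofFn e) = α e := by
  have h : (List.ofFn e).length = p := List.length_ofFn
  simp only [ofFun, h, dite_true]
  congr 1
  funext i
  simp

theorem ofFun_of_length {p : ℕ} (α : (Fin p → G) → R) {l : List G} (h : l.length ≠ p) :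
    ofFun α l = 0 := dif_neg h

theorem contract_ofFun_succ {p : ℕ} (α : (Fin (p + 1) → G) → R) (a : G) :
    contract a (ofFun α) = ofFun fun e => α (Fin.cons a e) := by
  refine ext' fun l => ?_
  by_cases h : l.length = p
  · subst h
    simp only [contract_apply, ofFun, List.length_cons, dite_true]
    congr 1
    funext i
    refine Fin.cases ?_ (fun i => ?_) i <;> simp
  · rw [ofFun_of_length _ h, contract_apply, ofFun_of_length _ (by simpa using h)]

theorem contract_ofFun_zero (α : (Fin 0 → G) → R) (a : G) : contract a (ofFun α) = 0 :=
  ext' fun l => ofFun_of_length α (l := a :: l) (by simp)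

theorem bar_ofFun {p : ℕ} (α : (Fin p → G) → R) : bar (ofFun α) = ((-1) ^ p : ℤ) • ofFun α := by
  have hs : ∀ (c : ℤ) (β : Form G R) l, (c • β) l = c • β l := fun _ _ _ => rfl
  refine ext' fun l => ?_
  rw [bar_apply, hs]
  by_cases h : l.length = p
  · rw [h]; simp
  · rw [ofFun_of_length _ h, mul_zero, smul_zero]

theorem eq_ofFun {p : ℕ} {β : Form G R} (h : ∀ l, l.length ≠ p → β l = 0) :
    ofFun (fun e : Fin p → G => β (List.ofFn e)) = β := by
  refine ext' fun l => ?_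
  by_cases hl : l.length = p
  · subst hl
    simp [ofFun]
  · rw [ofFun_of_length _ hl, h l hl]

/-! ### Shuffles -/

/-- Extension of a permutation by a fixed first element. -/
def extendPerm {m : ℕ} (ς : Equiv.Perm (Fin m)) : Equiv.Perm (Fin (m + 1)) :=
  Equiv.Perm.decomposeFin.symm (0, ς)

@[simp] theorem extendPerm_zero {m : ℕ} (ς : Equiv.Perm (Fin m)) : extendPerm ς 0 = 0 := by
  simp [extendPerm]

@[simp] theorem extendPerm_succ {m : ℕ} (ς : Equiv.Perm (Fin m)) (i : Fin m) :
    extendPerm ς i.succ = (ς i).succ := by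
  simp [extendPerm]

theorem sign_extendPerm {m : ℕ} (ς : Equiv.Perm (Fin m)) :
    Equiv.Perm.sign (extendPerm ς) = Equiv.Perm.sign ς := by
  simp [extendPerm]

/-- Permutations are sorted by the position `i` that is sent to `0`. The cycle `i.cycleRange` moves
`i` to the front, and `ς` permutes the remaining positions in their old order. -/
theorem sum_perm_succ {m : ℕ} {V : Type*} [AddCommMonoid V]
    (f : Equiv.Perm (Fin (m + 1)) → V) :
    ∑ ς, f ς = ∑ i : Fin (m + 1), ∑ ς : Equiv.Perm (Fin m), f (extendPerm ς * i.cycleRange) := by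
  rw [← Fintype.sum_prod_type']
  symm
  refine Fintype.sum_bijective
    (fun p : Fin (m + 1) × Equiv.Perm (Fin m) => extendPerm p.2 * p.1.cycleRange)
    ((Fintype.bijective_iff_injective_and_card _).2 ⟨?_, ?_⟩) _ _ fun _ => rfl
  · rintro ⟨i, ς⟩ ⟨i', ς'⟩ h
    have hi : i = i' := by
      have h0 : ∀ (i : Fin (m + 1)) (ς : Equiv.Perm (Fin m)),
          (extendPerm ς * i.cycleRange) i = 0 := by intro i ς; simp
      have h1 := h0 i' ς'
      have h2 := h0 i ς
      simp only at h
      rw [← h] at h1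
      exact (extendPerm ς * i.cycleRange).injective (h2.trans h1.symm)
    subst hi
    have h2 : extendPerm ς = extendPerm ς' := mul_right_cancel h
    simp only [Prod.mk.injEq, true_and]
    ext j
    have := congrArg (fun c => c j.succ) h2
    simp only [extendPerm_succ, Fin.succ_inj] at this
    rw [this]
  · simp [Fintype.card_perm, Nat.factorial_succ]

/-- The permutation is increasing on the first `p` elements and on the remaining ones. -/
def IsShuffle (p : ℕ) {m : ℕ} (ς : Equiv.Perm (Fin m)) : Prop :=
  ∀ i j : Fin m, i < j → ((j : ℕ) < p ∨ p ≤ (i : ℕ)) → ς i < ς j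

theorem isShuffle_extend_zero {p m : ℕ} (ς : Equiv.Perm (Fin m)) :
    IsShuffle (p + 1) (extendPerm ς) ↔ IsShuffle p ς := by
  constructor
  · intro h i j hij hp
    have := h i.succ j.succ (Fin.succ_lt_succ_iff.2 hij) (by simpa using hp)
    simpa using this
  · intro h i j hij hp
    induction j using Fin.cases with
    | zero => exact absurd hij (Fin.not_lt_zero _)
    | succ j =>
      induction i using Fin.cases with
      | zero => simp
      | succ i =>
        have := h i j (Fin.succ_lt_succ_iff.1 hij) (by simpa using hp)
        simpa using this

theorem cycleRange_of_val_lt {m : ℕ} {p i : Fin (m + 1)} (h : (i : ℕ) < p) :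
    ∃ i' : Fin m, (i' : ℕ) = i ∧ p.cycleRange i = i'.succ := by
  refine ⟨⟨i, by omega⟩, rfl, ?_⟩
  rw [Fin.cycleRange_of_lt (Fin.lt_def.2 h)]
  have hi : i ≠ Fin.last m := by
    intro h'; subst h'; simp at h; omega
  ext
  rw [Fin.val_add_one_of_lt (Fin.lt_last_iff_ne_last.2 hi)]
  simp

theorem cycleRange_of_val_gt {m : ℕ} {p i : Fin (m + 1)} (h : (p : ℕ) < i) :
    ∃ i' : Fin m, (i' : ℕ) + 1 = i ∧ p.cycleRange i = i'.succ := by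
  refine ⟨⟨i - 1, by omega⟩, by simp; omega, ?_⟩
  rw [Fin.cycleRange_of_gt (Fin.lt_def.2 h)]
  ext
  simp; omega

/-- Here `0` is the value at the first position of the second block. Deleting that position
preserves the first block and shortens the second by one. -/
theorem isShuffle_extend_cycleRange {m : ℕ} (ς : Equiv.Perm (Fin m)) (p : Fin (m + 1)) :
    IsShuffle p (extendPerm ς * p.cycleRange) ↔ IsShuffle p ς := by
  constructor
  · intro h i j hij hp
    have h1 : ∀ i : Fin m, ∃ i' : Fin (m + 1), p.cycleRange i' = i.succ ∧
        ((i : ℕ) < p → (i' : ℕ) = i) ∧ (p ≤ (i : ℕ) → (i' : ℕ) = i + 1) := by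
      intro i
      by_cases hi : (i : ℕ) < p
      · obtain ⟨k, hk, hk'⟩ := cycleRange_of_val_lt (p := p) (i := i.castSucc) (by simpa using hi)
        refine ⟨i.castSucc, ?_, fun _ => rfl, fun h => absurd h (by omega)⟩
        rw [hk']; congr 1; ext; simpa using hk
      · obtain ⟨k, hk, hk'⟩ := cycleRange_of_val_gt (p := p) (i := i.succ) (by simp; omega)
        refine ⟨i.succ, ?_, fun h => absurd h hi, fun _ => by simp⟩
        rw [hk']; congr 1; ext; simpa using hk
    obtain ⟨i', hi, hi1, hi2⟩ := h1 i
    obtain ⟨j', hj, hj1, hj2⟩ := h1 j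
    have := h i' j' (by rw [Fin.lt_def] at hij ⊢; omega) (by rw [Fin.lt_def] at hij; omega)
    simpa [hi, hj] using this
  · intro h i j hij hp
    rw [Fin.lt_def] at hij
    rcases lt_trichotomy (j : ℕ) p with hj | hj | hj
    · obtain ⟨i', hi1, hi2⟩ := cycleRange_of_val_lt (p := p) (i := i) (by omega)
      obtain ⟨j', hj1, hj2⟩ := cycleRange_of_val_lt hj
      have := h i' j' (by rw [Fin.lt_def]; omega) (by omega)
      simpa [hi2, hj2] using this
    · omega
    · obtain ⟨j', hj1, hj2⟩ := cycleRange_of_val_gt hj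
      rcases eq_or_lt_of_le (show (p : ℕ) ≤ i by omega) with hi | hi
      · obtain rfl : p = i := Fin.ext hi
        simp [hj2]
      · obtain ⟨i', hi1, hi2⟩ := cycleRange_of_val_gt hi
        have := h i' j' (by rw [Fin.lt_def]; omega) (by omega)
        simpa [hi2, hj2] using this

/-- The least value of a shuffle is taken at the first position of one of its blocks. -/
theorem isShuffle_extend_imp {p m : ℕ} (ς : Equiv.Perm (Fin m)) (i : Fin (m + 1))
    (h : IsShuffle p (extendPerm ς * i.cycleRange)) : (i = 0 ∧ 0 < p) ∨ (i : ℕ) = p := by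
  have h0 : (extendPerm ς * i.cycleRange) i = 0 := by simp
  by_contra hcon
  rw [not_or, not_and] at hcon
  rcases lt_or_gt_of_ne hcon.2 with hi | hi
  · have hne : i ≠ 0 := fun h' => hcon.1 h' (by omega)
    have := h 0 i (Fin.pos_iff_ne_zero.2 hne) (Or.inl hi)
    rw [h0] at this
    exact absurd this (Fin.not_lt_zero _)
  · have := h ⟨p, by omega⟩ i (Fin.lt_def.2 hi) (Or.inr le_rfl)
    rw [h0] at this
    exact absurd this (Fin.not_lt_zero _)

open Classical in
/-- The sum over shuffles is the product of forms. -/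
theorem sum_shuffles {m p q : ℕ} (h : p + q = m) (α : (Fin p → G) → R) (τ : (Fin q → G) → R)
    (e : Fin m → G) :
    ∑ ς : Equiv.Perm (Fin m) with IsShuffle p ς, ((Equiv.Perm.sign ς : ℤˣ) : ℤ) •
      (α (fun i => e (ς ⟨i, by omega⟩)) * τ (fun j => e (ς ⟨p + j, by omega⟩))) =
      (ofFun α * ofFun τ) (List.ofFn e) := by
  induction m generalizing p q with
  | zero =>
    obtain rfl : p = 0 := by omega
    obtain rfl : q = 0 := by omega
    rw [Finset.sum_filter, Fintype.sum_unique, if_pos (show IsShuffle 0 _ from fun i => i.elim0)]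
    simp only [List.ofFn_zero, mul_nil]
    have hα := ofFun_ofFn α Fin.elim0
    have hτ := ofFun_ofFn τ Fin.elim0
    rw [List.ofFn_zero] at hα hτ
    rw [hα, hτ]
    simp only [Equiv.Perm.default_eq, Equiv.Perm.sign_one, Units.val_one, one_smul]
    congr <;> funext i <;> exact i.elim0
  | succ m ih =>
    rw [Finset.sum_filter, sum_perm_succ]
    -- If the first argument sits at position `0` it is fed to `α`; at position `p` it is fed to
    -- `τ`, and the sign `(-1)^p` of the cycle is that of `bar`. When `p = 0` the two positions
    -- coincide, and the term from `α` vanishes.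
    have key : ∀ i : Fin (m + 1), ∑ ς : Equiv.Perm (Fin m),
        (if IsShuffle p (extendPerm ς * i.cycleRange) then
          ((Equiv.Perm.sign (extendPerm ς * i.cycleRange) : ℤˣ) : ℤ) •
          (α (fun k => e ((extendPerm ς * i.cycleRange) ⟨k, by omega⟩)) *
            τ (fun k => e ((extendPerm ς * i.cycleRange) ⟨p + k, by omega⟩))) else 0) =
        (if i = 0 then (contract (e 0) (ofFun α) * ofFun τ) (List.ofFn (Fin.tail e)) else 0) +
        (if (i : ℕ) = p then
          (bar (ofFun α) * contract (e 0) (ofFun τ)) (List.ofFn (Fin.tail e)) else 0) := by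
      intro i
      by_cases hA : i = 0 ∧ 0 < p
      · obtain ⟨rfl, hp⟩ := hA
        obtain ⟨p, rfl⟩ := Nat.exists_eq_succ_of_ne_zero hp.ne'
        rw [if_pos rfl, if_neg (by simp), add_zero, contract_ofFun_succ,
          ← ih (p := p) (q := q) (by omega), Finset.sum_filter]
        refine Finset.sum_congr rfl fun ς _ => ?_
        rw [Fin.cycleRange_zero, mul_one, sign_extendPerm]
        simp only [Nat.succ_eq_add_one, isShuffle_extend_zero]
        split_ifs
        · congr 3
          · funext k
            refine Fin.cases ?_ (fun k => ?_) k
            · exact congrArg e (extendPerm_zero ς)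
            · exact congrArg e (extendPerm_succ ς ⟨k, by omega⟩)
          · funext k
            have : (⟨p + 1 + k, by omega⟩ : Fin (m + 1)) = Fin.succ ⟨p + k, by omega⟩ := by
              ext; simp; omega
            rw [this, extendPerm_succ]; rfl
        · rfl
      · by_cases hB : (i : ℕ) = p
        · subst hB
          have h1 : (if i = 0 then
              (contract (e 0) (ofFun α) * ofFun τ) (List.ofFn (Fin.tail e)) else 0) = 0 := by
            split_ifs with h0
            · subst h0
              rw [show contract (e 0) (ofFun α) = 0 from contract_ofFun_zero α _, zero_mul]
              rfl
            · rfl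
          obtain ⟨q, rfl⟩ : ∃ q', q = q' + 1 := ⟨q - 1, by omega⟩
          rw [h1, zero_add, if_pos rfl, contract_ofFun_succ, bar_ofFun, smul_mul_assoc]
          have hs : ∀ (c : ℤ) (β : Form G R) l, (c • β) l = c • β l := fun _ _ _ => rfl
          rw [hs, ← ih (p := i) (q := q) (by omega), Finset.sum_filter, Finset.smul_sum]
          refine Finset.sum_congr rfl fun ς _ => ?_
          simp only [isShuffle_extend_cycleRange]
          split_ifs
          · rw [Equiv.Perm.sign_mul, sign_extendPerm, Fin.sign_cycleRange, mul_comm, Units.val_mul,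
              mul_smul]
            rw [Units.val_pow_eq_pow_val, Units.val_neg, Units.val_one]
            congr 4
            · funext k
              obtain ⟨k', hk, hk'⟩ := cycleRange_of_val_lt (p := i)
                (i := ⟨k, by omega⟩) (by simp)
              rw [Equiv.Perm.mul_apply, hk', extendPerm_succ]
              have : k' = ⟨k, by omega⟩ := Fin.ext hk
              rw [this]; rfl
            · funext k
              refine Fin.cases ?_ (fun k => ?_) k
              · rw [Equiv.Perm.mul_apply]
                have : (⟨(i : ℕ) + ((0 : Fin (q + 1)) : ℕ), by simp; omega⟩ : Fin (m + 1)) = i := by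
                  ext; simp
                rw [this, Fin.cycleRange_self, extendPerm_zero]; rfl
              · obtain ⟨k', hk, hk'⟩ := cycleRange_of_val_gt (p := i)
                  (i := ⟨i + (k.succ : Fin (q + 1)), by simp; omega⟩) (by simp)
                rw [Equiv.Perm.mul_apply, hk', extendPerm_succ]
                have : k' = ⟨i + k, by omega⟩ := by ext; simp at hk ⊢; omega
                rw [this]; rfl
          · simp
        · rw [if_neg hB, add_zero]
          have hz : ∀ ς : Equiv.Perm (Fin m), ¬ IsShuffle p (extendPerm ς * i.cycleRange) :=
            fun ς h' => (isShuffle_extend_imp ς i h').elim hA hB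
          simp only [hz, if_false, Finset.sum_const_zero]
          split_ifs with h0
          · subst h0
            exfalso
            simp at hA hB
            omega
          · rfl
    rw [Finset.sum_congr rfl fun i _ => key i, Finset.sum_add_distrib, Finset.sum_ite_eq',
      if_pos (Finset.mem_univ _), List.ofFn_succ, mul_cons]
    congr 1
    by_cases hp : p < m + 1
    · rw [Finset.sum_eq_single ⟨p, hp⟩]
      · simp; rfl
      · intro b _ hb
        rw [if_neg fun h' => hb (Fin.ext h')]
      · simp
    -- With an empty second block no position equals `p`, in accordance with `ι τ = 0` in degree
    -- zero.
    · obtain rfl : q = 0 := by omega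
      rw [show contract (e 0) (ofFun τ) = 0 from contract_ofFun_zero τ _, mul_zero, zero_apply]
      refine Finset.sum_eq_zero fun i _ => if_neg (by omega)

/-! ### The differential on functions of finitely many arguments -/

section Differential

variable (br : G → G → G) (L : G → R → R)

theorem lie_ofFn {k : ℕ} (a : G) (η : Form G R) (e : Fin k → G) :
    lie br L a η (List.ofFn e) = L a (η (List.ofFn e)) -
      ∑ j, η (List.ofFn (Function.update e j (br a (e j)))) := by
  induction k generalizing η with
  | zero => simp
  | succ k ih =>
    rw [List.ofFn_succ, lie_cons, ih, Fin.sum_univ_succ]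
    have h1 : List.ofFn (Function.update e 0 (br a (e 0))) =
        br a (e 0) :: List.ofFn fun i => e (Fin.succ i) := by
      rw [List.ofFn_succ]; simp [Fin.succ_ne_zero]
    have h2 : ∀ i : Fin k, List.ofFn (Function.update e i.succ (br a (e i.succ))) =
        e 0 :: List.ofFn (Function.update (fun i => e (Fin.succ i)) i (br a (e i.succ))) := by
      intro i
      rw [List.ofFn_succ]
      congr 1
      congr 1
      funext l
      by_cases hl : l = i
      · subst hl; simp
      · rw [Function.update_of_ne (fun h => hl (Fin.succ_injective _ h)),
          Function.update_of_ne hl]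
    rw [h1]
    simp only [h2, contract_apply]
    abel

/-- Unrolling Cartan's formula: the terms with `i = 0` form the Lie derivative along `e 0`, and the
others come from `-d ι_{e 0}`, whose minus sign accounts for the shift of the index by one. -/
theorem diff_ofFn {k : ℕ} (η : Form G R) (e : Fin (k + 1) → G) :
    diff br L η (List.ofFn e) =
      (∑ i : Fin (k + 1), (-1) ^ (i : ℕ) * L (e i) (η (List.ofFn fun j => e (i.succAbove j)))) -
      ∑ i : Fin (k + 1), ∑ j : Fin (k + 1) with i < j, (-1) ^ (i : ℕ) *
        η (List.ofFn fun l => Function.update e j (br (e i) (e j)) (i.succAbove l)) := by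
  induction k generalizing η with
  | zero =>
    rw [List.ofFn_succ, diff_cons, List.ofFn_zero, diff_nil]
    simp [Finset.filter_singleton]
  | succ k ih =>
    rw [List.ofFn_succ, diff_cons, ih, lie_ofFn]
    conv_rhs => rw [Fin.sum_univ_succ, Fin.sum_univ_succ (n := k + 1)]
    have h1 : ∑ j : Fin (k + 1 + 1) with 0 < j, (-1) ^ ((0 : Fin (k + 1 + 1)) : ℕ) *
        η (List.ofFn fun l => Function.update e j (br (e 0) (e j))
          ((0 : Fin (k + 1 + 1)).succAbove l)) =
        ∑ j, η (List.ofFn (Function.update (fun i => e (Fin.succ i)) j (br (e 0) (e j.succ)))) := by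
      rw [Finset.sum_filter, Fin.sum_univ_succ]
      simp only [lt_irrefl, if_false, zero_add, Fin.succ_pos, if_true, Fin.val_zero, pow_zero,
        one_mul, Fin.zero_succAbove]
      refine Finset.sum_congr rfl fun j _ => ?_
      congr 2
      funext l
      by_cases hl : l = j
      · subst hl; simp
      · rw [Function.update_of_ne (fun h => hl (Fin.succ_injective _ h)), Function.update_of_ne hl]
    have h2 : ∀ i : Fin (k + 1), ∑ j : Fin (k + 1 + 1) with i.succ < j, (-1) ^ (i.succ : ℕ) *
        η (List.ofFn fun l => Function.update e j (br (e i.succ) (e j)) (i.succ.succAbove l)) =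
        -∑ j : Fin (k + 1) with i < j, (-1) ^ (i : ℕ) *
          contract (e 0) η (List.ofFn fun l => Function.update (fun i => e (Fin.succ i)) j
            (br (e i.succ) (e j.succ)) (i.succAbove l)) := by
      intro i
      rw [Finset.sum_filter, Fin.sum_univ_succ, if_neg (by simp), zero_add, Finset.sum_filter,
        ← Finset.sum_neg_distrib]
      refine Finset.sum_congr rfl fun j _ => ?_
      simp only [Fin.succ_lt_succ_iff]
      split_ifs
      · rw [Fin.val_succ, pow_succ, List.ofFn_succ]
        simp only [Fin.succ_succAbove_zero, Fin.succ_succAbove_succ, contract_apply, mul_neg,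
          mul_one, neg_mul]
        rw [Function.update_of_ne (Fin.succ_ne_zero j).symm]
        congr 5
        funext l
        by_cases hl : i.succAbove l = j
        · rw [hl]; simp
        · rw [Function.update_of_ne (fun h => hl (Fin.succ_injective _ h)),
            Function.update_of_ne hl]
      · simp
    have h3 : ∀ i : Fin (k + 1), (-1 : R) ^ (i.succ : ℕ) *
        L (e i.succ) (η (List.ofFn fun j => e (i.succ.succAbove j))) =
        -((-1) ^ (i : ℕ) * L (e i.succ)
          (contract (e 0) η (List.ofFn fun j => e (i.succAbove j).succ))) := by
      intro i
      rw [Fin.val_succ, pow_succ, List.ofFn_succ]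
      simp
    rw [h1]
    simp only [h2, h3, Fin.val_zero, pow_zero, one_mul, Fin.zero_succAbove,
      Finset.sum_neg_distrib]
    abel

end Differential

/-! ### Symbols and linearity on functions of finitely many arguments -/

theorem HasSymbol.ofFn {C : Type*} {pair : G → G → C} {k : ℕ} {η : Form G R}
    {σ : C → Form G R} (h : HasSymbol pair η σ) (e : Fin (k + 2) → G) (i : Fin (k + 1)) :
    η (List.ofFn e) + η (List.ofFn (e ∘ Equiv.swap i.castSucc i.succ)) =
      σ (pair (e i.castSucc) (e i.succ))
        (List.ofFn fun j => e (i.castSucc.succAbove (i.succAbove j))) := by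
  induction k generalizing η σ with
  | zero =>
    obtain rfl : i = 0 := Fin.fin_one_eq_zero i
    have := h [] (e 0) (e 1) []
    simpa [List.ofFn_succ, Equiv.swap_apply_left] using this
  | succ k ih =>
    induction i using Fin.cases with
    | zero =>
      have := h [] (e 0) (e 1) (List.ofFn fun j => e j.succ.succ)
      have h3 : ∀ j : Fin (k + 1), Equiv.swap (0 : Fin (k + 1 + 2)) 1 j.succ.succ = j.succ.succ :=
        fun j => Equiv.swap_apply_of_ne_of_ne (Fin.succ_ne_zero _)
          (by rw [← Fin.succ_zero_eq_one]; exact fun h => Fin.succ_ne_zero _ (Fin.succ_injective _ h))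
      rw [List.ofFn_succ, List.ofFn_succ, List.ofFn_succ (f := e ∘ _), List.ofFn_succ]
      simpa [h3] using this
    | succ i =>
      have := ih (h.contract (e 0)) (fun j => e j.succ) i
      simp only [contract_apply] at this
      rw [List.ofFn_succ, List.ofFn_succ (f := e ∘ _), List.ofFn_succ (n := k)]
      have h0 : Equiv.swap (i.castSucc.succ) (i.succ.succ) 0 = 0 :=
        Equiv.swap_apply_of_ne_of_ne (Fin.succ_ne_zero i.castSucc).symm (Fin.succ_ne_zero _).symm
      have h1 : ∀ j : Fin (k + 2), Equiv.swap (i.castSucc.succ) (i.succ.succ) j.succ =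
          (Equiv.swap i.castSucc i.succ j).succ :=
        fun j => (Fin.succ_injective _).swap_apply _ _ _
      simp only [Function.comp_apply, h0, h1, ← Fin.succ_castSucc, Fin.succ_succAbove_zero,
        Fin.succ_succAbove_succ]
      exact this

theorem ofFn_update_last {k : ℕ} (e : Fin (k + 1) → G) (a : G) :
    List.ofFn (Function.update e (Fin.last k) a) = List.ofFn (Fin.init e) ++ [a] := by
  rw [List.ofFn_succ', List.concat_eq_append]
  congr 2
  · funext i
    rw [Function.update_of_ne (Fin.castSucc_lt_last i).ne]; rfl
  · simp

end Form

end Courant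

end

/-! ### Functions on `P × M` and the action of `Γ(E) × P` -/

noncomputable section

namespace Courant

variable {n : ℕ} {M : Type*} [TopologicalSpace M] [ChartedSpace (EuclideanSpace ℝ (Fin n)) M]
  [IsManifold (𝓡 n) ∞ M]
  {F : Type*} [NormedAddCommGroup F] [NormedSpace ℝ F]
  {E : M → Type*} [TopologicalSpace (TotalSpace F E)] [∀ x, AddCommGroup (E x)]
  [∀ x, Module ℝ (E x)] [∀ x, TopologicalSpace (E x)] [∀ x, IsTopologicalAddGroup (E x)]
  [∀ x, ContinuousSMul ℝ (E x)] [FiberBundle F E] [VectorBundle ℝ F E]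
  [ContMDiffVectorBundle ∞ F E (𝓡 n)]
  [FiniteDimensional ℝ F] [T2Space M]
  {P : Type*} [NormedAddCommGroup P] [NormedSpace ℝ P]

/-! ### Functions on `P × M` -/

theorem two_le_infty : (2 : WithTop ℕ∞) ≤ ∞ := ENat.LEInfty.out

variable (n M P) in
/-- Smooth functions on `P × M`. -/
abbrev TimeFun : Type _ := C^∞⟮𝓘(ℝ, P).prod (𝓡 n), P × M; ℝ⟯

/-- The restriction of a smooth function on `P × M` to `{p} × M`. -/
def TimeFun.slice (f : TimeFun n M P) (p : P) : C^∞⟮𝓡 n, M; ℝ⟯ :=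
  ⟨fun x => f (p, x), f.contMDiff.comp (contMDiff_const.prodMk contMDiff_id)⟩

theorem contDiff_time {f : P × M → ℝ} (hf : ContMDiff (𝓘(ℝ, P).prod (𝓡 n)) 𝓘(ℝ, ℝ) ∞ f) (x : M) :
    ContDiff ℝ ∞ fun p => f (p, x) :=
  contMDiff_iff_contDiff.1 (hf.comp (contMDiff_id.prodMk contMDiff_const))

theorem contMDiff_space {f : P × M → ℝ} (hf : ContMDiff (𝓘(ℝ, P).prod (𝓡 n)) 𝓘(ℝ, ℝ) ∞ f) (p : P) :
    ContMDiff (𝓡 n) 𝓘(ℝ, ℝ) ∞ fun x => f (p, x) :=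
  hf.comp (contMDiff_const.prodMk contMDiff_id)

theorem differentiable_time {f : P × M → ℝ}
    (hf : ContMDiff (𝓘(ℝ, P).prod (𝓡 n)) 𝓘(ℝ, ℝ) ∞ f) (x : M) :
    Differentiable ℝ fun p => f (p, x) :=
  (contDiff_time hf x).differentiable (by simp)

variable (A : CourantAlgebroid n F E)

namespace CourantAlgebroid

/-- The derivative of a function on `P × M` along `(ρ(a), τ)`. -/
def partialAct (u : Sections n F E × P) (f : P × M → ℝ) (y : P × M) : ℝ :=
  fderiv ℝ (fun p => f (p, y.2)) y.1 u.2 + A.lieDeriv u.1 (fun x => f (y.1, x)) y.2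

/-- The value is the tangent map of `f` applied to the smooth vector field `(u.2, ρ(u.1))` on `P ×
M`. -/
theorem contMDiff_partialAct (u : Sections n F E × P) {f : P × M → ℝ}
    (hf : ContMDiff (𝓘(ℝ, P).prod (𝓡 n)) 𝓘(ℝ, ℝ) ∞ f) :
    ContMDiff (𝓘(ℝ, P).prod (𝓡 n)) 𝓘(ℝ, ℝ) ∞ (A.partialAct u f) := by
  let V : P × M → TangentBundle (𝓘(ℝ, P).prod (𝓡 n)) (P × M) := fun y =>
    (equivTangentBundleProd 𝓘(ℝ, P) P (𝓡 n) M).symm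
      (⟨y.1, u.2⟩, ⟨y.2, A.anchorSection u.1 y.2⟩)
  have h1 : ContMDiff 𝓘(ℝ, P) 𝓘(ℝ, P).tangent ∞
      (fun p : P => (⟨p, u.2⟩ : TangentBundle 𝓘(ℝ, P) P)) :=
    contMDiff_vectorSpace_iff_contDiff (V := fun _ => u.2).2 contDiff_const
  have hV : ContMDiff (𝓘(ℝ, P).prod (𝓡 n)) (𝓘(ℝ, P).prod (𝓡 n)).tangent ∞ V :=
    contMDiff_equivTangentBundleProd_symm.comp
      ((h1.comp contMDiff_fst).prodMk ((A.anchorSection u.1).contMDiff.comp contMDiff_snd))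
  have h2 := (contMDiff_snd_tangentBundle_modelSpace ℝ 𝓘(ℝ, ℝ)).comp
    ((hf.contMDiff_tangentMap (m := ∞) (by simp)).comp hV)
  convert h2 using 1
  funext y
  have hd : MDifferentiableAt (𝓘(ℝ, P).prod (𝓡 n)) 𝓘(ℝ, ℝ) f y := hf.mdifferentiable (by simp) y
  have h3 := mfderiv_prod_eq_add_apply (I := 𝓘(ℝ, P)) (I' := 𝓡 n) (I'' := 𝓘(ℝ, ℝ)) (p := y)
    (v := ((u.2, A.anchor y.2 (u.1 y.2)) : P × EuclideanSpace ℝ (Fin n))) hd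
  rw [mfderiv_eq_fderiv] at h3
  exact h3.symm

theorem partialAct_add (u : Sections n F E × P) {f h : P × M → ℝ}
    (hf : ContMDiff (𝓘(ℝ, P).prod (𝓡 n)) 𝓘(ℝ, ℝ) ∞ f)
    (hh : ContMDiff (𝓘(ℝ, P).prod (𝓡 n)) 𝓘(ℝ, ℝ) ∞ h) (y : P × M) :
    A.partialAct u (fun y => f y + h y) y = A.partialAct u f y + A.partialAct u h y := by
  have h1 := A.lieDeriv_add u.1 (contMDiff_space hf y.1) (contMDiff_space hh y.1) y.2
  have h2 := fderiv_fun_add (differentiable_time hf y.2 y.1) (differentiable_time hh y.2 y.1)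
  simp only [partialAct, h1, h2, _root_.add_apply]
  ring

theorem partialAct_mul (u : Sections n F E × P) {f h : P × M → ℝ}
    (hf : ContMDiff (𝓘(ℝ, P).prod (𝓡 n)) 𝓘(ℝ, ℝ) ∞ f)
    (hh : ContMDiff (𝓘(ℝ, P).prod (𝓡 n)) 𝓘(ℝ, ℝ) ∞ h) (y : P × M) :
    A.partialAct u (fun y => f y * h y) y =
      A.partialAct u f y * h y + f y * A.partialAct u h y := by
  have h1 := A.lieDeriv_mul u.1 (contMDiff_space hf y.1) (contMDiff_space hh y.1) y.2
  have h2 := fderiv_fun_mul (differentiable_time hf y.2 y.1) (differentiable_time hh y.2 y.1)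
  simp only [partialAct, h1, h2, _root_.add_apply, _root_.smul_apply, smul_eq_mul]
  ring

theorem lieDeriv_add_left (a b : Sections n F E) (f : M → ℝ) (x : M) :
    A.lieDeriv (a + b) f x = A.lieDeriv a f x + A.lieDeriv b f x := by
  simp [lieDeriv]

theorem lieDeriv_smul_left (h : C^∞⟮𝓡 n, M; ℝ⟯) (a : Sections n F E) (f : M → ℝ) (x : M) :
    A.lieDeriv (h • a) f x = h x * A.lieDeriv a f x := by
  simp [lieDeriv]

theorem lieDeriv_zero_left (f : M → ℝ) (x : M) : A.lieDeriv (0 : Sections n F E) f x = 0 := by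
  simp [lieDeriv]

/-- The smooth function `ρ(a)(f)`. -/
def lieFun (a : Sections n F E) (f : C^∞⟮𝓡 n, M; ℝ⟯) : C^∞⟮𝓡 n, M; ℝ⟯ :=
  ⟨A.lieDeriv a f, A.contMDiff_lieDeriv a f.contMDiff⟩

theorem bracket_smul (a b : Sections n F E) (f : C^∞⟮𝓡 n, M; ℝ⟯) :
    A.bracket a (f • b) = A.lieFun a f • b + f • A.bracket a b := by
  ext x
  exact A.bracket_leibniz a b f x

/-- The anchor is a homomorphism of brackets. -/
theorem lieDeriv_bracket (a b : Sections n F E) {f : M → ℝ}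
    (hf : ContMDiff (𝓡 n) 𝓘(ℝ, ℝ) ∞ f) (x : M) :
    A.lieDeriv (A.bracket a b) f x =
      A.lieDeriv a (A.lieDeriv b f) x - A.lieDeriv b (A.lieDeriv a f) x := by
  by_cases hx : ∃ v : E x, v ≠ 0
  · obtain ⟨v, hv⟩ := hx
    obtain ⟨c, rfl⟩ := exists_section_eq (n := n) (F := F) x v
    let f' : C^∞⟮𝓡 n, M; ℝ⟯ := ⟨f, hf⟩
    -- The Leibniz identity for `f c`, minus `f` times that for `c`, leaves the defect of the anchor
    -- applied to `f`, times `c`, which is nonzero at `x`.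
    have h1 := congrArg (fun s : Sections n F E => s x) (A.bracket_jacobi a b (f' • c))
    have h2 := congrArg (fun s : Sections n F E => s x) (A.bracket_jacobi a b c)
    simp only [A.bracket_smul, map_add] at h1
    have e1 : ∀ (s t : Sections n F E), (s + t) x = s x + t x := fun _ _ => rfl
    have e2 : ∀ (s t : Sections n F E), (s - t) x = s x - t x := fun _ _ => rfl
    simp only [e1, e2, smul_sections_apply] at h1 h2
    rw [h2] at h1
    have h3 : (A.lieDeriv (A.bracket a b) f x - (A.lieDeriv a (A.lieDeriv b f) x -
        A.lieDeriv b (A.lieDeriv a f) x)) • c x = 0 := by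
      have h1' : A.lieDeriv (A.bracket a b) f x • c x +
          f x • (A.bracket a (A.bracket b c) x - A.bracket b (A.bracket a c) x) =
        A.lieDeriv a (A.lieDeriv b f) x • c x + A.lieDeriv b f x • A.bracket a c x +
          (A.lieDeriv a f x • A.bracket b c x + f x • A.bracket a (A.bracket b c) x) -
        (A.lieDeriv b (A.lieDeriv a f) x • c x + A.lieDeriv a f x • A.bracket b c x +
          (A.lieDeriv b f x • A.bracket a c x + f x • A.bracket b (A.bracket a c) x)) := h1
      rw [sub_smul, sub_smul, eq_sub_of_add_eq h1']
      module
    rcases smul_eq_zero.1 h3 with h | h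
    · exact sub_eq_zero.1 h
    · exact absurd h hv
  -- In rank zero all sections vanish at `x`, and so do all the derivatives.
  · push Not at hx
    simp [lieDeriv, hx (a x), hx (b x), hx (A.bracket a b x)]

theorem lieDeriv_eq_fderiv (a : Sections n F E) {h : M → ℝ} {x : M}
    (hh : MDifferentiableAt (𝓡 n) 𝓘(ℝ, ℝ) h x) :
    A.lieDeriv a h x = fderiv ℝ (fun v => h ((extChartAt (𝓡 n) x).symm v)) (extChartAt (𝓡 n) x x)
      (A.anchor x (a x) : EuclideanSpace ℝ (Fin n)) := by
  change mfderiv (𝓡 n) 𝓘(ℝ, ℝ) h x (A.anchor x (a x)) = _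
  rw [hh.mfderiv]
  simp only [writtenInExtChartAt, extChartAt_model_space_eq_id, PartialEquiv.refl_coe,
    Function.id_comp, ModelWithCorners.range_eq_univ, fderivWithin_univ]
  rfl

theorem contDiffAt_chart {f : P × M → ℝ} (hf : ContMDiff (𝓘(ℝ, P).prod (𝓡 n)) 𝓘(ℝ, ℝ) ∞ f) (x : M)
    (q : P) {v : EuclideanSpace ℝ (Fin n)} (hv : v ∈ (extChartAt (𝓡 n) x).target) :
    ContDiffAt ℝ ∞ (fun q : P × EuclideanSpace ℝ (Fin n) =>
      f (q.1, (extChartAt (𝓡 n) x).symm q.2)) (q, v) := by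
  have h1 : ContMDiffAt (𝓘(ℝ, P).prod 𝓘(ℝ, EuclideanSpace ℝ (Fin n))) (𝓘(ℝ, P).prod (𝓡 n)) ∞
      (fun q : P × EuclideanSpace ℝ (Fin n) => (q.1, (extChartAt (𝓡 n) x).symm q.2)) (q, v) := by
    refine ContMDiffAt.prodMk contMDiffAt_fst ?_
    refine ContMDiffAt.comp (q, v) (g := (extChartAt (𝓡 n) x).symm) (f := Prod.snd) ?_ contMDiffAt_snd
    exact (contMDiffOn_extChartAt_symm x).contMDiffAt
      ((isOpen_extChartAt_target x).mem_nhds hv)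
  have h2 := hf.contMDiffAt.comp (q, v) h1
  rw [← contMDiffAt_iff_contDiffAt, modelWithCornersSelf_prod, ← chartedSpaceSelf_prod]
  exact h2

/-- Derivatives in the direction of `P` commute with derivatives in the direction of `M`. -/
theorem fderiv_lieDeriv_comm {f : P × M → ℝ}
    (hf : ContMDiff (𝓘(ℝ, P).prod (𝓡 n)) 𝓘(ℝ, ℝ) ∞ f) (a : Sections n F E) (τ : P) (y : P × M) :
    fderiv ℝ (fun p => A.lieDeriv a (fun x => f (p, x)) y.2) y.1 τ =
      A.lieDeriv a (fun x => fderiv ℝ (fun p => f (p, x)) y.1 τ) y.2 := by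
  obtain ⟨p, x⟩ := y
  let φ := extChartAt (𝓡 n) x
  let z := φ x
  let w : EuclideanSpace ℝ (Fin n) := A.anchor x (a x)
  let g : P × EuclideanSpace ℝ (Fin n) → ℝ := fun q => f (q.1, φ.symm q.2)
  have hφ : ∀ h : M → ℝ, MDifferentiableAt (𝓡 n) 𝓘(ℝ, ℝ) h x →
      A.lieDeriv a h x = fderiv ℝ (fun v => h (φ.symm v)) z w := by
    exact fun h hh => A.lieDeriv_eq_fderiv a hh
  have htarget : φ.target ∈ 𝓝 z := extChartAt_target_mem_nhds x
  have hg : ∀ q : P, ∀ v ∈ φ.target, ContDiffAt ℝ ∞ g (q, v) :=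
    fun q v hv => contDiffAt_chart hf x q hv
  have hgz : ∀ q, ContDiffAt ℝ ∞ g (q, z) := fun q => hg q z (mem_of_mem_nhds htarget)
  have hL : ∀ q, A.lieDeriv a (fun x => f (q, x)) x = fderiv ℝ g (q, z) (0, w) := by
    intro q
    rw [hφ _ (mdifferentiable_of_contMDiff (contMDiff_space hf q) x)]
    have h1 : HasFDerivAt g (fderiv ℝ g (q, z)) (q, z) :=
      ((hgz q).differentiableAt (by simp)).hasFDerivAt
    have h2 := HasFDerivAt.comp (g := g) (f := fun v => (q, v)) z h1 (hasFDerivAt_prodMk_right q z)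
    have h3 : HasFDerivAt (fun v => f (q, φ.symm v)) _ z := h2
    rw [h3.fderiv]
    simp
  have hT : ∀ v ∈ φ.target, fderiv ℝ (fun p => f (p, φ.symm v)) p τ = fderiv ℝ g (p, v) (τ, 0) := by
    intro v hv
    have h1 : HasFDerivAt g (fderiv ℝ g (p, v)) (p, v) :=
      ((hg p v hv).differentiableAt (by simp)).hasFDerivAt
    have h2 := HasFDerivAt.comp (g := g) (f := fun q => (q, v)) p h1 (hasFDerivAt_prodMk_left p v)
    have h3 : HasFDerivAt (fun p => f (p, φ.symm v)) _ p := h2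
    rw [h3.fderiv]
    simp
  have hsm := A.contMDiff_partialAct ((0 : Sections n F E), τ) hf
  have hsm' : ContMDiff (𝓡 n) 𝓘(ℝ, ℝ) ∞ (fun x => fderiv ℝ (fun p => f (p, x)) p τ) := by
    have := contMDiff_space hsm p
    simpa [partialAct, lieDeriv_zero_left] using this
  have hdd : DifferentiableAt ℝ (fderiv ℝ g) (p, z) :=
    ((hgz p).fderiv_right (m := 1) two_le_infty).differentiableAt (by simp)
  -- In a chart around `x` both sides are second derivatives of `g`, along the fixed vectors `(τ,
  -- 0)` and `(0, w)`.
  have hsymm : fderiv ℝ (fderiv ℝ g) (p, z) (τ, 0) (0, w) =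
      fderiv ℝ (fderiv ℝ g) (p, z) (0, w) (τ, 0) :=
    ((hgz p).isSymmSndFDerivAt (by simpa using two_le_infty)) _ _
  change fderiv ℝ (fun q => A.lieDeriv a (fun x => f (q, x)) x) p τ =
    A.lieDeriv a (fun x => fderiv ℝ (fun p => f (p, x)) p τ) x
  rw [hφ _ (mdifferentiable_of_contMDiff hsm' x)]
  have e1 : (fun v => fderiv ℝ (fun p => f (p, φ.symm v)) p τ) =ᶠ[𝓝 z]
      fun v => fderiv ℝ g (p, v) (τ, 0) := by
    filter_upwards [htarget] with v hv using hT v hv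
  rw [e1.fderiv_eq]
  simp only [hL]
  have k1 := (HasFDerivAt.comp (g := fderiv ℝ g) (f := fun q => (q, z)) p hdd.hasFDerivAt
    (hasFDerivAt_prodMk_left p z)).clm_apply
    (hasFDerivAt_const ((0, w) : P × EuclideanSpace ℝ (Fin n)) p)
  have k2 := (HasFDerivAt.comp (g := fderiv ℝ g) (f := fun v => (p, v)) z hdd.hasFDerivAt
    (hasFDerivAt_prodMk_right p z)).clm_apply
    (hasFDerivAt_const ((τ, 0) : P × EuclideanSpace ℝ (Fin n)) z)
  have k1' : HasFDerivAt (fun q => fderiv ℝ g (q, z) (0, w)) _ p := k1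
  have k2' : HasFDerivAt (fun v => fderiv ℝ g (p, v) (τ, 0)) _ z := k2
  rw [k1'.fderiv, k2'.fderiv]
  simpa using hsymm

theorem fderiv_fderiv_comm {f : P → ℝ} (hf : ContDiff ℝ ∞ f) (σ τ p : P) :
    fderiv ℝ (fun q => fderiv ℝ f q τ) p σ = fderiv ℝ (fun q => fderiv ℝ f q σ) p τ := by
  have hdd : DifferentiableAt ℝ (fderiv ℝ f) p :=
    (hf.contDiffAt.fderiv_right (m := 1) two_le_infty).differentiableAt (by simp)
  have h := fun τ : P => (hdd.hasFDerivAt.clm_apply (hasFDerivAt_const τ p)).fderiv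
  have hsymm : fderiv ℝ (fderiv ℝ f) p σ τ = fderiv ℝ (fderiv ℝ f) p τ σ :=
    (hf.contDiffAt.isSymmSndFDerivAt (by simpa using two_le_infty)) _ _
  rw [h τ, h σ]
  simpa using hsymm

/-- Parameter derivatives commute with each other and with the anchor, so the commutator reduces to
that of `ρ(u.1)` and `ρ(v.1)`. -/
theorem partialAct_bracket (u v : Sections n F E × P) {f : P × M → ℝ}
    (hf : ContMDiff (𝓘(ℝ, P).prod (𝓡 n)) 𝓘(ℝ, ℝ) ∞ f) (y : P × M) :
    A.partialAct (A.bracket u.1 v.1, (0 : P)) f y =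
      A.partialAct u (A.partialAct v f) y - A.partialAct v (A.partialAct u f) y := by
  have hT : ∀ u : Sections n F E × P, ContMDiff (𝓘(ℝ, P).prod (𝓡 n)) 𝓘(ℝ, ℝ) ∞
      (fun y : P × M => fderiv ℝ (fun p => f (p, y.2)) y.1 u.2) := by
    intro u
    convert A.contMDiff_partialAct ((0 : Sections n F E), u.2) hf using 1
    funext y
    simp [partialAct, lieDeriv_zero_left]
  have hL : ∀ u : Sections n F E × P, ContMDiff (𝓘(ℝ, P).prod (𝓡 n)) 𝓘(ℝ, ℝ) ∞
      (fun y : P × M => A.lieDeriv u.1 (fun x => f (y.1, x)) y.2) := by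
    intro u
    convert A.contMDiff_partialAct (u.1, (0 : P)) hf using 1
    funext y
    simp [partialAct]
  have key : ∀ u v : Sections n F E × P, A.partialAct u (A.partialAct v f) y =
      fderiv ℝ (fun q => fderiv ℝ (fun p => f (p, y.2)) q v.2) y.1 u.2 +
      fderiv ℝ (fun p => A.lieDeriv v.1 (fun x => f (p, x)) y.2) y.1 u.2 +
      (A.lieDeriv u.1 (fun x => fderiv ℝ (fun p => f (p, x)) y.1 v.2) y.2 +
      A.lieDeriv u.1 (fun x => A.lieDeriv v.1 (fun x => f (y.1, x)) x) y.2) := by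
    intro u v
    have h1 := A.lieDeriv_add u.1 (contMDiff_space (hT v) y.1) (contMDiff_space (hL v) y.1) y.2
    have h2 := fderiv_fun_add (differentiable_time (hT v) y.2 y.1)
      (differentiable_time (hL v) y.2 y.1)
    simp only [partialAct] at h1 h2 ⊢
    rw [h1, h2]
    rfl
  rw [key, key, A.fderiv_lieDeriv_comm hf, A.fderiv_lieDeriv_comm hf,
    fderiv_fderiv_comm (contDiff_time hf y.2)]
  have := A.lieDeriv_bracket u.1 v.1 (contMDiff_space hf y.1) y.2
  simp only [partialAct, this, map_zero]
  ring

/-- The action of the Leibniz algebra `Γ(E) × P` on the smooth functions on `P × M`. -/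
def timeAction : LeibnizAction (Sections n F E × P) (TimeFun n M P) where
  br u v := (A.bracket u.1 v.1, 0)
  jacobi a b c := by
    ext1
    · exact A.bracket_jacobi a.1 b.1 c.1
    · simp
  act u f := ⟨A.partialAct u f, A.contMDiff_partialAct u f.contMDiff⟩
  act_add u f g := by ext y; exact A.partialAct_add u f.contMDiff g.contMDiff y
  act_mul u f g := by ext y; exact A.partialAct_mul u f.contMDiff g.contMDiff y
  act_br u v f := by ext y; exact A.partialAct_bracket u v f.contMDiff y

end CourantAlgebroid

end Courant

end

/-! ### Frames, sections, bilinear forms and traces over `P × M` -/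

noncomputable section

namespace Courant

variable {n : ℕ} {M : Type*} [TopologicalSpace M] [ChartedSpace (EuclideanSpace ℝ (Fin n)) M]
  [IsManifold (𝓡 n) ∞ M]
  {F : Type*} [NormedAddCommGroup F] [NormedSpace ℝ F]
  {E : M → Type*} [TopologicalSpace (TotalSpace F E)] [∀ x, AddCommGroup (E x)]
  [∀ x, Module ℝ (E x)] [∀ x, TopologicalSpace (E x)] [∀ x, IsTopologicalAddGroup (E x)]
  [∀ x, ContinuousSMul ℝ (E x)] [FiberBundle F E] [VectorBundle ℝ F E]
  [ContMDiffVectorBundle ∞ F E (𝓡 n)]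
  [FiniteDimensional ℝ F] [T2Space M]
  {P : Type*} [NormedAddCommGroup P] [NormedSpace ℝ P]


variable (A : CourantAlgebroid n F E)

/-! ### Dual frames -/

namespace CourantAlgebroid

/-- Sections `sᵢ`, `s'ᵢ` with `χ v = ∑ᵢ ⟨s'ᵢ, v⟩ sᵢ` and `⟨s'ᵢ, sⱼ⟩ = χ δᵢⱼ`. -/
structure DualFrame (x₀ : M) where
  {ι : Type}
  [fintype : Fintype ι]
  [decidableEq : DecidableEq ι]
  s : ι → Sections n F E
  s' : ι → Sections n F E
  χ : C^∞⟮𝓡 n, M; ℝ⟯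
  χ_self : χ x₀ = 1
  expand (x : M) (v : E x) : χ x • v = ∑ i, A.pairing x (s' i x) v • s i x
  dual (i j : ι) (x : M) : A.pairing x (s' i x) (s j x) = if i = j then χ x else 0

attribute [instance] DualFrame.fintype DualFrame.decidableEq

/-- A local frame and its coefficient functionals are both multiplied by a bump function `f`, and
the functionals are represented through the pairing; hence `χ = f * f`. Such frames reduce local
questions at `x₀` to finitely many global sections. -/
theorem nonempty_dualFrame (x₀ : M) : Nonempty (A.DualFrame x₀) := by
  classical
  let e := trivializationAt F E x₀
  have hx₀ : x₀ ∈ e.baseSet := FiberBundle.mem_baseSet_trivializationAt F E x₀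
  let b := Module.finBasis ℝ F
  have : ContMDiffVectorBundle 1 F E (𝓡 n) := ContMDiffVectorBundle.of_le (n := ∞) (by simp)
  obtain ⟨f, -, hf⟩ := (SmoothBumpFunction.nhds_basis_tsupport (I := 𝓡 n) x₀).mem_iff.1
    (e.open_baseSet.mem_nhds hx₀)
  let φ : C^∞⟮𝓡 n, M; ℝ⟯ := ⟨f, f.contMDiff⟩
  have hzero : ∀ x, x ∉ e.baseSet → f x = 0 := fun x hx => by
    by_contra h
    exact hx (hf (subset_tsupport _ h))
  let s : Fin (Module.finrank ℝ F) → Sections n F E := fun i =>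
    ⟨(f : M → ℝ) • e.localFrame b i, ContMDiffOn.smul_section_of_tsupport f.contMDiff.contMDiffOn
      e.open_baseSet hf (e.contMDiffOn_localFrame_baseSet ∞ b i)⟩
  have hs : ∀ i x, s i x = f x • e.localFrame b i x := fun _ _ => rfl
  have hT : ∀ i, ∃ u : Sections n F E, ∀ (t : Sections n F E) x,
      A.pairing x (u x) (t x) = f x * e.localFrameCoeff (𝓡 n) b i x (t x) := by
    intro i
    refine exists_section_of_functional A.pairing (contMDiff_form A.contMDiff_pairing)
      A.pairing_nondegenerate (fun t x => f x * e.localFrameCoeff (𝓡 n) b i x (t x)) ?_ ?_ ?_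
    · intro t
      refine contMDiff_of_tsupport fun x hx => ?_
      have hx' : x ∈ e.baseSet := hf (tsupport_smul_subset_left _ _ hx)
      exact f.contMDiffAt.mul (contMDiffAt_localFrameCoeff b hx' t.contMDiff.contMDiffAt i)
    · intro t u x
      simp [mul_add]
    · intro h t x
      simp only [smul_sections_apply, map_smul, smul_eq_mul]
      ring
  choose s' hs' using hT
  refine ⟨{ s := s, s' := s', χ := φ * φ, χ_self := ?_, expand := ?_, dual := ?_ }⟩
  · change f x₀ * f x₀ = 1
    rw [f.eq_one, one_mul]
  · intro x v
    obtain ⟨t, rfl⟩ := exists_section_eq (n := n) (F := F) x v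
    change (f x * f x) • t x = _
    by_cases hx : x ∈ e.baseSet
    · conv_lhs => rw [e.eq_sum_localFrameCoeff_smul (I := 𝓡 n) (b := b) (s := t) hx,
        Finset.smul_sum]
      refine Finset.sum_congr rfl fun i _ => ?_
      rw [hs', hs, smul_smul, smul_smul]
      ring_nf
    · simp [hs, hzero x hx]
  · intro i j x
    rw [hs', hs]
    change _ = if i = j then f x * f x else 0
    by_cases hx : x ∈ e.baseSet
    · rw [map_smul, smul_eq_mul, e.localFrameCoeff_apply_of_mem_baseSet (I := 𝓡 n) b hx,
        e.localFrame_apply_of_mem_baseSet b hx, Module.Basis.repr_self, Finsupp.single_apply]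
      simp only [eq_comm (a := j)]
      split_ifs <;> simp
    · simp [hzero x hx]

end CourantAlgebroid

end Courant

end

noncomputable section

namespace Courant

variable {n : ℕ} {M : Type*} [TopologicalSpace M] [ChartedSpace (EuclideanSpace ℝ (Fin n)) M]
  [IsManifold (𝓡 n) ∞ M]
  {F : Type*} [NormedAddCommGroup F] [NormedSpace ℝ F]
  {E : M → Type*} [TopologicalSpace (TotalSpace F E)] [∀ x, AddCommGroup (E x)]
  [∀ x, Module ℝ (E x)] [∀ x, TopologicalSpace (E x)] [∀ x, IsTopologicalAddGroup (E x)]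
  [∀ x, ContinuousSMul ℝ (E x)] [FiberBundle F E] [VectorBundle ℝ F E]
  [ContMDiffVectorBundle ∞ F E (𝓡 n)]
  [FiniteDimensional ℝ F] [T2Space M]
  {P : Type*} [NormedAddCommGroup P] [NormedSpace ℝ P]


variable (A : CourantAlgebroid n F E)

/-! ### Time-dependent sections -/

/-- Smoothness is local, and near `y₀` one may divide by `ψ`. This removes the factors `χ` produced
by dual frames. -/
theorem contMDiff_of_mul {h : P × M → ℝ}
    (H : ∀ y₀, ∃ ψ : P × M → ℝ, ContMDiff (𝓘(ℝ, P).prod (𝓡 n)) 𝓘(ℝ, ℝ) ∞ ψ ∧ ψ y₀ ≠ 0 ∧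
      ContMDiff (𝓘(ℝ, P).prod (𝓡 n)) 𝓘(ℝ, ℝ) ∞ (fun y => ψ y * h y)) :
    ContMDiff (𝓘(ℝ, P).prod (𝓡 n)) 𝓘(ℝ, ℝ) ∞ h := by
  intro y₀
  obtain ⟨ψ, hψ, h0, hh⟩ := H y₀
  have h1 := (hh y₀).div₀ (hψ y₀) h0
  refine h1.congr_of_eventuallyEq ?_
  filter_upwards [hψ.continuous.continuousAt.eventually_ne h0] with y hy
  exact (mul_div_cancel_left₀ (h y) hy).symm

variable (P) in
/-- A smooth function on `M`, regarded as a function on `P × M`. -/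
def TimeFun.const (f : C^∞⟮𝓡 n, M; ℝ⟯) : TimeFun n M P :=
  ⟨fun y => f y.2, f.contMDiff.comp contMDiff_snd⟩

@[simp] theorem TimeFun.const_apply (f : C^∞⟮𝓡 n, M; ℝ⟯) (y : P × M) :
    TimeFun.const P f y = f y.2 := rfl

theorem TimeFun.sum_apply {ι : Type*} (s : Finset ι) (f : ι → TimeFun n M P) (y : P × M) :
    (∑ i ∈ s, f i) y = ∑ i ∈ s, f i y := by
  have := congrFun (map_sum (ContMDiffMap.coeFnAddMonoidHom
    (I := 𝓘(ℝ, P).prod (𝓡 n)) (I' := 𝓘(ℝ, ℝ)) (N := P × M) (G := ℝ) (n := ∞)) f s) y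
  rw [Finset.sum_apply] at this
  exact this

namespace CourantAlgebroid

variable (P) in
/-- The families of sections of `E` parametrised by `P` that depend smoothly on the parameter. -/
def timeSections : AddSubgroup (Π y : P × M, E y.2) where
  carrier := {v | ∀ s : Sections n F E, ContMDiff (𝓘(ℝ, P).prod (𝓡 n)) 𝓘(ℝ, ℝ) ∞
    fun y => A.pairing y.2 (v y) (s y.2)}
  add_mem' {v w} hv hw s := by simpa using! (hv s).add (hw s)
  zero_mem' s := by simpa using contMDiff_const
  neg_mem' {v} hv s := by simpa using! (hv s).neg

/-- The families of sections of `E` parametrised by `P` that depend smoothly on the parameter. -/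
abbrev TimeSec (P : Type*) [NormedAddCommGroup P] [NormedSpace ℝ P] : Type _ := A.timeSections P

variable {A}

theorem contMDiff_pairing_section (v : A.TimeSec P) (s : Sections n F E) :
    ContMDiff (𝓘(ℝ, P).prod (𝓡 n)) 𝓘(ℝ, ℝ) ∞ fun y => A.pairing y.2 (v.1 y) (s y.2) := v.2 s

instance : SMul (TimeFun n M P) (A.TimeSec P) :=
  ⟨fun f v => ⟨fun y => f y • v.1 y, fun s => by
    simpa using! f.contMDiff.mul (contMDiff_pairing_section v s)⟩⟩

theorem smul_val (f : TimeFun n M P) (v : A.TimeSec P) (y : P × M) :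
    (f • v).1 y = f y • v.1 y := rfl

theorem add_val (v w : A.TimeSec P) (y : P × M) : (v + w).1 y = v.1 y + w.1 y := rfl

theorem sub_val (v w : A.TimeSec P) (y : P × M) : (v - w).1 y = v.1 y - w.1 y := rfl

theorem zero_val (y : P × M) : (0 : A.TimeSec P).1 y = 0 := rfl

theorem sum_val {ι : Type*} (s : Finset ι) (v : ι → A.TimeSec P) (y : P × M) :
    (∑ i ∈ s, v i).1 y = ∑ i ∈ s, (v i).1 y := by
  have := congrFun (map_sum (A.timeSections P).subtype v s) y
  rw [Finset.sum_apply] at this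
  exact this

theorem timeSec_ext {v w : A.TimeSec P} (h : ∀ y, v.1 y = w.1 y) : v = w :=
  Subtype.ext (funext h)

instance : Module (TimeFun n M P) (A.TimeSec P) where
  one_smul v := timeSec_ext fun y => one_smul ℝ (v.1 y)
  mul_smul f g v := timeSec_ext fun y => mul_smul (f y) (g y) (v.1 y)
  smul_zero f := timeSec_ext fun y => smul_zero (f y)
  smul_add f v w := timeSec_ext fun y => smul_add (f y) (v.1 y) (w.1 y)
  add_smul f g v := timeSec_ext fun y => add_smul (f y) (g y) (v.1 y)
  zero_smul v := timeSec_ext fun y => zero_smul ℝ (v.1 y)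

variable (A P) in
/-- A section of `E`, regarded as a constant family. -/
def constSec (s : Sections n F E) : A.TimeSec P :=
  ⟨fun y => s y.2, fun t => (A.pairFun s t).contMDiff.comp contMDiff_snd⟩

@[simp] theorem constSec_val (s : Sections n F E) (y : P × M) : (A.constSec P s).1 y = s y.2 := rfl

theorem constSec_add (s t : Sections n F E) :
    A.constSec P (s + t) = A.constSec P s + A.constSec P t := rfl

theorem constSec_smul (f : C^∞⟮𝓡 n, M; ℝ⟯) (s : Sections n F E) :
    A.constSec P (f • s) = TimeFun.const P f • A.constSec P s := rfl

variable (n F E P) in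
/-- A smooth family of nondegenerate symmetric bilinear forms on the fibres of `E`. -/
structure TimeForm where
  toFun (y : P × M) : E y.2 →L[ℝ] E y.2 →L[ℝ] ℝ
  contMDiff (s t : Sections n F E) : ContMDiff (𝓘(ℝ, P).prod (𝓡 n)) 𝓘(ℝ, ℝ) ∞
    fun y => toFun y (s y.2) (t y.2)
  symm (y : P × M) (v w : E y.2) : toFun y v w = toFun y w v
  nondegenerate (y : P × M) (v : E y.2) : (∀ w, toFun y v w = 0) → v = 0

variable (A P) in
/-- The pairing of the Courant algebroid, as a constant family. -/
def timePairing : TimeForm n F E P where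
  toFun y := A.pairing y.2
  contMDiff s t := (A.pairFun s t).contMDiff.comp contMDiff_snd
  symm y := A.pairing_symm y.2
  nondegenerate y := A.pairing_nondegenerate y.2

/-- The coefficient functions of a section in a dual frame. -/
def DualFrame.coeff {x₀ : M} (b : A.DualFrame x₀) (i : b.ι) (v : A.TimeSec P) : TimeFun n M P :=
  ⟨fun y => A.pairing y.2 (b.s' i y.2) (v.1 y), by
    simpa only [A.pairing_symm _ (b.s' i _)] using contMDiff_pairing_section v (b.s' i)⟩

theorem DualFrame.coeff_apply {x₀ : M} (b : A.DualFrame x₀) (i : b.ι) (v : A.TimeSec P)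
    (y : P × M) : b.coeff i v y = A.pairing y.2 (b.s' i y.2) (v.1 y) := rfl

theorem DualFrame.expand_time {x₀ : M} (b : A.DualFrame x₀) (v : A.TimeSec P) :
    TimeFun.const P b.χ • v = ∑ i, b.coeff i v • A.constSec P (b.s i) := by
  refine timeSec_ext fun y => ?_
  rw [sum_val]
  exact b.expand y.2 (v.1 y)

namespace TimeForm

variable (B : TimeForm n F E P)

theorem contMDiff_apply (v w : A.TimeSec P) : ContMDiff (𝓘(ℝ, P).prod (𝓡 n)) 𝓘(ℝ, ℝ) ∞
    fun y => B.toFun y (v.1 y) (w.1 y) := by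
  refine contMDiff_of_mul fun y₀ => ?_
  obtain ⟨b⟩ := A.nonempty_dualFrame y₀.2
  -- One factor `χ` for the expansion of each argument.
  refine ⟨fun y => b.χ y.2 * b.χ y.2, (TimeFun.const P (b.χ * b.χ)).contMDiff, ?_, ?_⟩
  · simp [b.χ_self]
  · have h : ContMDiff (𝓘(ℝ, P).prod (𝓡 n)) 𝓘(ℝ, ℝ) ∞ (fun y => ∑ i, ∑ j,
        b.coeff i v y * (b.coeff j w y * B.toFun y (b.s i y.2) (b.s j y.2))) :=
      contMDiff_finsetSum fun i _ => contMDiff_finsetSum fun j _ =>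
        (b.coeff i v).contMDiff.mul ((b.coeff j w).contMDiff.mul (B.contMDiff _ _))
    convert h using 2 with y
    have h1 : b.χ y.2 * b.χ y.2 * B.toFun y (v.1 y) (w.1 y) =
        B.toFun y (b.χ y.2 • v.1 y) (b.χ y.2 • w.1 y) := by
      simp only [map_smul, _root_.smul_apply, smul_eq_mul, mul_assoc]
    rw [h1, b.expand, b.expand]
    simp only [map_sum, _root_.sum_apply, map_smul, _root_.smul_apply, smul_eq_mul,
      DualFrame.coeff_apply, Finset.mul_sum]
    rw [Finset.sum_comm]
    exact Finset.sum_congr rfl fun i _ => Finset.sum_congr rfl fun j _ => by ring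

variable (A) in
/-- A family of forms as a bilinear form over the smooth functions. -/
def bilin : A.TimeSec P →ₗ[TimeFun n M P] A.TimeSec P →ₗ[TimeFun n M P] TimeFun n M P :=
  LinearMap.mk₂ _ (fun v w => ⟨fun y => B.toFun y (v.1 y) (w.1 y), B.contMDiff_apply v w⟩)
    (fun v v' w => by
      ext y
      change B.toFun y ((v + v').1 y) (w.1 y) = B.toFun y (v.1 y) (w.1 y) + B.toFun y (v'.1 y) (w.1 y)
      simp [add_val])
    (fun f v w => by
      ext y
      change B.toFun y ((f • v).1 y) (w.1 y) = f y * B.toFun y (v.1 y) (w.1 y)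
      simp [smul_val])
    (fun v w w' => by
      ext y
      change B.toFun y (v.1 y) ((w + w').1 y) = B.toFun y (v.1 y) (w.1 y) + B.toFun y (v.1 y) (w'.1 y)
      simp [add_val])
    (fun f v w => by
      ext y
      change B.toFun y (v.1 y) ((f • w).1 y) = f y * B.toFun y (v.1 y) (w.1 y)
      simp [smul_val])

theorem bilin_apply (v w : A.TimeSec P) (y : P × M) :
    B.bilin A v w y = B.toFun y (v.1 y) (w.1 y) := rfl

theorem eq_of_forall {y : P × M} {v w : E y.2}
    (h : ∀ s : Sections n F E, B.toFun y v (s y.2) = B.toFun y w (s y.2)) : v = w := by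
  rw [← sub_eq_zero]
  refine B.nondegenerate y _ fun u => ?_
  obtain ⟨s, hs⟩ := exists_section_eq (n := n) (F := F) y.2 u
  rw [map_sub, _root_.sub_apply, ← hs, h, sub_self]

/-- Pointwise nondegeneracy gives the value of `u`. Its smoothness follows from Cramer's rule for
the Gram matrix of `B` in a dual frame. -/
theorem exists_timeSec (T : Sections n F E → P × M → ℝ)
    (hT : ∀ s, ContMDiff (𝓘(ℝ, P).prod (𝓡 n)) 𝓘(ℝ, ℝ) ∞ (T s))
    (hadd : ∀ s t y, T (s + t) y = T s y + T t y)
    (hsmul : ∀ (f : C^∞⟮𝓡 n, M; ℝ⟯) s y, T (f • s) y = f y.2 * T s y) :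
    ∃ u : A.TimeSec P, ∀ s y, B.toFun y (u.1 y) (s y.2) = T s y := by
  classical
  have key : ∀ y : P × M, ∃ v : E y.2, ∀ s : Sections n F E, B.toFun y v (s y.2) = T s y := by
    intro y
    obtain ⟨φ, hφ⟩ := exists_fiber_map (n := n) (F := F) (E := E) y.2 (fun s => T s y)
      (fun s t => hadd s t y) (fun f s => hsmul f s y)
    have : FiniteDimensional ℝ (E y.2) := VectorBundle.finiteDimensional ℝ F E y.2
    obtain ⟨v, hv⟩ := exists_represents (B.toFun y) (B.nondegenerate y) φ
    exact ⟨v, fun s => (hv (s y.2)).trans (hφ s)⟩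
  choose u hu using key
  refine ⟨⟨u, fun t => ?_⟩, fun s y => hu y s⟩
  refine contMDiff_of_mul fun y₀ => ?_
  obtain ⟨b⟩ := A.nonempty_dualFrame y₀.2
  let G : P × M → Matrix b.ι b.ι ℝ := fun y => Matrix.of fun i j => B.toFun y (b.s j y.2) (b.s i y.2)
  let c : P × M → b.ι → ℝ := fun y i => A.pairing y.2 (b.s' i y.2) (u y)
  have hG : ∀ i j, ContMDiff (𝓘(ℝ, P).prod (𝓡 n)) 𝓘(ℝ, ℝ) ∞ (fun y => G y i j) :=
    fun i j => B.contMDiff _ _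
  have hdet : ∀ H : P × M → Matrix b.ι b.ι ℝ,
      (∀ i j, ContMDiff (𝓘(ℝ, P).prod (𝓡 n)) 𝓘(ℝ, ℝ) ∞ (fun y => H y i j)) →
      ContMDiff (𝓘(ℝ, P).prod (𝓡 n)) 𝓘(ℝ, ℝ) ∞ (fun y => (H y).det) := by
    intro H hH
    simp only [Matrix.det_apply']
    exact contMDiff_finsetSum fun ς _ => contMDiff_const.mul (contMDiff_finsetProd fun i _ => hH _ _)
  have hmul : ∀ y, (G y).mulVec (c y) = fun i => b.χ y.2 * T (b.s i) y := by
    intro y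
    funext i
    rw [← hu, ← smul_eq_mul, ← _root_.smul_apply, ← map_smul, b.expand, map_sum,
      _root_.sum_apply]
    simp only [map_smul, _root_.smul_apply, Matrix.mulVec, dotProduct, G, c, Matrix.of_apply,
      smul_eq_mul]
    exact Finset.sum_congr rfl fun j _ => mul_comm _ _
  -- Cramer's rule without division holds at every `y`, including points where the sections of the
  -- frame degenerate.
  have hc : ∀ y i, (G y).det * c y i =
      ((G y).updateCol i fun j => b.χ y.2 * T (b.s j) y).det := by
    intro y i
    rw [← Matrix.cramer_apply, ← hmul, Matrix.cramer_eq_adjugate_mulVec, Matrix.mulVec_mulVec,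
      Matrix.adjugate_mul, Matrix.smul_mulVec, Matrix.one_mulVec, Pi.smul_apply, smul_eq_mul]
  refine ⟨fun y => (G y).det * b.χ y.2, (hdet G hG).mul (TimeFun.const P b.χ).contMDiff, ?_, ?_⟩
  · simp only [b.χ_self, mul_one]
    intro h0
    -- A kernel vector of the Gram matrix at `y₀` would be a linear relation between the `sᵢ`, which
    -- pairing with the `s'ᵢ` excludes since `χ = 1` there.
    obtain ⟨z, hz, hGz⟩ := Matrix.exists_mulVec_eq_zero_iff.2 h0
    have h1 : ∑ j, z j • b.s j y₀.2 = 0 := by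
      refine B.nondegenerate y₀ _ fun w => ?_
      rw [← one_smul ℝ w, ← b.χ_self, b.expand, map_sum]
      refine Finset.sum_eq_zero fun i _ => ?_
      have h2 := congrFun hGz i
      simp only [Matrix.mulVec, dotProduct, G, Pi.zero_apply, Matrix.of_apply] at h2
      rw [map_smul, map_sum, _root_.sum_apply]
      simp only [map_smul, _root_.smul_apply, smul_eq_mul]
      rw [← mul_zero (A.pairing y₀.2 (b.s' i y₀.2) w), ← h2]
      congr 1
      exact Finset.sum_congr rfl fun j _ => mul_comm _ _
    refine hz (funext fun i => ?_)
    have h2 := congrArg (A.pairing y₀.2 (b.s' i y₀.2)) h1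
    simpa [b.dual, b.χ_self] using h2
  · have h : ContMDiff (𝓘(ℝ, P).prod (𝓡 n)) 𝓘(ℝ, ℝ) ∞ (fun y => ∑ i,
        ((G y).updateCol i fun j => b.χ y.2 * T (b.s j) y).det *
          A.pairing y.2 (b.s i y.2) (t y.2)) := by
      refine contMDiff_finsetSum fun i _ => ContMDiff.mul (hdet _ fun k l => ?_)
        ((A.timePairing P).contMDiff (b.s i) t)
      simp only [Matrix.updateCol_apply]
      split_ifs
      · exact (TimeFun.const P b.χ).contMDiff.mul (hT _)
      · exact hG k l
    convert h using 2 with y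
    rw [mul_assoc, ← smul_eq_mul (b.χ y.2), ← _root_.smul_apply, ← map_smul, b.expand, map_sum,
      _root_.sum_apply, Finset.mul_sum]
    refine Finset.sum_congr rfl fun i _ => ?_
    rw [← hc, map_smul, _root_.smul_apply, smul_eq_mul, mul_assoc]

/-- Functionals on time-dependent sections are represented by time-dependent sections. -/
theorem exists_represents_time (T : A.TimeSec P →ₗ[TimeFun n M P] TimeFun n M P) :
    ∃ u : A.TimeSec P, ∀ w, B.bilin A u w = T w := by
  obtain ⟨u, hu⟩ := B.exists_timeSec (A := A) (fun s => T (A.constSec P s))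
    (fun s => (T (A.constSec P s)).contMDiff) (fun s t y => by rw [constSec_add, map_add]; rfl)
    (fun f s y => by rw [constSec_smul, map_smul]; rfl)
  refine ⟨u, fun w => ?_⟩
  ext y
  obtain ⟨b⟩ := A.nonempty_dualFrame y.2
  -- A functional linear over functions is determined at `y` by its values on the constant sections
  -- of a dual frame, because `χ = 1` at `y`.
  have h : ∀ S : A.TimeSec P →ₗ[TimeFun n M P] TimeFun n M P,
      S w y = ∑ i, b.coeff i w y * S (A.constSec P (b.s i)) y := by
    intro S
    have h1 : (S (TimeFun.const P b.χ • w)) y = S w y := by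
      rw [map_smul]
      change b.χ y.2 * S w y = _
      rw [b.χ_self, one_mul]
    rw [← h1, b.expand_time, map_sum, TimeFun.sum_apply]
    refine Finset.sum_congr rfl fun i _ => ?_
    rw [map_smul]
    rfl
  rw [h, h]
  refine Finset.sum_congr rfl fun i _ => ?_
  rw [← hu, bilin_apply, constSec_val]

end TimeForm

end CourantAlgebroid

end Courant

end

noncomputable section

namespace Courant

variable {n : ℕ} {M : Type*} [TopologicalSpace M] [ChartedSpace (EuclideanSpace ℝ (Fin n)) M]
  [IsManifold (𝓡 n) ∞ M]
  {F : Type*} [NormedAddCommGroup F] [NormedSpace ℝ F]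
  {E : M → Type*} [TopologicalSpace (TotalSpace F E)] [∀ x, AddCommGroup (E x)]
  [∀ x, Module ℝ (E x)] [∀ x, TopologicalSpace (E x)] [∀ x, IsTopologicalAddGroup (E x)]
  [∀ x, ContinuousSMul ℝ (E x)] [FiberBundle F E] [VectorBundle ℝ F E]
  [ContMDiffVectorBundle ∞ F E (𝓡 n)]
  [FiniteDimensional ℝ F] [T2Space M]
  {P : Type*} [NormedAddCommGroup P] [NormedSpace ℝ P]


variable {A : CourantAlgebroid n F E}

/-! ### Endomorphisms of time-dependent sections and their traces -/

namespace CourantAlgebroid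

theorem DualFrame.apply_eq_sum {N : Type*} [AddCommGroup N] [Module (TimeFun n M P) N] {x₀ : M}
    (b : A.DualFrame x₀) (T : A.TimeSec P →ₗ[TimeFun n M P] N) (v : A.TimeSec P) :
    TimeFun.const P b.χ • T v = ∑ i, b.coeff i v • T (A.constSec P (b.s i)) := by
  rw [← map_smul, b.expand_time, map_sum]
  simp only [map_smul]

/-- Constant sections already span the fibre, so they determine `φ`. The dual frame at `y` extends
the formula to sections that depend on the parameter. -/
theorem exists_fib (T : Module.End (TimeFun n M P) (A.TimeSec P)) (y : P × M) :
    ∃ φ : Module.End ℝ (E y.2), ∀ v : A.TimeSec P, φ (v.1 y) = (T v).1 y := by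
  obtain ⟨φ, hφ⟩ := exists_fiber_map (n := n) (F := F) (E := E) y.2
    (fun s => (T (A.constSec P s)).1 y)
    (fun s t => by rw [constSec_add, map_add]; rfl)
    (fun f s => by rw [constSec_smul, map_smul]; rfl)
  refine ⟨φ, fun v => ?_⟩
  obtain ⟨b⟩ := A.nonempty_dualFrame y.2
  have h := congrArg (fun w : A.TimeSec P => w.1 y) (b.apply_eq_sum T v)
  simp only [sum_val, smul_val, TimeFun.const_apply, b.χ_self, one_smul] at h
  rw [h, ← one_smul ℝ (v.1 y), ← b.χ_self, b.expand, map_sum]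
  refine Finset.sum_congr rfl fun i _ => ?_
  rw [map_smul, hφ]
  rfl

/-- The endomorphism of the fibre induced by an endomorphism of the time-dependent sections. -/
def fib (T : Module.End (TimeFun n M P) (A.TimeSec P)) (y : P × M) : Module.End ℝ (E y.2) :=
  (exists_fib T y).choose

theorem fib_apply (T : Module.End (TimeFun n M P) (A.TimeSec P)) (y : P × M) (v : A.TimeSec P) :
    fib T y (v.1 y) = (T v).1 y := (exists_fib T y).choose_spec v

theorem fib_apply_section (T : Module.End (TimeFun n M P) (A.TimeSec P)) (y : P × M)
    (s : Sections n F E) : fib T y (s y.2) = (T (A.constSec P s)).1 y :=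
  fib_apply T y (A.constSec P s)

theorem fib_eq {T : Module.End (TimeFun n M P) (A.TimeSec P)} {y : P × M}
    {φ : Module.End ℝ (E y.2)}
    (h : ∀ s : Sections n F E, φ (s y.2) = (T (A.constSec P s)).1 y) : fib T y = φ := by
  ext v
  obtain ⟨s, rfl⟩ := exists_section_eq (n := n) (F := F) y.2 v
  rw [h, fib_apply_section]

theorem fib_add (T U : Module.End (TimeFun n M P) (A.TimeSec P)) (y : P × M) :
    fib (T + U) y = fib T y + fib U y := fib_eq fun s => by
  rw [LinearMap.add_apply, fib_apply_section, fib_apply_section]; rfl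

theorem fib_mul (T U : Module.End (TimeFun n M P) (A.TimeSec P)) (y : P × M) :
    fib (T * U) y = fib T y * fib U y := fib_eq fun s => by
  rw [Module.End.mul_apply, fib_apply_section, fib_apply]; rfl

/-- Restriction to the fibre over `y` as a homomorphism of rings. -/
def fibHom (y : P × M) : Module.End (TimeFun n M P) (A.TimeSec P) →+* Module.End ℝ (E y.2) where
  toFun T := fib T y
  map_one' := fib_eq fun _ => rfl
  map_mul' T U := fib_mul T U y
  map_zero' := fib_eq fun _ => rfl
  map_add' T U := fib_add T U y

theorem fib_smul (f : TimeFun n M P) (T : Module.End (TimeFun n M P) (A.TimeSec P)) (y : P × M) :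
    fib (f • T) y = f y • fib T y := fib_eq fun s => by
  rw [LinearMap.smul_apply, LinearMap.smul_apply, fib_apply_section]; rfl

/-- After multiplication by `χ`, `φ` is a sum of operators of rank at most one, `v ↦ ⟨s'ᵢ, v⟩
φ(sᵢ)`. In this form the trace is visibly smooth. -/
theorem DualFrame.trace_eq_sum {x₀ : M} (b : A.DualFrame x₀) (x : M) (φ : Module.End ℝ (E x)) :
    b.χ x * LinearMap.trace ℝ (E x) φ = ∑ i, A.pairing x (b.s' i x) (φ (b.s i x)) := by
  have : FiniteDimensional ℝ (E x) := VectorBundle.finiteDimensional ℝ F E x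
  have h : b.χ x • φ = ∑ i, LinearMap.smulRight (A.pairing x (b.s' i x) : E x →ₗ[ℝ] ℝ)
      (φ (b.s i x)) := by
    ext v
    rw [LinearMap.smul_apply, ← map_smul, b.expand, map_sum, LinearMap.sum_apply]
    simp
  rw [← smul_eq_mul, ← map_smul, h, map_sum]
  refine Finset.sum_congr rfl fun i _ => ?_
  rw [LinearMap.trace_smulRight]
  rfl

variable (A P) in
/-- The fibrewise trace. -/
def timeTrace : Module.End (TimeFun n M P) (A.TimeSec P) →ₗ[TimeFun n M P] TimeFun n M P where
  toFun T := ⟨fun y => LinearMap.trace ℝ (E y.2) (fib T y), by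
    refine contMDiff_of_mul fun y₀ => ?_
    obtain ⟨b⟩ := A.nonempty_dualFrame y₀.2
    refine ⟨fun y => b.χ y.2, (TimeFun.const P b.χ).contMDiff, by simp [b.χ_self], ?_⟩
    have h : ContMDiff (𝓘(ℝ, P).prod (𝓡 n)) 𝓘(ℝ, ℝ) ∞
        (fun y => ∑ i, b.coeff i (T (A.constSec P (b.s i))) y) :=
      contMDiff_finsetSum fun i _ => ContMDiffMap.contMDiff _
    convert h using 2 with y
    rw [b.trace_eq_sum]
    refine Finset.sum_congr rfl fun i _ => ?_
    rw [fib_apply_section]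
    rfl⟩
  map_add' T U := by
    ext y
    change LinearMap.trace ℝ (E y.2) (fib (T + U) y) =
      LinearMap.trace ℝ (E y.2) (fib T y) + LinearMap.trace ℝ (E y.2) (fib U y)
    rw [fib_add, map_add]
  map_smul' f T := by
    ext y
    change LinearMap.trace ℝ (E y.2) (fib (f • T) y) = f y * LinearMap.trace ℝ (E y.2) (fib T y)
    rw [fib_smul, map_smul, smul_eq_mul]

theorem timeTrace_apply (T : Module.End (TimeFun n M P) (A.TimeSec P)) (y : P × M) :
    A.timeTrace P T y = LinearMap.trace ℝ (E y.2) (fib T y) := rfl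

theorem timeTrace_mul_comm (T U : Module.End (TimeFun n M P) (A.TimeSec P)) :
    A.timeTrace P (T * U) = A.timeTrace P (U * T) := by
  ext y
  rw [timeTrace_apply, timeTrace_apply, fib_mul, fib_mul,
    LinearMap.trace_mul_comm]

theorem DualFrame.timeTrace_eq_sum {x₀ : M} (b : A.DualFrame x₀)
    (T : Module.End (TimeFun n M P) (A.TimeSec P)) :
    TimeFun.const P b.χ * A.timeTrace P T = ∑ i, b.coeff i (T (A.constSec P (b.s i))) := by
  ext y
  rw [TimeFun.sum_apply]
  refine (b.trace_eq_sum y.2 (fib T y)).trans (Finset.sum_congr rfl fun i _ => ?_)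
  rw [fib_apply_section]
  rfl

/-- The trace of a commutator with a connection is the derivative of the trace. -/
theorem timeTrace_ad {G : Type*} [AddCommGroup G] {𝒜 : LeibnizAction G (TimeFun n M P)}
    (D : LeibnizConnection 𝒜 (A.TimeSec P)) (a : G)
    (T : Module.End (TimeFun n M P) (A.TimeSec P)) :
    A.timeTrace P (D.ad a T) = 𝒜.act a (A.timeTrace P T) := by
  ext y
  obtain ⟨b⟩ := A.nonempty_dualFrame y.2
  let c (i : b.ι) : A.TimeSec P →ₗ[TimeFun n M P] TimeFun n M P :=
    (A.timePairing P).bilin A (A.constSec P (b.s' i))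
  have hc : ∀ i v, c i v = b.coeff i v := fun i v => rfl
  let κ : TimeFun n M P := TimeFun.const P b.χ
  have hκ : κ y = 1 := b.χ_self
  -- After the cut-off, `T` is a finite sum of operators `w ↦ f(w) v`, for which the trace is
  -- `f(v)`.
  have hT : κ • T = ∑ i, LinearMap.smulRight (c i) (T (A.constSec P (b.s i))) := by
    ext1 v
    rw [LinearMap.smul_apply, b.apply_eq_sum, LinearMap.sum_apply]
    rfl
  have htr : ∀ (f : A.TimeSec P →ₗ[TimeFun n M P] TimeFun n M P) (v : A.TimeSec P),
      A.timeTrace P (LinearMap.smulRight f v) = f v := by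
    intro f v
    ext y
    obtain ⟨b⟩ := A.nonempty_dualFrame y.2
    have h := congrArg (fun g : TimeFun n M P => g y)
      (b.timeTrace_eq_sum (LinearMap.smulRight f v))
    have h' := congrArg (fun g : TimeFun n M P => g y) (b.apply_eq_sum f v)
    change b.χ y.2 * _ = _ at h
    change b.χ y.2 * _ = _ at h'
    rw [b.χ_self, one_mul, TimeFun.sum_apply] at h h'
    rw [h, h']
    refine Finset.sum_congr rfl fun i _ => ?_
    change A.pairing y.2 (b.s' i y.2) (f (A.constSec P (b.s i)) y • v.1 y) =
      A.pairing y.2 (b.s' i y.2) (v.1 y) * f (A.constSec P (b.s i)) y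
    rw [map_smul, smul_eq_mul, mul_comm]
  -- The commutator acts on `f ⊗ v` as a derivation, with `f'` the covariant derivative of `f`; the
  -- two occurrences of `f(∇_a v)` in the trace cancel.
  have hrank : ∀ (f : A.TimeSec P →ₗ[TimeFun n M P] TimeFun n M P) (v : A.TimeSec P),
      A.timeTrace P (D.ad a (LinearMap.smulRight f v)) = 𝒜.act a (f v) := by
    intro f v
    let f' : A.TimeSec P →ₗ[TimeFun n M P] TimeFun n M P :=
      { toFun := fun w => 𝒜.act a (f w) - f (D a w)
        map_add' := fun w w' => by simp only [map_add, 𝒜.act_add]; ring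
        map_smul' := fun g w => by
          simp only [map_smul, D.leibniz, map_add, smul_eq_mul, 𝒜.act_mul, RingHom.id_apply]; ring }
    have : D.ad a (LinearMap.smulRight f v) =
        LinearMap.smulRight f' v + LinearMap.smulRight f (D a v) := by
      ext1 w
      simp only [LeibnizConnection.ad_apply, LinearMap.add_apply, LinearMap.smulRight_apply,
        D.leibniz]
      change _ = (𝒜.act a (f w) - f (D a w)) • v + _
      rw [sub_smul]
      abel
    rw [this, map_add, htr, htr]
    change 𝒜.act a (f v) - f (D a v) + f (D a v) = _
    ring
  have hsum : A.timeTrace P (D.ad a (κ • T)) = 𝒜.act a (A.timeTrace P (κ • T)) := by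
    have hact : 𝒜.act a (A.timeTrace P (κ • T)) =
        ∑ i, 𝒜.act a (c i (T (A.constSec P (b.s i)))) := by
      let act' : TimeFun n M P →+ TimeFun n M P := AddMonoidHom.mk' (𝒜.act a) (𝒜.act_add a)
      change act' _ = ∑ i, act' _
      rw [hT, map_sum, map_sum]
      simp only [htr]
    have had : D.ad a (κ • T) = ∑ i, D.ad a (LinearMap.smulRight (c i) (T (A.constSec P (b.s i)))) := by
      let ad' : Module.End (TimeFun n M P) (A.TimeSec P) →+ Module.End (TimeFun n M P) (A.TimeSec P) :=
        AddMonoidHom.mk' (D.ad a) (D.ad_add a)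
      change ad' _ = ∑ i, ad' _
      rw [hT, map_sum]
    rw [hact, had, map_sum]
    simp only [hrank]
  -- The derivative of the cut-off contributes the same term to both sides of `hsum`; evaluation at
  -- `y`, where `κ = 1`, then removes `κ`.
  have hleib : D.ad a (κ • T) = 𝒜.act a κ • T + κ • D.ad a T := by
    ext1 w
    simp only [LeibnizConnection.ad_apply, LinearMap.add_apply, LinearMap.smul_apply, D.leibniz,
      smul_sub]
    abel
  rw [hleib, map_add, map_smul, map_smul, map_smul, smul_eq_mul, smul_eq_mul, smul_eq_mul,
    𝒜.act_mul] at hsum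
  have h := congrArg (fun g : TimeFun n M P => g y) hsum
  change 𝒜.act a κ y * A.timeTrace P T y + κ y * _ = 𝒜.act a κ y * A.timeTrace P T y + κ y * _ at h
  rw [hκ, one_mul, one_mul] at h
  exact add_left_cancel h

/-- Adjoint endomorphisms have the same trace. -/
theorem timeTrace_adjoint (B : TimeForm n F E P)
    {T U : Module.End (TimeFun n M P) (A.TimeSec P)}
    (h : ∀ v w, B.bilin A (T v) w = B.bilin A v (U w)) : A.timeTrace P T = A.timeTrace P U := by
  ext y
  rw [timeTrace_apply, timeTrace_apply]
  have : FiniteDimensional ℝ (E y.2) := VectorBundle.finiteDimensional ℝ F E y.2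
  let β : E y.2 →ₗ[ℝ] Module.Dual ℝ (E y.2) :=
    { toFun := fun v => (B.toFun y v : E y.2 →ₗ[ℝ] ℝ)
      map_add' := fun v w => by ext; simp
      map_smul' := fun c w => by ext; simp }
  have hinj : Function.Injective β := by
    rw [← LinearMap.ker_eq_bot, LinearMap.ker_eq_bot']
    exact fun v hv => B.nondegenerate y v fun w => LinearMap.congr_fun hv w
  let β' := LinearEquiv.ofInjectiveOfFinrankEq β hinj
    (Subspace.dual_finrank_eq (K := ℝ) (V := E y.2)).symm
  -- The isomorphism of the fibre with its dual given by `B` carries `T` to the transpose of `U`,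
  -- and both operations preserve the trace.
  have hβ : β'.conj (fib T y) = Module.Dual.transpose (fib U y) := by
    ext ξ v
    obtain ⟨w, rfl⟩ := β'.surjective ξ
    rw [LinearEquiv.conj_apply_apply, LinearEquiv.symm_apply_apply]
    obtain ⟨t, rfl⟩ := exists_section_eq (n := n) (F := F) y.2 w
    obtain ⟨s, rfl⟩ := exists_section_eq (n := n) (F := F) y.2 v
    change B.toFun y (fib T y (t y.2)) (s y.2) = B.toFun y (t y.2) (fib U y (s y.2))
    rw [fib_apply_section, fib_apply_section]
    exact congrArg (fun g : TimeFun n M P => g y) (h (A.constSec P t) (A.constSec P s))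
  rw [← LinearMap.trace_conj' (fib T y) β', hβ, LinearMap.trace_transpose']

end CourantAlgebroid

end Courant

end

/-! ### Connections over `P × M`, their adjoints and the regularity of curvature -/

noncomputable section

namespace Courant

variable {n : ℕ} {M : Type*} [TopologicalSpace M] [ChartedSpace (EuclideanSpace ℝ (Fin n)) M]
  [IsManifold (𝓡 n) ∞ M]
  {F : Type*} [NormedAddCommGroup F] [NormedSpace ℝ F]
  {E : M → Type*} [TopologicalSpace (TotalSpace F E)] [∀ x, AddCommGroup (E x)]
  [∀ x, Module ℝ (E x)] [∀ x, TopologicalSpace (E x)] [∀ x, IsTopologicalAddGroup (E x)]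
  [∀ x, ContinuousSMul ℝ (E x)] [FiberBundle F E] [VectorBundle ℝ F E]
  [ContMDiffVectorBundle ∞ F E (𝓡 n)]
  [FiniteDimensional ℝ F] [T2Space M]
  {P : Type*} [NormedAddCommGroup P] [NormedSpace ℝ P]


variable {A : CourantAlgebroid n F E}

/-! ### Connections on time-dependent sections -/

namespace CourantAlgebroid

theorem exists_slice (v : A.TimeSec P) (p : P) :
    ∃ u : Sections n F E, ∀ x, u x = v.1 (p, x) := by
  obtain ⟨u, hu⟩ := exists_section_of_functional A.pairing
    (contMDiff_form A.contMDiff_pairing) A.pairing_nondegenerate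
    (fun s x => A.pairing x (v.1 (p, x)) (s x))
    (fun s => contMDiff_space (contMDiff_pairing_section v s) p)
    (fun s t x => by simp) (fun f s x => by simp)
  refine ⟨u, fun x => A.eq_of_pairing fun w => ?_⟩
  obtain ⟨s, rfl⟩ := exists_section_eq (n := n) (F := F) x w
  exact hu s x

/-- The value of a time-dependent section at a given time. -/
def slice (v : A.TimeSec P) (p : P) : Sections n F E := (exists_slice v p).choose

theorem slice_apply (v : A.TimeSec P) (p : P) (x : M) : slice v p x = v.1 (p, x) :=
  (exists_slice v p).choose_spec x

theorem slice_add (v w : A.TimeSec P) (p : P) : slice (v + w) p = slice v p + slice w p := by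
  ext x
  change _ = slice v p x + slice w p x
  simp only [slice_apply, add_val]

theorem slice_smul (f : TimeFun n M P) (v : A.TimeSec P) (p : P) :
    slice (f • v) p = f.slice p • slice v p := by
  ext x
  simp only [slice_apply, smul_sections_apply, smul_val]
  rfl

@[simp] theorem slice_constSec (s : Sections n F E) (p : P) : slice (A.constSec P s) p = s := by
  ext x
  rw [slice_apply, constSec_val]

theorem contMDiff_fderiv_time (A : CourantAlgebroid n F E) {f : P × M → ℝ}
    (hf : ContMDiff (𝓘(ℝ, P).prod (𝓡 n)) 𝓘(ℝ, ℝ) ∞ f) (τ : P) :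
    ContMDiff (𝓘(ℝ, P).prod (𝓡 n)) 𝓘(ℝ, ℝ) ∞
      (fun y : P × M => fderiv ℝ (fun p => f (p, y.2)) y.1 τ) := by
  convert A.contMDiff_partialAct ((0 : Sections n F E), τ) hf using 1
  funext y
  simp [partialAct, lieDeriv_zero_left]

theorem exists_timeDeriv (τ : P) (v : A.TimeSec P) : ∃ u : A.TimeSec P,
    ∀ (s : Sections n F E) (y : P × M), A.pairing y.2 (u.1 y) (s y.2) =
      fderiv ℝ (fun p => A.pairing y.2 (v.1 (p, y.2)) (s y.2)) y.1 τ := by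
  have hd := fun (s : Sections n F E) => differentiable_time (contMDiff_pairing_section v s)
  refine (A.timePairing P).exists_timeSec _
    (fun s => A.contMDiff_fderiv_time (contMDiff_pairing_section v s) τ) ?_ ?_
  · intro s t y
    have := fderiv_fun_add (hd s y.2 y.1) (hd t y.2 y.1)
    simp only [ContMDiffSection.coe_add, Pi.add_apply, map_add]
    rw [this]
    rfl
  · intro f s y
    have := fderiv_const_mul (hd s y.2 y.1) (f y.2)
    simp only [smul_sections_apply, map_smul, smul_eq_mul]
    rw [this]
    rfl

/-- The derivative of a time-dependent section in the direction `τ`. -/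
def timeDeriv (τ : P) (v : A.TimeSec P) : A.TimeSec P := (exists_timeDeriv τ v).choose

theorem pairing_timeDeriv (τ : P) (v : A.TimeSec P) (s : Sections n F E) (y : P × M) :
    A.pairing y.2 ((timeDeriv τ v).1 y) (s y.2) =
      fderiv ℝ (fun p => A.pairing y.2 (v.1 (p, y.2)) (s y.2)) y.1 τ :=
  (exists_timeDeriv τ v).choose_spec s y

theorem timeSec_ext_pairing {v w : A.TimeSec P}
    (h : ∀ (s : Sections n F E) y, A.pairing y.2 (v.1 y) (s y.2) = A.pairing y.2 (w.1 y) (s y.2)) :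
    v = w :=
  timeSec_ext fun y => (A.timePairing P).eq_of_forall fun s => h s y

theorem timeDeriv_add_left (σ τ : P) (v : A.TimeSec P) :
    timeDeriv (σ + τ) v = timeDeriv σ v + timeDeriv τ v := timeSec_ext_pairing fun s y => by
  simp only [add_val, map_add, _root_.add_apply, pairing_timeDeriv]

theorem timeDeriv_zero_left (v : A.TimeSec P) : timeDeriv 0 v = 0 := timeSec_ext_pairing fun s y => by
  simp only [zero_val, map_zero, _root_.zero_apply, pairing_timeDeriv]

theorem timeDeriv_add (τ : P) (v w : A.TimeSec P) :
    timeDeriv τ (v + w) = timeDeriv τ v + timeDeriv τ w := timeSec_ext_pairing fun s y => by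
  have := fderiv_fun_add (differentiable_time (contMDiff_pairing_section v s) y.2 y.1)
    (differentiable_time (contMDiff_pairing_section w s) y.2 y.1)
  simp only [add_val, map_add, _root_.add_apply, pairing_timeDeriv]
  rw [this]
  rfl

theorem timeDeriv_smul (τ : P) (f : TimeFun n M P) (v : A.TimeSec P) (y : P × M) :
    (timeDeriv τ (f • v)).1 y =
      fderiv ℝ (fun p => f (p, y.2)) y.1 τ • v.1 y + f y • (timeDeriv τ v).1 y := by
  refine (A.timePairing P).eq_of_forall fun s => ?_
  change A.pairing y.2 _ _ = A.pairing y.2 _ _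
  have := fderiv_fun_mul (differentiable_time f.contMDiff y.2 y.1)
    (differentiable_time (contMDiff_pairing_section v s) y.2 y.1)
  simp only [smul_val, map_add, map_smul, _root_.add_apply, _root_.smul_apply, smul_eq_mul,
    pairing_timeDeriv]
  rw [this]
  simp only [_root_.add_apply, _root_.smul_apply, smul_eq_mul]
  ring

theorem timeDeriv_constSec (τ : P) (s : Sections n F E) : timeDeriv τ (A.constSec P s) = 0 :=
  timeSec_ext_pairing fun t y => by
    simp [zero_val, pairing_timeDeriv]

/-- The definition of `timeDeriv` only involves pairings with fixed sections. A dual frame at the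
point writes the pairing of two moving sections as a sum of products of such functions. -/
theorem fderiv_pairing (τ : P) (v w : A.TimeSec P) (y : P × M) :
    fderiv ℝ (fun p => A.pairing y.2 (v.1 (p, y.2)) (w.1 (p, y.2))) y.1 τ =
      A.pairing y.2 ((timeDeriv τ v).1 y) (w.1 y) + A.pairing y.2 (v.1 y) ((timeDeriv τ w).1 y) := by
  obtain ⟨p, x⟩ := y
  obtain ⟨b⟩ := A.nonempty_dualFrame x
  have hexp : ∀ u w : E x, A.pairing x u w =
      ∑ i, A.pairing x w (b.s' i x) * A.pairing x u (b.s i x) := by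
    intro u w
    conv_lhs => rw [← one_smul ℝ w, ← b.χ_self, b.expand, map_sum]
    simp only [map_smul, smul_eq_mul, A.pairing_symm x w]
  have h1 : (fun q => A.pairing x (v.1 (q, x)) (w.1 (q, x))) = fun q =>
      ∑ i, A.pairing x (w.1 (q, x)) (b.s' i x) * A.pairing x (v.1 (q, x)) (b.s i x) := by
    funext q
    exact hexp _ _
  have hd := fun (v : A.TimeSec P) (s : Sections n F E) =>
    differentiable_time (contMDiff_pairing_section v s) x p
  rw [h1, fderiv_fun_sum fun i _ => (hd w (b.s' i)).fun_mul (hd v (b.s i)), hexp _ (w.1 (p, x)),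
    hexp (v.1 (p, x)), ← Finset.sum_add_distrib, _root_.sum_apply]
  refine Finset.sum_congr rfl fun i _ => ?_
  rw [fderiv_fun_mul (hd w (b.s' i)) (hd v (b.s i))]
  simp only [_root_.add_apply, _root_.smul_apply, smul_eq_mul,
    pairing_timeDeriv τ v (b.s i) (p, x), pairing_timeDeriv τ w (b.s' i) (p, x)]
  ring

/-- A family of `E`-connections that depends smoothly on the parameter. -/
def IsSmoothFamily (Δ : P → A.EConnection) : Prop :=
  ∀ a b s : Sections n F E, ContMDiff (𝓘(ℝ, P).prod (𝓡 n)) 𝓘(ℝ, ℝ) ∞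
    fun y : P × M => A.pairing y.2 (Δ y.1 a b y.2) (s y.2)

/-- Expanding `χ v` in a dual frame and applying the Leibniz rule reduces the claim to sections that
are constant in the parameter. The derivative of `χ` is the term subtracted. -/
theorem IsSmoothFamily.contMDiff {Δ : P → A.EConnection} (hΔ : IsSmoothFamily Δ)
    (a : Sections n F E) (v : A.TimeSec P) (s : Sections n F E) :
    ContMDiff (𝓘(ℝ, P).prod (𝓡 n)) 𝓘(ℝ, ℝ) ∞
      fun y : P × M => A.pairing y.2 (Δ y.1 a (slice v y.1) y.2) (s y.2) := by
  refine contMDiff_of_mul fun y₀ => ?_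
  obtain ⟨b⟩ := A.nonempty_dualFrame y₀.2
  refine ⟨fun y => b.χ y.2, (TimeFun.const P b.χ).contMDiff, by simp [b.χ_self], ?_⟩
  have h : ContMDiff (𝓘(ℝ, P).prod (𝓡 n)) 𝓘(ℝ, ℝ) ∞ (fun y : P × M =>
      (∑ i, (b.coeff i v y * A.pairing y.2 (Δ y.1 a (b.s i) y.2) (s y.2) +
        A.timeAction.act (a, 0) (b.coeff i v) y * A.pairing y.2 (b.s i y.2) (s y.2))) -
        A.lieFun a b.χ y.2 * A.pairing y.2 (v.1 y) (s y.2)) :=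
    (contMDiff_finsetSum fun i _ => ((b.coeff i v).contMDiff.mul (hΔ a (b.s i) s)).add
      ((A.timeAction.act (a, 0) (b.coeff i v)).contMDiff.mul
        ((A.timePairing P).contMDiff (b.s i) s))).sub
      ((TimeFun.const P (A.lieFun a b.χ)).contMDiff.mul (contMDiff_pairing_section v s))
  convert h using 2 with y
  have h1 : b.χ • slice v y.1 = ∑ i, (b.coeff i v).slice y.1 • b.s i := by
    ext x
    have h2 : (∑ i, (b.coeff i v).slice y.1 • b.s i : Sections n F E) x =
        ∑ i, (b.coeff i v).slice y.1 x • b.s i x := by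
      have := congrFun (map_sum (ContMDiffSection.coeAddHom (𝓡 n) F ∞ E)
        (fun i => (b.coeff i v).slice y.1 • b.s i) Finset.univ) x
      rw [Finset.sum_apply] at this
      exact this
    rw [h2, smul_sections_apply, slice_apply, b.expand]
    rfl
  have h2 := congrArg (fun u : Sections n F E => A.pairing y.2 (u y.2) (s y.2))
    (congrArg (Δ y.1 a) h1)
  have h3 : ∀ u : b.ι → Sections n F E, A.pairing y.2 ((∑ i, u i : Sections n F E) y.2) (s y.2) =
      ∑ i, A.pairing y.2 (u i y.2) (s y.2) := by
    intro u
    have := congrFun (map_sum (ContMDiffSection.coeAddHom (𝓡 n) F ∞ E) u Finset.univ) y.2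
    rw [Finset.sum_apply] at this
    rw [show (∑ i, u i : Sections n F E) y.2 = ∑ i, u i y.2 from this, map_sum, _root_.sum_apply]
  simp only [map_sum, h3, (Δ y.1).leibniz, map_add, map_smul, _root_.add_apply, _root_.smul_apply,
    smul_eq_mul, slice_apply] at h2
  have h4 : ∀ f : TimeFun n M P, A.timeAction.act (a, 0) f y =
      A.lieDeriv a (f.slice y.1) y.2 := by
    intro f
    change A.partialAct (a, 0) f y = _
    simp only [partialAct, map_zero, zero_add]
    rfl
  simp only [h4]
  rw [eq_sub_iff_add_eq]
  exact h2

section Family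

variable {Δ : P → A.EConnection} (hΔ : IsSmoothFamily Δ)

/-- The connection on time-dependent sections given by a smooth family of `E`-connections. -/
def familyConnection : LeibnizConnection (A.timeAction (P := P)) (A.TimeSec P) where
  toFun := AddMonoidHom.mk' (fun u => AddMonoidHom.mk'
      (fun v => ⟨fun y => Δ y.1 u.1 (slice v y.1) y.2, hΔ.contMDiff u.1 v⟩ + timeDeriv u.2 v)
      (fun v w => by
        refine timeSec_ext fun y => ?_
        change Δ y.1 u.1 (slice (v + w) y.1) y.2 + (timeDeriv u.2 (v + w)).1 y =
          Δ y.1 u.1 (slice v y.1) y.2 + (timeDeriv u.2 v).1 y +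
            (Δ y.1 u.1 (slice w y.1) y.2 + (timeDeriv u.2 w).1 y)
        rw [slice_add, timeDeriv_add, map_add, ContMDiffSection.coe_add, Pi.add_apply, add_val]
        abel))
    (fun u u' => by
      ext1 v
      refine timeSec_ext fun y => ?_
      change Δ y.1 (u.1 + u'.1) (slice v y.1) y.2 + (timeDeriv (u.2 + u'.2) v).1 y =
        Δ y.1 u.1 (slice v y.1) y.2 + (timeDeriv u.2 v).1 y +
          (Δ y.1 u'.1 (slice v y.1) y.2 + (timeDeriv u'.2 v).1 y)
      rw [timeDeriv_add_left, map_add, LinearMap.add_apply, ContMDiffSection.coe_add, Pi.add_apply,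
        add_val]
      abel)
  leibniz u f v := by
    refine timeSec_ext fun y => ?_
    change Δ y.1 u.1 (slice (f • v) y.1) y.2 + (timeDeriv u.2 (f • v)).1 y =
      A.partialAct u f y • v.1 y + f y • (Δ y.1 u.1 (slice v y.1) y.2 + (timeDeriv u.2 v).1 y)
    rw [slice_smul, timeDeriv_smul, (Δ y.1).leibniz, slice_apply, partialAct, smul_add, add_smul]
    change f y • _ + A.lieDeriv u.1 (fun x => f (y.1, x)) y.2 • v.1 y + _ = _
    abel

theorem familyConnection_val (u : Sections n F E × P) (v : A.TimeSec P) (y : P × M) :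
    (familyConnection hΔ u v).1 y = Δ y.1 u.1 (slice v y.1) y.2 + (timeDeriv u.2 v).1 y := rfl

theorem slice_familyConnection (a : Sections n F E) (v : A.TimeSec P) (p : P) :
    slice (familyConnection hΔ (a, 0) v) p = Δ p a (slice v p) := by
  ext x
  rw [slice_apply, familyConnection_val, timeDeriv_zero_left, zero_val, add_zero]

theorem familyConnection_time (τ : P) (v : A.TimeSec P) :
    familyConnection hΔ (0, τ) v = timeDeriv τ v := by
  refine timeSec_ext fun y => ?_
  rw [familyConnection_val]
  simp

theorem fib_curvEnd_apply (a b s : Sections n F E) (y : P × M) :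
    fib ((familyConnection hΔ).curvEnd (a, 0) (b, 0)) y (s y.2) =
      (Δ y.1 a (Δ y.1 b s) - Δ y.1 b (Δ y.1 a s) - Δ y.1 (A.bracket a b) s : Sections n F E) y.2 := by
  rw [fib_apply_section, LeibnizConnection.curvEnd_apply, sub_val, sub_val]
  change _ - _ - (familyConnection hΔ (A.bracket a b, 0) (A.constSec P s)).1 y = _
  simp only [familyConnection_val, slice_familyConnection, slice_constSec, timeDeriv_zero_left,
    zero_val, add_zero]
  rfl

/-- The curvature in the directions `∂_τ` and `a` is the velocity of the family: `∂_τ` commutes with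
`a` and kills constant sections. -/
theorem pairing_fib_curvEnd_time (τ : P) (a s t : Sections n F E) (y : P × M) :
    A.pairing y.2 (fib ((familyConnection hΔ).curvEnd (0, τ) (a, 0)) y (s y.2)) (t y.2) =
      fderiv ℝ (fun p => A.pairing y.2 (Δ p a s y.2) (t y.2)) y.1 τ := by
  have hz : A.timeAction.br (0, τ) (a, (0 : P)) = 0 := by
    change (A.bracket 0 a, (0 : P)) = 0
    rw [map_zero]
    rfl
  rw [fib_apply_section, LeibnizConnection.curvEnd_apply, hz, map_zero, AddMonoidHom.zero_apply,
    familyConnection_time, familyConnection_time, timeDeriv_constSec, map_zero, sub_zero, sub_zero,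
    pairing_timeDeriv]
  simp only [familyConnection_val, slice_constSec, timeDeriv_constSec, zero_val, add_zero]

theorem familyConnection_smul_left (f : C^∞⟮𝓡 n, M; ℝ⟯) (a : Sections n F E) (v : A.TimeSec P) :
    familyConnection hΔ (f • a, 0) v = TimeFun.const P f • familyConnection hΔ (a, 0) v := by
  refine timeSec_ext fun y => ?_
  rw [smul_val, familyConnection_val, familyConnection_val, timeDeriv_zero_left, zero_val,
    add_zero, add_zero, (Δ y.1).smul_left]
  rfl

/-- The `E`-connection preserves the pairing. -/
def EConnection.PreservesPairing (D : A.EConnection) : Prop :=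
  ∀ (e v w : Sections n F E) (x : M), A.pairing x (D e v x) (w x) + A.pairing x (v x) (D e w x) =
    A.lieDeriv e (A.pairFun v w) x

/-- The pairing does not depend on the parameter, so `∂_τ` preserves it as well as each `Δ p` does.
-/
theorem familyConnection_skew (h : ∀ p, (Δ p).PreservesPairing) (u : Sections n F E × P)
    (v w : A.TimeSec P) :
    (A.timePairing P).bilin A (familyConnection hΔ u v) w +
      (A.timePairing P).bilin A v (familyConnection hΔ u w) =
      A.timeAction.act u ((A.timePairing P).bilin A v w) := by
  ext y
  change A.pairing y.2 ((familyConnection hΔ u v).1 y) (w.1 y) +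
    A.pairing y.2 (v.1 y) ((familyConnection hΔ u w).1 y) =
    fderiv ℝ (fun p => A.pairing y.2 (v.1 (p, y.2)) (w.1 (p, y.2))) y.1 u.2 +
      A.lieDeriv u.1 (fun x => A.pairing x (v.1 (y.1, x)) (w.1 (y.1, x))) y.2
  have h1 := h y.1 u.1 (slice v y.1) (slice w y.1) y.2
  have h2 : (A.pairFun (slice v y.1) (slice w y.1) : M → ℝ) =
      fun x => A.pairing x (v.1 (y.1, x)) (w.1 (y.1, x)) := by
    funext x
    change A.pairing x (slice v y.1 x) (slice w y.1 x) = _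
    rw [slice_apply, slice_apply]
  rw [h2, slice_apply, slice_apply] at h1
  rw [fderiv_pairing, familyConnection_val, familyConnection_val, ← h1, map_add, map_add,
    _root_.add_apply]
  ring

end Family

end CourantAlgebroid

end Courant

end

noncomputable section

namespace Courant

variable {n : ℕ} {M : Type*} [TopologicalSpace M] [ChartedSpace (EuclideanSpace ℝ (Fin n)) M]
  [IsManifold (𝓡 n) ∞ M]
  {F : Type*} [NormedAddCommGroup F] [NormedSpace ℝ F]
  {E : M → Type*} [TopologicalSpace (TotalSpace F E)] [∀ x, AddCommGroup (E x)]
  [∀ x, Module ℝ (E x)] [∀ x, TopologicalSpace (E x)] [∀ x, IsTopologicalAddGroup (E x)]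
  [∀ x, ContinuousSMul ℝ (E x)] [FiberBundle F E] [VectorBundle ℝ F E]
  [ContMDiffVectorBundle ∞ F E (𝓡 n)]
  [FiniteDimensional ℝ F] [T2Space M]
  {P : Type*} [NormedAddCommGroup P] [NormedSpace ℝ P]


variable {A : CourantAlgebroid n F E}

namespace CourantAlgebroid

/-! ### Adjoint connections -/

namespace TimeForm

variable (B : TimeForm n F E P)

theorem bilin_comm (v w : A.TimeSec P) : B.bilin A v w = B.bilin A w v := by
  ext y
  exact B.symm y _ _

theorem eq_of_bilin {v w : A.TimeSec P} (h : ∀ u, B.bilin A u v = B.bilin A u w) : v = w := by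
  refine timeSec_ext fun y => B.eq_of_forall fun s => ?_
  have := congrArg (fun f : TimeFun n M P => f y) (h (A.constSec P s))
  simp only [bilin_apply, constSec_val] at this
  rw [B.symm, this, B.symm]

variable {G : Type*} [AddCommGroup G] {𝒜 : LeibnizAction G (TimeFun n M P)}
  (D : LeibnizConnection 𝒜 (A.TimeSec P))

/-- Connections have adjoints with respect to families of nondegenerate forms. -/
theorem exists_adjoint (hact : ∀ a b f, 𝒜.act (a + b) f = 𝒜.act a f + 𝒜.act b f) :
    ∃ D' : LeibnizConnection 𝒜 (A.TimeSec P), ∀ a v w,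
    B.bilin A (D a v) w + B.bilin A v (D' a w) = 𝒜.act a (B.bilin A v w) := by
  -- The right-hand side is linear in `v` over functions, because the derivatives of the
  -- coefficients cancel, and is therefore represented by a section.
  have key : ∀ a w, ∃ u : A.TimeSec P, ∀ v,
      B.bilin A v u = 𝒜.act a (B.bilin A v w) - B.bilin A (D a v) w := by
    intro a w
    obtain ⟨u, hu⟩ := B.exists_represents_time (A := A)
      { toFun := fun v => 𝒜.act a (B.bilin A v w) - B.bilin A (D a v) w
        map_add' := fun v v' => by
          simp only [map_add, LinearMap.add_apply, 𝒜.act_add]; ring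
        map_smul' := fun f v => by
          simp only [map_smul, map_add, LinearMap.add_apply, LinearMap.smul_apply, D.leibniz,
            smul_eq_mul, 𝒜.act_mul, RingHom.id_apply]
          ring }
    exact ⟨u, fun v => (B.bilin_comm v u).trans (hu v)⟩
  choose D' hD' using key
  have hsub : ∀ a f g, 𝒜.act a (f - g) = 𝒜.act a f - 𝒜.act a g := fun a f g =>
    map_sub (AddMonoidHom.mk' (𝒜.act a) (𝒜.act_add a)) f g
  refine ⟨{ toFun := AddMonoidHom.mk' (fun a => AddMonoidHom.mk' (D' a) fun w w' => ?_) fun a b => ?_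
            leibniz := fun a f w => ?_ }, fun a v w => ?_⟩
  · refine B.eq_of_bilin fun v => ?_
    simp only [map_add, hD', 𝒜.act_add]
    abel
  · ext1 w
    refine B.eq_of_bilin fun v => ?_
    simp only [AddMonoidHom.mk'_apply, AddMonoidHom.add_apply, map_add, hD', LinearMap.add_apply,
      hact]
    abel
  · refine B.eq_of_bilin fun v => ?_
    simp only [AddMonoidHom.mk'_apply, map_add, map_smul, hD', smul_eq_mul, 𝒜.act_mul]
    ring
  · simp only [AddMonoidHom.mk'_apply, hD']
    abel

variable (A) in
/-- The bilinear form as a biadditive map. -/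
def biadd : A.TimeSec P →+ A.TimeSec P →+ TimeFun n M P :=
  AddMonoidHom.mk' (fun v => (B.bilin A v).toAddMonoidHom) fun v w => by
    ext1 u
    exact LinearMap.congr_fun (map_add (B.bilin A) v w) u

variable {B D} in
theorem chern_adjoint {D' : LeibnizConnection 𝒜 (A.TimeSec P)}
    (h : ∀ a v w, B.bilin A (D a v) w + B.bilin A v (D' a w) = 𝒜.act a (B.bilin A v w))
    {k : ℕ} (hk : Odd k) (l : List G) :
    D'.chern (A.timeTrace P).toAddMonoidHom k l = -D.chern (A.timeTrace P).toAddMonoidHom k l :=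
  LeibnizConnection.chern_adjoint (B := B.biadd A) D h _
    (fun _ _ h => timeTrace_adjoint B h) hk l

end TimeForm

theorem TimeFun.eq_zero_of_eq_neg {f : TimeFun n M P} (h : f = -f) : f = 0 := by
  ext y
  have := congrArg (fun g : TimeFun n M P => g y) h
  change f y = -f y at this
  change f y = 0
  linarith

/-- `tr(F^k)` vanishes for odd `k` if the connection preserves a form. -/
theorem chern_eq_zero_of_skew {G : Type*} [AddCommGroup G] {𝒜 : LeibnizAction G (TimeFun n M P)}
    {D : LeibnizConnection 𝒜 (A.TimeSec P)} (B : TimeForm n F E P)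
    (h : ∀ a v w, B.bilin A (D a v) w + B.bilin A v (D a w) = 𝒜.act a (B.bilin A v w))
    {k : ℕ} (hk : Odd k) : D.chern (A.timeTrace P).toAddMonoidHom k = 0 :=
  Form.ext' fun l => TimeFun.eq_zero_of_eq_neg (TimeForm.chern_adjoint h hk l)

-- The bracket is compatible with the pairing by invariance, and the correction `⟨∇_{ρ(v)} e, w⟩ -
-- ⟨∇_{ρ(w)} e, v⟩` is antisymmetric in `v` and `w`.
variable (A) in
theorem preservesPairing_bott (cov : CovariantDerivative (𝓡 n) F E)
    [CovariantDerivative.ContMDiffCovariantDerivative cov ∞] :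
    (A.bott cov).PreservesPairing := by
  intro e v w x
  change A.pairing x (A.bottFun cov e v x) (w x) + A.pairing x (v x) (A.bottFun cov e w x) = _
  have h := A.pairing_invariant e v w x
  rw [A.pairing_symm x (v x), pairing_bottFun, pairing_bottFun, A.pairing_symm x _ (v x)]
  change _ = mvfderiv (𝓡 n) (fun y => A.pairing y (v y) (w y)) x (A.anchor x (e x))
  rw [h, A.pairing_symm x (v x) (A.bracket e w x)]
  ring

theorem timeAction_act_add (u v : Sections n F E × P) (f : TimeFun n M P) :
    A.timeAction.act (u + v) f = A.timeAction.act u f + A.timeAction.act v f := by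
  ext y
  change A.partialAct (u + v) f y = A.partialAct u f y + A.partialAct v f y
  simp only [partialAct, Prod.fst_add, Prod.snd_add, map_add, lieDeriv_add_left]
  ring

variable (P) in
/-- Functions on `M` as functions on `P × M`. -/
def constHom : C^∞⟮𝓡 n, M; ℝ⟯ →+* TimeFun n M P where
  toFun := TimeFun.const P
  map_one' := rfl
  map_mul' _ _ := rfl
  map_zero' := rfl
  map_add' _ _ := rfl

@[simp] theorem constHom_apply (f : C^∞⟮𝓡 n, M; ℝ⟯) : constHom P f = TimeFun.const P f := rfl

theorem timeAction_act_const (u : Sections n F E × P) (f : C^∞⟮𝓡 n, M; ℝ⟯) :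
    A.timeAction.act u (TimeFun.const P f) = TimeFun.const P (A.lieFun u.1 f) := by
  ext y
  change fderiv ℝ (fun p => f y.2) y.1 u.2 + _ = _
  simp
  rfl

/-! ### The section `𝒟 f` -/

section Differential

variable (A)

theorem exists_differential (f : C^∞⟮𝓡 n, M; ℝ⟯) : ∃ u : Sections n F E, ∀ s x,
    A.pairing x (u x) (s x) = A.lieDeriv s f x :=
  exists_section_of_functional A.pairing (contMDiff_form A.contMDiff_pairing)
    A.pairing_nondegenerate (fun s => A.lieDeriv s f)
    (fun s => A.contMDiff_lieDeriv s f.contMDiff)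
    (fun s t x => A.lieDeriv_add_left s t f x) (fun g s x => A.lieDeriv_smul_left g s f x)

/-- The section `𝒟 f` with `⟨𝒟 f, e⟩ = ρ(e)(f)`. -/
def differential (f : C^∞⟮𝓡 n, M; ℝ⟯) : Sections n F E := (A.exists_differential f).choose

theorem pairing_differential (f : C^∞⟮𝓡 n, M; ℝ⟯) (s : Sections n F E) (x : M) :
    A.pairing x (A.differential f x) (s x) = A.lieDeriv s f x :=
  (A.exists_differential f).choose_spec s x

theorem sections_ext_pairing {u v : Sections n F E}
    (h : ∀ (s : Sections n F E) x, A.pairing x (u x) (s x) = A.pairing x (v x) (s x)) : u = v := by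
  ext x
  refine A.eq_of_pairing fun w => ?_
  obtain ⟨s, rfl⟩ := exists_section_eq (n := n) (F := F) x w
  exact h s x

theorem bracket_add_bracket (a b : Sections n F E) :
    A.bracket a b + A.bracket b a = A.differential (A.pairFun a b) :=
  A.sections_ext_pairing fun s x => by
    rw [pairing_differential]
    exact A.bracket_symm a b s x

theorem differential_add (f g : C^∞⟮𝓡 n, M; ℝ⟯) :
    A.differential (f + g) = A.differential f + A.differential g :=
  A.sections_ext_pairing fun s x => by
    rw [ContMDiffSection.coe_add, Pi.add_apply, map_add, _root_.add_apply, pairing_differential,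
      pairing_differential, pairing_differential]
    exact A.lieDeriv_add s f.contMDiff g.contMDiff x

theorem differential_mul (f g : C^∞⟮𝓡 n, M; ℝ⟯) :
    A.differential (f * g) = f • A.differential g + g • A.differential f :=
  A.sections_ext_pairing fun s x => by
    rw [ContMDiffSection.coe_add, Pi.add_apply, map_add, _root_.add_apply, smul_sections_apply,
      smul_sections_apply, map_smul, map_smul, _root_.smul_apply, _root_.smul_apply,
      pairing_differential, pairing_differential, pairing_differential]
    exact A.lieDeriv_mul s f.contMDiff g.contMDiff x

theorem differential_const (c : ℝ) :
    A.differential (algebraMap ℝ C^∞⟮𝓡 n, M; ℝ⟯ c) = 0 :=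
  A.sections_ext_pairing fun s x => by
    rw [pairing_differential, ContMDiffSection.coe_zero, Pi.zero_apply, map_zero,
      _root_.zero_apply]
    exact A.lieDeriv_const s c x

/-- For `f = ⟨a, b⟩`, `𝒟f = [a, b] + [b, a]` has anchor zero because the anchor preserves brackets.
For general `f` put `a = 𝒟f` and apply this to `⟨f a, b⟩`: what remains is `⟨a, b⟩ ρ(𝒟f) = 0`, with
`b` chosen so that `⟨a, b⟩` is nonzero at `x`. -/
theorem lieDeriv_differential (f : C^∞⟮𝓡 n, M; ℝ⟯) {h : M → ℝ}
    (hh : ContMDiff (𝓡 n) 𝓘(ℝ, ℝ) ∞ h) (x : M) : A.lieDeriv (A.differential f) h x = 0 := by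
  have h0 : ∀ a b : Sections n F E, A.lieDeriv (A.differential (A.pairFun a b)) h x = 0 := by
    intro a b
    rw [← bracket_add_bracket, lieDeriv_add_left, A.lieDeriv_bracket a b hh,
      A.lieDeriv_bracket b a hh]
    ring
  by_cases hx : A.differential f x = 0
  · simp [lieDeriv, hx]
  · obtain ⟨w, hw⟩ := not_forall.1 (mt (A.pairing_nondegenerate x _) hx)
    obtain ⟨b, rfl⟩ := exists_section_eq (n := n) (F := F) x w
    let a := A.differential f
    have h1 : A.pairFun (f • a) b = f * A.pairFun a b := by
      ext y
      change A.pairing y (f y • a y) (b y) = f y * A.pairing y (a y) (b y)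
      rw [map_smul, _root_.smul_apply, smul_eq_mul]
    have h2 := h0 (f • a) b
    rw [h1, differential_mul, lieDeriv_add_left, lieDeriv_smul_left, lieDeriv_smul_left, h0,
      mul_zero, zero_add] at h2
    exact (mul_eq_zero.1 h2).resolve_left hw

end Differential

/-! ### Regularity of the curvature -/

section Family

variable {Δ : P → A.EConnection} (hΔ : IsSmoothFamily Δ)

/-- Instance of the general statement with `dd f = (𝒟f, 0)`; the identity `ρ ∘ 𝒟 = 0` makes the
symbol linear over functions. -/
theorem hasDerivationSymbol_familyCurv :
    Form.HasDerivationSymbol ℝ (constHom P) (fun u v : Sections n F E × P => A.pairFun u.1 v.1)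
      (familyConnection hΔ).curv := by
  refine LeibnizConnection.hasDerivationSymbol_curv _ (fun f => (A.differential f, 0)) ?_ ?_ ?_ ?_ ?_
  · intro a b
    exact Prod.ext (A.bracket_add_bracket a.1 b.1) (add_zero 0)
  · intro f g
    ext y
    change fderiv ℝ _ y.1 0 + _ = (0 : ℝ)
    rw [map_zero, zero_add]
    exact A.lieDeriv_differential f (contMDiff_space g.contMDiff y.1) y.2
  · intro f g
    exact Prod.ext (A.differential_add f g) (add_zero 0).symm
  · intro f g v
    have : (A.differential (f * g), (0 : P)) =
        (f • A.differential g, 0) + (g • A.differential f, 0) :=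
      Prod.ext (A.differential_mul f g) (add_zero 0).symm
    rw [this, map_add, AddMonoidHom.add_apply, familyConnection_smul_left,
      familyConnection_smul_left]
    rfl
  · intro c
    exact Prod.ext (A.differential_const c) rfl

theorem isLastLinear_familyCurv :
    Form.IsLastLinear (constHom (n := n) (M := M) P) (fun a : Sections n F E => (a, (0 : P)))
      (familyConnection hΔ).curv := by
  refine LeibnizConnection.isLastLinear_curv _ ?_ ?_ ?_ ?_
  · intro a b
    exact Prod.ext rfl (add_zero 0).symm
  · intro u a b
    refine Prod.ext ?_ (add_zero 0).symm
    change A.bracket u.1 (a + b) = A.bracket u.1 a + A.bracket u.1 b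
    rw [map_add]
  · intro f a v
    exact familyConnection_smul_left hΔ f a v
  · intro u f a v
    have : A.timeAction.br u (f • a, (0 : P)) =
        (A.lieFun u.1 f • a, 0) + (f • A.bracket u.1 a, 0) :=
      Prod.ext (A.bracket_smul u.1 a f) (add_zero 0).symm
    rw [this, map_add, AddMonoidHom.add_apply, familyConnection_smul_left,
      familyConnection_smul_left, constHom_apply, timeAction_act_const, add_comm]
    rfl

end Family

/-! ### The family underlying a connection -/

section Underlying

variable {D : LeibnizConnection (A.timeAction (P := P)) (A.TimeSec P)}
  (hD : ∀ (f : C^∞⟮𝓡 n, M; ℝ⟯) (a : Sections n F E) (v : A.TimeSec P),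
    D (f • a, 0) v = TimeFun.const P f • D (a, 0) v)

theorem slice_const_smul (f : C^∞⟮𝓡 n, M; ℝ⟯) (v : A.TimeSec P) (p : P) :
    slice (TimeFun.const P f • v) p = f • slice v p := slice_smul _ _ _

theorem underlying_leibniz (D : LeibnizConnection (A.timeAction (P := P)) (A.TimeSec P)) (p : P)
    (a b : Sections n F E) (f : C^∞⟮𝓡 n, M; ℝ⟯) :
    slice (D (a, 0) (A.constSec P (f • b))) p =
      f • slice (D (a, 0) (A.constSec P b)) p + A.lieFun a f • b := by
  rw [constSec_smul, D.leibniz, timeAction_act_const, slice_add, slice_const_smul,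
    slice_const_smul, slice_constSec, add_comm]

/-- The `E`-connections given by a connection on time-dependent sections at fixed times. -/
def underlying (p : P) : A.EConnection where
  toFun := LinearMap.mk₂ ℝ (fun a b => slice (D (a, 0) (A.constSec P b)) p)
    (fun a a' b => by
      have : (a + a', (0 : P)) = (a, 0) + (a', 0) := Prod.ext rfl (add_zero 0).symm
      rw [this, map_add, AddMonoidHom.add_apply, slice_add])
    (fun c a b => by
      let f : C^∞⟮𝓡 n, M; ℝ⟯ := ⟨fun _ => c, contMDiff_const⟩
      exact (congrArg (slice · p) (hD f a (A.constSec P b))).trans (slice_const_smul f _ p))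
    (fun a b b' => by rw [constSec_add, map_add, slice_add])
    (fun c a b => by
      let f : C^∞⟮𝓡 n, M; ℝ⟯ := ⟨fun _ => c, contMDiff_const⟩
      refine (underlying_leibniz D p a b f).trans ?_
      have : A.lieFun a f • b = 0 := by
        ext x
        have h0 : A.lieDeriv a f x = 0 := A.lieDeriv_const a c x
        change A.lieDeriv a f x • b x = 0
        rw [h0, zero_smul]
      rw [this, add_zero]
      rfl)
  leibniz a b f x := congrArg (fun s : Sections n F E => s x) (underlying_leibniz D p a b f)
  smul_left a b f :=
    (congrArg (slice · p) (hD f a (A.constSec P b))).trans (slice_const_smul f _ p)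

theorem underlying_apply (p : P) (a b : Sections n F E) :
    underlying hD p a b = slice (D (a, 0) (A.constSec P b)) p := rfl

theorem isSmoothFamily_underlying : IsSmoothFamily (underlying hD) := by
  intro a b s
  simp only [underlying_apply, slice_apply]
  exact contMDiff_pairing_section (D (a, 0) (A.constSec P b)) s

/-- Two connections differ by endomorphisms. -/
theorem exists_difference {G : Type*} [AddCommGroup G] {𝒜 : LeibnizAction G (TimeFun n M P)}
    (D D' : LeibnizConnection 𝒜 (A.TimeSec P)) (a : G) :
    ∃ u : Module.End (TimeFun n M P) (A.TimeSec P), ∀ v, D' a v = D a v + u v :=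
  ⟨{ toFun := fun v => D' a v - D a v
     map_add' := fun v w => by rw [map_add, map_add]; abel
     map_smul' := fun f v => by rw [D.leibniz, D'.leibniz, RingHom.id_apply, smul_sub]; abel },
    fun v => (add_sub_cancel (D a v) (D' a v)).symm⟩

/-- The difference of the two sides is linear over functions and vanishes on constant sections. In
the parameter directions the two connections may differ. -/
theorem familyConnection_underlying (a : Sections n F E) :
    familyConnection (isSmoothFamily_underlying hD) (a, 0) = D (a, 0) := by
  obtain ⟨u, hu⟩ := exists_difference (familyConnection (isSmoothFamily_underlying hD)) D (a, 0)
  ext1 v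
  rw [hu, left_eq_add]
  have h0 : ∀ s, u (A.constSec P s) = 0 := by
    intro s
    rw [← left_eq_add (a := familyConnection (isSmoothFamily_underlying hD) (a, 0) _), ← hu]
    refine timeSec_ext fun y => ?_
    rw [familyConnection_val, slice_constSec, timeDeriv_zero_left, zero_val, add_zero,
      underlying_apply, slice_apply]
  refine timeSec_ext fun y => ?_
  obtain ⟨s, hs⟩ := exists_section_eq (n := n) (F := F) y.2 (v.1 y)
  rw [← fib_apply, ← hs, fib_apply_section, h0]

end Underlying

end CourantAlgebroid

end Courant

end

/-! ### Restriction of forms and integration over the parameter -/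

noncomputable section

namespace Courant

namespace Form

/-! ### Restriction of forms along maps of arguments and values -/

section Pull

variable {G G' R R' : Type*} [Ring R] [Ring R']

/-- Restriction of a form along a map of the arguments, composed with a map of the values. -/
def pull (j : G' → G) (t : R →+ R') (α : Form G R) : Form G' R' := ⟨fun l => t (α (l.map j))⟩

@[simp] theorem pull_apply (j : G' → G) (t : R →+ R') (α : Form G R) (l : List G') :
    pull j t α l = t (α (l.map j)) := rfl

theorem contract_pull (j : G' → G) (t : R →+ R') (α : Form G R) (a : G') :
    contract a (pull j t α) = pull j t (contract (j a) α) := rfl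

variable {br : G → G → G} {L : G → R → R} {br' : G' → G' → G'} {L' : G' → R' → R'}
  {j : G' → G} {t : R →+ R'}

theorem lie_pull (hbr : ∀ a b, br (j a) (j b) = j (br' a b))
    (hL : ∀ a r, t (L (j a) r) = L' a (t r)) (a : G') (α : Form G R) (l : List G') :
    lie br' L' a (pull j t α) l = t (lie br L (j a) α (l.map j)) := by
  induction l generalizing α with
  | nil => exact (hL a _).symm
  | cons b l ih =>
    rw [lie_cons, List.map_cons, lie_cons, contract_pull, ih, map_sub, hbr]
    rfl

theorem diff_pull (hbr : ∀ a b, br (j a) (j b) = j (br' a b))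
    (hL : ∀ a r, t (L (j a) r) = L' a (t r)) (α : Form G R) :
    diff br' L' (pull j t α) = pull j t (diff br L α) := by
  refine ext' fun l => ?_
  induction l generalizing α with
  | nil => simp
  | cons a l ih =>
    rw [diff_cons, pull_apply, List.map_cons, diff_cons, contract_pull, ih, lie_pull hbr hL,
      pull_apply, map_sub]

theorem HasDerivationSymbol.pull {k C S S' : Type*} [CommRing k] [CommRing C] [Algebra k C]
    [CommRing S] [CommRing S'] [Algebra S R] [Algebra S' R'] {ι : C →+* S} {ι' : C →+* S'}
    {pair : G → G → C} {pair' : G' → G' → C} {α : Form G R}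
    (hα : HasDerivationSymbol k ι pair α) (hpair : ∀ a b, pair (j a) (j b) = pair' a b)
    (ht : ∀ f r, t (ι f • r) = ι' f • t r) : HasDerivationSymbol k ι' pair' (pull j t α) := by
  obtain ⟨σ, h1, h2⟩ := hα
  refine ⟨fun f => Form.pull j t (σ f), fun u a b v => ?_, fun f g => ?_, fun f g => ?_, fun c => ?_⟩
  · have := congrArg t (h1 (u.map j) (j a) (j b) (v.map j))
    simpa [hpair] using this
  · exact ext' fun l => by simp [h2.map_add]
  · exact ext' fun l => by simp [h2.map_mul, ht]
  · exact ext' fun l => by simp [h2.map_algebraMap]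

theorem IsLastLinear.pull {Γ C S S' : Type*} [Add Γ] [CommRing C] [SMul C Γ]
    [CommRing S] [CommRing S'] [Algebra S R] [Algebra S' R'] {ι : C →+* S} {ι' : C →+* S'}
    {i : Γ → G'} {α : Form G R} (hα : IsLastLinear ι (fun a => j (i a)) α)
    (ht : ∀ f r, t (ι f • r) = ι' f • t r) : IsLastLinear ι' i (pull j t α) :=
  ⟨fun l a b => by simp [hα.map_add], fun l f a => by simp [hα.map_smul, ht]⟩

end Pull

/-! ### Central arguments -/

section Central

variable {G R : Type*} [AddCommGroup G] [Ring R]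

/-- The form vanishes if one of the arguments is zero. -/
def VanishesAtZero (α : Form G R) : Prop := ∀ u v : List G, α (u ++ 0 :: v) = 0

theorem VanishesAtZero.contract {α : Form G R} (h : VanishesAtZero α) (a : G) :
    VanishesAtZero (contract a α) := fun u v => h (a :: u) v

theorem VanishesAtZero.bar {α : Form G R} (h : VanishesAtZero α) : VanishesAtZero (bar α) :=
  fun u v => by rw [bar_apply, h, mul_zero]

theorem VanishesAtZero.contract_zero {α : Form G R} (h : VanishesAtZero α) :
    Form.contract 0 α = 0 := ext' fun l => h [] l

theorem VanishesAtZero.mul {α β : Form G R} (hα : VanishesAtZero α) (hβ : VanishesAtZero β) :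
    VanishesAtZero (α * β) := by
  intro u
  induction u generalizing α β with
  | nil =>
    intro v
    rw [List.nil_append, mul_cons, hα.contract_zero, hβ.contract_zero, zero_mul, mul_zero]
    simp
  | cons a u ih =>
    intro v
    rw [List.cons_append, mul_cons, ih (hα.contract a) hβ, ih hα.bar (hβ.contract a), add_zero]

theorem VanishesAtZero.pow {α : Form G R} (hα : VanishesAtZero α) (m : ℕ) :
    VanishesAtZero (α ^ m) := by
  induction m with
  | zero => intro u v; cases u <;> rfl
  | succ m ih => rw [pow_succ]; exact ih.mul hα

theorem VanishesAtZero.comp {V : Type*} [Ring V] {α : Form G R} (hα : VanishesAtZero α)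
    (t : R →+ V) : VanishesAtZero (Form.comp t α) := fun u v => by simp [hα u v]

variable {br : G → G → G} {L : G → R → R}

/-- Each bracket term in the Lie derivative has the argument `[a, j b] = 0` and drops out. Applied
to parameter directions, where `L_{∂_τ}` becomes `∂_τ` of the value. -/
theorem VanishesAtZero.lie_of_central {Γ : Type*} {j : Γ → G} {a : G}
    (ha : ∀ b, br a (j b) = 0) {α : Form G R} (hα : VanishesAtZero α) (l : List Γ) :
    lie br L a α (l.map j) = L a (α (l.map j)) := by
  induction l generalizing α with
  | nil => rfl
  | cons b l ih =>
    rw [List.map_cons, lie_cons, ih (hα.contract (j b)), ha,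
      show α (0 :: l.map j) = 0 from hα [] (l.map j), sub_zero]
    rfl

end Central

end Form

end Courant

end

noncomputable section

namespace Courant

variable {n : ℕ} {M : Type*} [TopologicalSpace M] [ChartedSpace (EuclideanSpace ℝ (Fin n)) M]
  [IsManifold (𝓡 n) ∞ M]
  {F : Type*} [NormedAddCommGroup F] [NormedSpace ℝ F]
  {E : M → Type*} [TopologicalSpace (TotalSpace F E)] [∀ x, AddCommGroup (E x)]
  [∀ x, Module ℝ (E x)] [∀ x, TopologicalSpace (E x)] [∀ x, IsTopologicalAddGroup (E x)]
  [∀ x, ContinuousSMul ℝ (E x)] [FiberBundle F E] [VectorBundle ℝ F E]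
  [ContMDiffVectorBundle ∞ F E (𝓡 n)]
  [FiniteDimensional ℝ F] [T2Space M]
  {P : Type*} [NormedAddCommGroup P] [NormedSpace ℝ P]


/-! ### Integration over the parameter -/

open MeasureTheory

section Integral

theorem ContDiffOn.integral_of_support {P V : Type*} [NormedAddCommGroup P] [NormedSpace ℝ P]
    [MeasurableSpace P] [BorelSpace P] {μ : Measure P} [IsLocallyFiniteMeasure μ]
    [NormedAddCommGroup V] [NormedSpace ℝ V] {U : Set V} (hU : IsOpen U) {K : Set P}
    (hK : IsCompact K) {g : P × V → ℝ} (hg : ContDiffOn ℝ ∞ g (univ ×ˢ U))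
    (hsupp : ∀ p ∉ K, ∀ v ∈ U, g (p, v) = 0) :
    ContDiffOn ℝ ∞ (fun v => ∫ p, g (p, v) ∂μ) U := by
  -- The integral is the value at `0` of the convolution of the constant `1` with `p ↦ g (-p, v)`.
  have h := contDiffOn_convolution_right_with_param_comp (𝕜 := ℝ) (μ := μ) (n := ⊤)
    (ContinuousLinearMap.mul ℝ ℝ) (s := U) (v := fun _ => (0 : P)) contDiffOn_const
    (f := fun _ => (1 : ℝ)) (g := fun v p => g (-p, v)) (k := (fun p : P => -p) ⁻¹' K) hU
    ((Homeomorph.neg P).isCompact_preimage.2 hK) (fun v p hv hp => hsupp _ hp v hv)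
    (locallyIntegrable_const 1) ?_
  · simpa [convolution] using! h
  · refine ContDiffOn.comp (g := g) (f := fun q : V × P => (-q.2, q.1)) hg ?_ ?_
    · fun_prop
    · rintro ⟨v, p⟩ ⟨hv, -⟩
      exact ⟨mem_univ _, hv⟩

variable [FiniteDimensional ℝ P] [MeasurableSpace P] [BorelSpace P] {μ : Measure P}
  [IsFiniteMeasure μ] {K : Set P}

theorem integrable_of_continuous (hK : IsCompact K) (hμ : μ Kᶜ = 0) {f : P → ℝ}
    (hf : Continuous f) : Integrable f μ := by
  have h : μ.restrict K = μ := Measure.restrict_eq_self_of_ae_mem (by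
    rw [ae_iff]; exact hμ)
  rw [← h]
  exact hf.continuousOn.integrableOn_compact hK

theorem exists_cutoff (hK : IsCompact K) : ∃ ψ : P → ℝ, ContDiff ℝ ∞ ψ ∧ HasCompactSupport ψ ∧
    ∀ p ∈ K, ψ p = 1 := by
  obtain ⟨R, hR, hKR⟩ := hK.isBounded.subset_closedBall_lt 0 (0 : P)
  let ψ : ContDiffBump (0 : P) := ⟨R, R + 1, hR, by linarith⟩
  exact ⟨ψ, ψ.contDiff, ψ.hasCompactSupport, fun p hp => ψ.one_of_mem_closedBall (hKR hp)⟩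

/-- As `μ` is concentrated on `K`, multiplying the integrand by a cut-off equal to `1` on `K` does
not change the integral and gives it compact support in `p`. -/
theorem contMDiff_integral (hK : IsCompact K) (hμ : μ Kᶜ = 0) {f : P × M → ℝ}
    (hf : ContMDiff (𝓘(ℝ, P).prod (𝓡 n)) 𝓘(ℝ, ℝ) ∞ f) :
    ContMDiff (𝓡 n) 𝓘(ℝ, ℝ) ∞ (fun x => ∫ p, f (p, x) ∂μ) := by
  obtain ⟨ψ, hψ, hψc, hψ1⟩ := exists_cutoff (P := P) hK
  have hae : ∀ᵐ p ∂μ, p ∈ K := by rw [ae_iff]; exact hμ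
  have heq : ∀ x, ∫ p, f (p, x) ∂μ = ∫ p, ψ p * f (p, x) ∂μ := fun x =>
    integral_congr_ae (by filter_upwards [hae] with p hp; rw [hψ1 p hp, one_mul])
  intro x₀
  let φ := extChartAt (𝓡 n) x₀
  have hg : ContDiffOn ℝ ∞ (fun q : P × EuclideanSpace ℝ (Fin n) => ψ q.1 * f (q.1, φ.symm q.2))
      (univ ×ˢ φ.target) := by
    rintro ⟨q, v⟩ ⟨-, hv⟩
    have h3 := CourantAlgebroid.contDiffAt_chart hf x₀ q hv
    exact ((hψ.comp contDiff_fst).contDiffAt.mul h3).contDiffWithinAt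
  have h := ContDiffOn.integral_of_support (μ := μ) (isOpen_extChartAt_target x₀) hψc hg
    (fun p hp v _ => by simp [image_eq_zero_of_notMem_tsupport hp])
  have h2 : ContMDiffAt (𝓡 n) 𝓘(ℝ, ℝ) ∞
      ((fun v => ∫ p, ψ p * f (p, φ.symm v) ∂μ) ∘ φ) x₀ := by
    refine ContMDiffAt.comp x₀ (I' := 𝓘(ℝ, EuclideanSpace ℝ (Fin n))) ?_ contMDiffAt_extChartAt
    exact (h.contDiffAt ((isOpen_extChartAt_target x₀).mem_nhds
      (mem_extChartAt_target x₀))).contMDiffAt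
  refine h2.congr_of_eventuallyEq ?_
  filter_upwards [extChartAt_source_mem_nhds (I := 𝓡 n) x₀] with x hx
  rw [heq, Function.comp_apply, φ.left_inv hx]

/-- Differentiation under the integral sign along the straight line with velocity `ρ(a)` in a chart
at `x`. -/
theorem lieDeriv_integral (A : CourantAlgebroid n F E) (hK : IsCompact K) (hμ : μ Kᶜ = 0)
    {f : P × M → ℝ} (hf : ContMDiff (𝓘(ℝ, P).prod (𝓡 n)) 𝓘(ℝ, ℝ) ∞ f) (a : Sections n F E) (x : M) :
    A.lieDeriv a (fun x => ∫ p, f (p, x) ∂μ) x = ∫ p, A.lieDeriv a (fun x => f (p, x)) x ∂μ := by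
  let φ := extChartAt (𝓡 n) x
  let z := φ x
  let w : EuclideanSpace ℝ (Fin n) := A.anchor x (a x)
  let g : P × EuclideanSpace ℝ (Fin n) → ℝ := fun q => f (q.1, φ.symm q.2)
  have hg : ∀ q : P, ∀ v ∈ φ.target, ContDiffAt ℝ ∞ g (q, v) :=
    fun q v hv => CourantAlgebroid.contDiffAt_chart hf x q hv
  have hz : z ∈ φ.target := mem_extChartAt_target x
  have hline : ∀ h : M → ℝ, ContMDiff (𝓡 n) 𝓘(ℝ, ℝ) ∞ h →
      HasDerivAt (fun r : ℝ => h (φ.symm (z + r • w))) (A.lieDeriv a h x) 0 := by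
    intro h hh
    rw [A.lieDeriv_eq_fderiv a (mdifferentiable_of_contMDiff hh x)]
    have h1 : ContDiffAt ℝ ∞ (fun v => h (φ.symm v)) z := by
      have := (hh.contMDiffAt).comp z ((contMDiffOn_extChartAt_symm (I := 𝓡 n) x).contMDiffAt
        ((isOpen_extChartAt_target x).mem_nhds hz))
      exact contMDiffAt_iff_contDiffAt.1 this
    have h2 : HasDerivAt (fun r : ℝ => z + r • w) w 0 := by
      simpa using ((hasDerivAt_id (0 : ℝ)).smul_const w).const_add z
    have h3 : HasFDerivAt (fun v => h (φ.symm v)) (fderiv ℝ (fun v => h (φ.symm v)) z)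
        (z + (0 : ℝ) • w) := by
      rw [zero_smul, add_zero]
      exact (h1.differentiableAt (by simp)).hasFDerivAt
    exact h3.comp_hasDerivAt 0 h2
  have hcont : Continuous fun r : ℝ => z + r • w := by fun_prop
  have hopen : ∀ᶠ r : ℝ in 𝓝 0, z + r • w ∈ φ.target :=
    hcont.continuousAt.eventually_mem (by
      rw [zero_smul, add_zero]; exact (isOpen_extChartAt_target x).mem_nhds hz)
  obtain ⟨ε, hε, hball⟩ := Metric.eventually_nhds_iff_ball.1 hopen
  let G' : P × ℝ → ℝ := fun q => fderiv ℝ g (q.1, z + q.2 • w) (0, w)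
  have hG' : ∀ p, ∀ r ∈ Metric.ball (0 : ℝ) ε,
      HasDerivAt (fun r : ℝ => f (p, φ.symm (z + r • w))) (G' (p, r)) r := by
    intro p r hr
    have h1 : HasFDerivAt g (fderiv ℝ g (p, z + r • w)) (p, z + r • w) :=
      ((hg p _ (hball r hr)).differentiableAt (by simp)).hasFDerivAt
    have h2 : HasDerivAt (fun r : ℝ => (p, z + r • w)) ((0 : P), w) r := by
      have : HasDerivAt (fun r : ℝ => z + r • w) w r := by
        simpa using ((hasDerivAt_id r).smul_const w).const_add z
      exact (hasDerivAt_const r p).prodMk this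
    exact h1.comp_hasDerivAt r h2
  have hGc : ContinuousOn G' (K ×ˢ Metric.closedBall 0 (ε / 2)) := by
    rintro ⟨p, r⟩ ⟨-, hr⟩
    have h1 := (hg p _ (hball r (Metric.closedBall_subset_ball (by linarith) hr))).fderiv_right
      (m := 1) two_le_infty
    have h2 : ContinuousAt (fun q : P × ℝ => (q.1, z + q.2 • w)) (p, r) := by fun_prop
    have h3 : ContinuousAt (fun q : P × ℝ => fderiv ℝ g (q.1, z + q.2 • w)) (p, r) :=
      ContinuousAt.comp (f := fun q : P × ℝ => (q.1, z + q.2 • w)) h1.continuousAt h2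
    exact (h3.clm_apply continuousAt_const).continuousWithinAt
  -- Compactness gives a constant bound on the derivatives, integrable since `μ` is finite. Halving
  -- `ε` keeps the closed ball inside the chart.
  obtain ⟨C, hC⟩ := (hK.prod (isCompact_closedBall (0 : ℝ) (ε / 2))).exists_bound_of_continuousOn hGc
  have hae : ∀ᵐ p ∂μ, p ∈ K := by rw [ae_iff]; exact hμ
  have hfc : ∀ y : M, Continuous fun p => f (p, y) := fun y => (contDiff_time hf y).continuous
  have h0 : ∀ p, G' (p, 0) = A.lieDeriv a (fun x => f (p, x)) x := fun p =>
    (hG' p 0 (Metric.mem_ball_self hε)).unique (hline _ (contMDiff_space hf p))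
  have hmeas : AEStronglyMeasurable (fun p => G' (p, 0)) μ := by
    simp only [h0]
    have := contDiff_time (A.contMDiff_partialAct (a, (0 : P)) hf) x
    simp only [CourantAlgebroid.partialAct, map_zero, zero_add] at this
    exact this.continuous.aestronglyMeasurable
  have key := (hasDerivAt_integral_of_dominated_loc_of_deriv_le (μ := μ)
    (F := fun r p => f (p, φ.symm (z + r • w))) (F' := fun r p => G' (p, r)) (bound := fun _ => C)
    (Metric.ball_mem_nhds (0 : ℝ) (half_pos hε))
    (Filter.Eventually.of_forall fun r => (hfc _).aestronglyMeasurable)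
    (integrable_of_continuous hK hμ (hfc _)) hmeas
    (by
      filter_upwards [hae] with p hp r hr
      exact hC (p, r) ⟨hp, Metric.ball_subset_closedBall hr⟩)
    (integrable_const C)
    (Filter.Eventually.of_forall fun p r hr =>
      hG' p r (Metric.ball_subset_ball (by linarith) hr))).2
  rw [← key.unique (hline _ (contMDiff_integral hK hμ hf))]
  simp only [h0]

variable (μ) in
/-- Integration over the parameter. -/
def timeIntegral (hK : IsCompact K) (hμ : μ Kᶜ = 0) : TimeFun n M P →+ C^∞⟮𝓡 n, M; ℝ⟯ :=
  AddMonoidHom.mk' (fun f => ⟨fun x => ∫ p, f (p, x) ∂μ, contMDiff_integral hK hμ f.contMDiff⟩)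
    fun f g => by
      ext x
      exact integral_add (integrable_of_continuous hK hμ (contDiff_time f.contMDiff x).continuous)
        (integrable_of_continuous hK hμ (contDiff_time g.contMDiff x).continuous)

theorem timeIntegral_apply (hK : IsCompact K) (hμ : μ Kᶜ = 0) (f : TimeFun n M P) (x : M) :
    timeIntegral μ hK hμ f x = ∫ p, f (p, x) ∂μ := rfl

theorem timeIntegral_const_mul (hK : IsCompact K) (hμ : μ Kᶜ = 0) (h : C^∞⟮𝓡 n, M; ℝ⟯)
    (f : TimeFun n M P) :
    timeIntegral μ hK hμ (TimeFun.const P h * f) = h * timeIntegral μ hK hμ f := by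
  ext x
  exact integral_const_mul (h x) _

theorem timeIntegral_act (A : CourantAlgebroid n F E) (hK : IsCompact K) (hμ : μ Kᶜ = 0)
    (a : Sections n F E) (f : TimeFun n M P) :
    timeIntegral μ hK hμ (A.timeAction.act (a, 0) f) = A.lieFun a (timeIntegral μ hK hμ f) := by
  ext x
  refine Eq.trans ?_ (lieDeriv_integral A hK hμ f.contMDiff a x).symm
  rw [timeIntegral_apply]
  congr 1
  funext p
  change A.partialAct (a, 0) f (p, x) = _
  simp [CourantAlgebroid.partialAct]

end Integral

end Courant

end

/-! ### Comparison with cochains and with the Chern–Simons form -/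

noncomputable section

namespace Courant

variable {n : ℕ} {M : Type*} [TopologicalSpace M] [ChartedSpace (EuclideanSpace ℝ (Fin n)) M]
  [IsManifold (𝓡 n) ∞ M]
  {F : Type*} [NormedAddCommGroup F] [NormedSpace ℝ F]
  {E : M → Type*} [TopologicalSpace (TotalSpace F E)] [∀ x, AddCommGroup (E x)]
  [∀ x, Module ℝ (E x)] [∀ x, TopologicalSpace (E x)] [∀ x, IsTopologicalAddGroup (E x)]
  [∀ x, ContinuousSMul ℝ (E x)] [FiberBundle F E] [VectorBundle ℝ F E]
  [ContMDiffVectorBundle ∞ F E (𝓡 n)]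
  [FiniteDimensional ℝ F] [T2Space M]
  {P : Type*} [NormedAddCommGroup P] [NormedSpace ℝ P]


variable {A : CourantAlgebroid n F E}

namespace Form

theorem mul_eq_zero_of_length {G R : Type*} [Ring R] {p q : ℕ} {α β : Form G R}
    (hα : ∀ l, l.length ≠ p → α l = 0) (hβ : ∀ l, l.length ≠ q → β l = 0) {l : List G}
    (hl : l.length ≠ p + q) : (α * β) l = 0 := by
  induction l generalizing p q α β with
  | nil =>
    rw [mul_nil]
    by_cases hp : p = 0
    · rw [hβ [] (by simp at hl ⊢; omega), mul_zero]
    · rw [hα [] (by simp; omega), zero_mul]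
  | cons a l ih =>
    rw [mul_cons]
    have hb : ∀ l, l.length ≠ p → bar α l = 0 := fun l h => by rw [bar_apply, hα l h, mul_zero]
    have h1 : (contract a α * β) l = 0 := by
      cases p with
      | zero =>
        rw [show contract a α = 0 from ext' fun l => hα (a :: l) (by simp), zero_mul]; rfl
      | succ p =>
        exact ih (p := p) (fun l h => hα (a :: l) (by simpa using h)) hβ
          (by simp at hl ⊢; omega)
    have h2 : (bar α * contract a β) l = 0 := by
      cases q with
      | zero =>
        rw [show contract a β = 0 from ext' fun l => hβ (a :: l) (by simp), mul_zero]; rfl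
      | succ q =>
        exact ih (q := q) hb (fun l h => hβ (a :: l) (by simpa using h))
          (by simp at hl ⊢; omega)
    rw [h1, h2, add_zero]

end Form

namespace CourantAlgebroid

/-! ### Forms and cochains -/

theorem isShuffle_iff {p q : ℕ} (ς : Equiv.Perm (Fin (p + q))) :
    ς ∈ shuffles p q ↔ Form.IsShuffle p ς := by
  constructor
  · rintro ⟨h1, h2⟩ i j hij h
    rcases h with h | h
    · have hi : (i : ℕ) < p := lt_trans hij h
      exact h1 (show (⟨i, hi⟩ : Fin p) < ⟨j, h⟩ from hij)
    · have hj : p ≤ (j : ℕ) := h.trans hij.le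
      have := h2 (show (⟨i - p, by omega⟩ : Fin q) < ⟨j - p, by omega⟩ from by
        simp only [Fin.mk_lt_mk]
        have : (i : ℕ) < j := hij
        omega)
      have e1 : Fin.natAdd p (⟨i - p, by omega⟩ : Fin q) = i := Fin.ext (by simp; omega)
      have e2 : Fin.natAdd p (⟨j - p, by omega⟩ : Fin q) = j := Fin.ext (by simp; omega)
      simpa only [e1, e2] using this
  · intro h
    refine ⟨fun i j hij => h _ _ (show (i : ℕ) < j from hij) (Or.inl (by simp)),
      fun i j hij => h _ _ (by simpa using hij) (Or.inr (by simp))⟩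

theorem cup_eq {R : Type*} [Ring R] {p q m : ℕ} (h : p + q = m) (α : (Fin p → Sections n F E) → R)
    (τ : (Fin q → Sections n F E) → R) (e : Fin m → Sections n F E) :
    cup h α τ e = (Form.ofFun α * Form.ofFun τ) (List.ofFn e) := by
  classical
  subst h
  rw [← Form.sum_shuffles rfl α τ e]
  simp only [isShuffle_iff, cup]
  exact Finset.sum_congr (by ext; simp) fun _ _ => rfl

theorem ofFun_cup {R : Type*} [Ring R] {p q m : ℕ} (h : p + q = m)
    (α : (Fin p → Sections n F E) → R) (τ : (Fin q → Sections n F E) → R) :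
    Form.ofFun (cup h α τ) = Form.ofFun α * Form.ofFun τ := by
  rw [← Form.eq_ofFun (p := m) (β := Form.ofFun α * Form.ofFun τ)]
  · congr 1
    funext e
    exact cup_eq h α τ e
  · intro l hl
    exact Form.mul_eq_zero_of_length (fun _ => Form.ofFun_of_length α)
      (fun _ => Form.ofFun_of_length τ) (by rwa [h])

theorem ofFun_curvaturePow (D : A.EConnection) (p : ℕ) :
    Form.ofFun (D.curvaturePow p) = Form.ofFun D.curvature ^ p := by
  induction p with
  | zero =>
    rw [pow_zero]
    refine Form.ext' fun l => ?_
    cases l <;> rfl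
  | succ p ih =>
    rw [pow_succ, ← ih, ← ofFun_cup]
    rfl

/-- Evaluated on a fixed list, a derivation symbol is a derivation of `C^∞(M)`, which is what the
symbol of a cochain requires. -/
theorem isCochain_ofFn {η : Form (Sections n F E) C^∞⟮𝓡 n, M; ℝ⟯}
    (h : Form.HasDerivationSymbol ℝ (RingHom.id C^∞⟮𝓡 n, M; ℝ⟯) A.pairFun η)
    (h' : Form.IsLastLinear (RingHom.id C^∞⟮𝓡 n, M; ℝ⟯) id η) (k : ℕ) :
    A.IsCochain k (fun e x => η (List.ofFn e) x) where
  contMDiff e := (η (List.ofFn e)).contMDiff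
  map_add_last i hi e s t x := by
    obtain ⟨m, rfl⟩ : ∃ m, k = m + 1 := ⟨i, hi.symm⟩
    obtain rfl : i = Fin.last m := Fin.ext (by simpa using hi)
    have := h'.map_add (List.ofFn (Fin.init e)) s t
    simp only [Form.ofFn_update_last]
    exact congrArg (fun f : C^∞⟮𝓡 n, M; ℝ⟯ => f x) this
  map_smul_last i hi e f s x := by
    obtain ⟨m, rfl⟩ : ∃ m, k = m + 1 := ⟨i, hi.symm⟩
    obtain rfl : i = Fin.last m := Fin.ext (by simpa using hi)
    have := h'.map_smul (List.ofFn (Fin.init e)) f s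
    simp only [Form.ofFn_update_last]
    exact congrArg (fun f : C^∞⟮𝓡 n, M; ℝ⟯ => f x) this
  hasSymbol := by
    obtain ⟨σ, h1, h2⟩ := h
    match k with
    | 0 => trivial
    | 1 => trivial
    | k + 2 =>
      refine ⟨fun e => Derivation.mk'
        { toFun := fun f => σ f (List.ofFn e)
          map_add' := fun f g => by rw [h2.map_add]; rfl
          map_smul' := fun c f => by
            rw [Algebra.smul_def, h2.map_mul, h2.map_algebraMap]
            simp [Algebra.smul_def] } fun f g => ?_, fun e i x => ?_⟩
      · change σ (f * g) _ = _
        rw [h2.map_mul]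
        rfl
      · exact congrArg (fun f : C^∞⟮𝓡 n, M; ℝ⟯ => f x) (h1.ofFn e i)

theorem contMDiffMap_sum_apply {ι : Type*} (s : Finset ι) (f : ι → C^∞⟮𝓡 n, M; ℝ⟯) (x : M) :
    (∑ i ∈ s, f i) x = ∑ i ∈ s, f i x := by
  have := congrFun (map_sum (ContMDiffMap.coeFnAddMonoidHom
    (I := 𝓡 n) (I' := 𝓘(ℝ, ℝ)) (N := M) (G := ℝ) (n := ∞)) f s) x
  rw [Finset.sum_apply] at this
  exact this

theorem d_ofFn (η : Form (Sections n F E) C^∞⟮𝓡 n, M; ℝ⟯) (k : ℕ) :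
    A.d k (fun e x => η (List.ofFn e) x) =
      fun e x => Form.diff (fun a b => A.bracket a b) A.lieFun η (List.ofFn e) x := by
  funext e x
  rw [Form.diff_ofFn]
  have hs : ∀ (i : ℕ) (f : C^∞⟮𝓡 n, M; ℝ⟯), ((-1) ^ i * f) x = (-1) ^ i * f x := by
    intro i f
    rcases Nat.even_or_odd i with h | h
    · rw [h.neg_one_pow, h.neg_one_pow, one_mul, one_mul]
    · rw [h.neg_one_pow, h.neg_one_pow, neg_one_mul, neg_one_mul]; rfl
  change _ = (∑ i, _ : C^∞⟮𝓡 n, M; ℝ⟯) x - (∑ i, ∑ j with i < j, _ : C^∞⟮𝓡 n, M; ℝ⟯) x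
  simp only [contMDiffMap_sum_apply, hs]
  rfl

/-! ### Fibrewise formulas -/

theorem fiberEnd_eq {T : Sections n F E → Π x, E x} {x : M} {φ : Module.End ℝ (E x)}
    (h : ∀ s : Sections n F E, φ (s x) = T s x) : fiberEnd T x = φ := by
  have hex : ∃ φ : Module.End ℝ (E x), ∀ s : Sections n F E, φ (s x) = T s x := ⟨φ, h⟩
  rw [fiberEnd, dif_pos hex]
  ext v
  obtain ⟨s, rfl⟩ := exists_section_eq (n := n) (F := F) x v
  rw [hex.choose_spec, h]

/-- The curvature at `x` as a form with values in the endomorphisms of the fibre. -/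
def curvForm (D : A.EConnection) (x : M) : Form (Sections n F E) (Module.End ℝ (E x)) :=
  Form.ofFun fun e => D.curvature e x

theorem evalHom_ofFun {p : ℕ} (α : (Fin p → Sections n F E) → Π x, Module.End ℝ (E x)) (x : M) :
    Form.mapHom id (Pi.evalRingHom (fun x => Module.End ℝ (E x)) x) (Form.ofFun α) =
      Form.ofFun fun e => α e x := by
  refine Form.ext' fun l => ?_
  rw [Form.mapHom_apply, List.map_id]
  by_cases h : l.length = p
  · subst h
    simp [Form.ofFun]
  · rw [Form.ofFun_of_length _ h, Form.ofFun_of_length _ h, map_zero]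

/-- Evaluation at `x` is a ring homomorphism on families of endomorphisms, so it commutes with the
shuffle product. -/
theorem cup_curvaturePow_apply {m k : ℕ} (h : 1 + 2 * k = m)
    (V : (Fin 1 → Sections n F E) → Π x, Module.End ℝ (E x)) (D : A.EConnection)
    (e : Fin m → Sections n F E) (x : M) :
    cup h V (D.curvaturePow k) e x =
      (Form.ofFun (fun e => V e x) * curvForm D x ^ k) (List.ofFn e) := by
  rw [cup_eq, ofFun_curvaturePow, ← evalHom_ofFun, curvForm, ← evalHom_ofFun, ← map_pow, ← map_mul,
    Form.mapHom_apply, List.map_id]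
  rfl

section Family

variable {Δ : P → A.EConnection} (hΔ : IsSmoothFamily Δ)

/-- Along `Γ(E)` the curvature contains no parameter derivatives, so at time `p` it is that of `Δ
p`. -/
theorem mapHom_curv (p : P) (x : M) :
    Form.mapHom (fun a : Sections n F E => (a, (0 : P))) (fibHom (p, x))
      (familyConnection hΔ).curv = curvForm (Δ p) x := by
  refine Form.ext' fun l => ?_
  rw [Form.mapHom_apply]
  by_cases h : l.length = 2
  · obtain ⟨a, b, rfl⟩ := List.length_eq_two.1 h
    have h1 : curvForm (Δ p) x [a, b] = (Δ p).curvature ![a, b] x :=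
      Form.ofFun_ofFn (fun e => (Δ p).curvature e x) ![a, b]
    rw [h1]
    symm
    refine fiberEnd_eq fun s => ?_
    exact fib_curvEnd_apply hΔ a b s (p, x)
  · rw [LeibnizConnection.curv_of_length _ (by simpa using h), map_zero]
    exact (Form.ofFun_of_length _ h).symm

theorem chern_apply (k : ℕ) (l : List (Sections n F E)) (p : P) (x : M) :
    (familyConnection hΔ).chern (A.timeTrace P).toAddMonoidHom k (l.map fun a => (a, (0 : P)))
      (p, x) = LinearMap.trace ℝ (E x) ((curvForm (Δ p) x ^ k) l) := by
  rw [← mapHom_curv hΔ, ← map_pow, Form.mapHom_apply]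
  rfl

/-- Contraction puts the velocity in place of one curvature factor. It is left as any `φ` with the
right pairings, which allows for reparametrised paths and for curves in `P`. -/
theorem contract_chern_apply {p : P} {τ : P} {x : M} {φ : Sections n F E → Module.End ℝ (E x)}
    (hφ : ∀ a s t : Sections n F E, A.pairing x (φ a (s x)) (t x) =
      fderiv ℝ (fun q => A.pairing x (Δ q a s x) (t x)) p τ)
    (k : ℕ) (l : List (Sections n F E)) :
    Form.contract (0, τ) ((familyConnection hΔ).chern (A.timeTrace P).toAddMonoidHom (k + 1))
      (l.map fun a => (a, (0 : P))) (p, x) = (k + 1) * LinearMap.trace ℝ (E x)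
        ((Form.ofFun (fun e : Fin 1 → Sections n F E => φ (e 0)) * curvForm (Δ p) x ^ k) l) := by
  have h1 : Form.mapHom (fun a : Sections n F E => (a, (0 : P))) (fibHom (p, x))
      (Form.contract (0, τ) (familyConnection hΔ).curv) =
        Form.ofFun (fun e : Fin 1 → Sections n F E => φ (e 0)) := by
    refine Form.ext' fun l => ?_
    rw [Form.mapHom_apply]
    by_cases h : l.length = 1
    · obtain ⟨a, rfl⟩ := List.length_eq_one_iff.1 h
      have h1 : Form.ofFun (fun e : Fin 1 → Sections n F E => φ (e 0)) [a] = φ a :=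
        Form.ofFun_ofFn (fun e : Fin 1 → Sections n F E => φ (e 0)) ![a]
      rw [h1]
      ext v
      obtain ⟨s, rfl⟩ := exists_section_eq (n := n) (F := F) x v
      refine A.eq_of_pairing fun w => ?_
      obtain ⟨t, rfl⟩ := exists_section_eq (n := n) (F := F) x w
      rw [hφ]
      exact pairing_fib_curvEnd_time hΔ τ a s t (p, x)
    · rw [Form.contract_apply, LeibnizConnection.curv_of_length _ (by simpa using h), map_zero]
      exact (Form.ofFun_of_length _ h).symm
  rw [LeibnizConnection.contract_chern _ _ fun T U => timeTrace_mul_comm T U, ← mapHom_curv hΔ,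
    ← h1, ← map_pow, ← map_mul, Form.mapHom_apply]
  have h2 : ∀ (m : ℕ) (f : TimeFun n M P) y, (m • f) y = m * f y := by
    intro m f y
    induction m with
    | zero => simp
    | succ m ih => rw [succ_nsmul]; change (m • f) y + f y = _; rw [ih]; push_cast; ring
  rw [h2]
  push_cast
  rfl

end Family

end CourantAlgebroid

end Courant

end

noncomputable section

namespace Courant

variable {n : ℕ} {M : Type*} [TopologicalSpace M] [ChartedSpace (EuclideanSpace ℝ (Fin n)) M]
  [IsManifold (𝓡 n) ∞ M]
  {F : Type*} [NormedAddCommGroup F] [NormedSpace ℝ F]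
  {E : M → Type*} [TopologicalSpace (TotalSpace F E)] [∀ x, AddCommGroup (E x)]
  [∀ x, Module ℝ (E x)] [∀ x, TopologicalSpace (E x)] [∀ x, IsTopologicalAddGroup (E x)]
  [∀ x, ContinuousSMul ℝ (E x)] [FiberBundle F E] [VectorBundle ℝ F E]
  [ContMDiffVectorBundle ∞ F E (𝓡 n)]
  [FiniteDimensional ℝ F] [T2Space M]
  {P : Type*} [NormedAddCommGroup P] [NormedSpace ℝ P]


variable {A : CourantAlgebroid n F E}

open MeasureTheory

/-! ### Derivatives of curves in the fibres -/

/-- The fibres of `E` carry a vector space topology but no chosen norm, so the chain rule for a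
continuous linear map is used in topological vector spaces. -/
theorem HasFDerivWithinAt.clm_comp_tvs {V W X : Type*} [AddCommGroup V] [Module ℝ V]
    [TopologicalSpace V] [AddCommGroup W] [Module ℝ W] [TopologicalSpace W]
    [AddCommGroup X] [Module ℝ X] [TopologicalSpace X] {f : X → V} {f' : X →L[ℝ] V}
    {s : Set X} {x : X} (h : HasFDerivWithinAt f f' s x) (ℓ : V →L[ℝ] W) :
    HasFDerivWithinAt (fun y => ℓ (f y)) (ℓ ∘L f') s x := by
  refine .of_isLittleOTVS ((ℓ.isBigOTVS_comp.trans_isLittleOTVS h.isLittleOTVS).congr_left ?_)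
  intro y
  simp

/-! ### Reparametrisation -/

/-- A smooth map of the real line onto `[0, 1]` that increases from `0` to `1` on `[0, 1]`. -/
def ramp (u : ℝ) : ℝ := (1 - Real.cos (Real.pi * u)) / 2

@[simp] theorem ramp_zero : ramp 0 = 0 := by simp [ramp]

@[simp] theorem ramp_one : ramp 1 = 1 := by norm_num [ramp]

theorem ramp_mem (u : ℝ) : ramp u ∈ Icc (0 : ℝ) 1 := by
  have h1 := Real.cos_le_one (Real.pi * u)
  have h2 := Real.neg_one_le_cos (Real.pi * u)
  constructor <;> simp only [ramp] <;> linarith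

theorem contDiff_ramp : ContDiff ℝ ∞ ramp := by
  unfold ramp
  fun_prop

theorem hasDerivAt_ramp (u : ℝ) : HasDerivAt ramp (Real.pi * Real.sin (Real.pi * u) / 2) u := by
  have h1 : HasDerivAt (fun u => Real.pi * u) Real.pi u := by
    simpa using (hasDerivAt_id u).const_mul Real.pi
  have h2 := (((Real.hasDerivAt_cos _).comp u h1).const_sub 1).div_const 2
  refine h2.congr_deriv ?_
  ring

theorem deriv_ramp_nonneg {u : ℝ} (hu : u ∈ Icc (0 : ℝ) 1) :
    0 ≤ Real.pi * Real.sin (Real.pi * u) / 2 := by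
  have := Real.sin_nonneg_of_nonneg_of_le_pi (mul_nonneg Real.pi_pos.le hu.1)
    (mul_le_of_le_one_right Real.pi_pos.le hu.2)
  have := Real.pi_pos
  positivity

theorem injOn_ramp : InjOn ramp (Icc 0 1) := by
  intro u hu v hv h
  have hm : ∀ w ∈ Icc (0 : ℝ) 1, Real.pi * w ∈ Icc 0 Real.pi := fun w hw =>
    ⟨mul_nonneg Real.pi_pos.le hw.1, mul_le_of_le_one_right Real.pi_pos.le hw.2⟩
  have h1 : Real.cos (Real.pi * u) = Real.cos (Real.pi * v) := by
    simp only [ramp] at h; linarith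
  exact mul_left_cancel₀ Real.pi_pos.ne' (Real.injOn_cos (hm u hu) (hm v hv) h1)

theorem image_ramp : ramp '' Icc 0 1 = Icc 0 1 := by
  refine Subset.antisymm (image_subset_iff.2 fun u _ => ramp_mem u) ?_
  have := intermediate_value_Icc (f := ramp) zero_le_one contDiff_ramp.continuous.continuousOn
  simpa using this

/-- Substitution of `ramp` in an integral. No regularity of the integrand is needed. -/
theorem integral_ramp (g : ℝ → ℝ) :
    ∫ t in (0 : ℝ)..1, g t =
      ∫ u in Icc (0 : ℝ) 1, Real.pi * Real.sin (Real.pi * u) / 2 * g (ramp u) := by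
  rw [intervalIntegral.integral_of_le zero_le_one, ← integral_Icc_eq_integral_Ioc]
  conv_lhs => rw [← image_ramp]
  rw [integral_image_eq_integral_abs_deriv_smul measurableSet_Icc
    (fun u _ => (hasDerivAt_ramp u).hasDerivWithinAt) injOn_ramp]
  refine setIntegral_congr_fun measurableSet_Icc fun u hu => ?_
  simp only [abs_of_nonneg (deriv_ramp_nonneg hu), smul_eq_mul]

namespace CourantAlgebroid

/-! ### Smooth paths of connections -/

theorem IsSmoothPath.contMDiffOn_pairing {γ : ℝ → A.EConnection} {D₀ D₁ : A.EConnection}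
    (hγ : IsSmoothPath γ D₀ D₁) (a b s : Sections n F E) :
    ContMDiffOn (𝓘(ℝ, ℝ).prod (𝓡 n)) 𝓘(ℝ, ℝ) ∞
      (fun y : ℝ × M => A.pairing y.2 (γ y.1 a b y.2) (s y.2)) (Icc 0 1 ×ˢ univ) := by
  have h1 : ContMDiff (𝓘(ℝ, ℝ).prod (𝓡 n)) ((𝓡 n).prod 𝓘(ℝ, F →L[ℝ] F →L[ℝ] ℝ)) ∞
      (fun y : ℝ × M => TotalSpace.mk' (F →L[ℝ] F →L[ℝ] ℝ)
        (E := fun x => E x →L[ℝ] E x →L[ℝ] Bundle.Trivial M ℝ x) y.2 (A.pairing y.2)) :=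
    A.contMDiff_pairing.comp contMDiff_snd
  have h2 : ContMDiff (𝓘(ℝ, ℝ).prod (𝓡 n)) ((𝓡 n).prod 𝓘(ℝ, F)) ∞
      (fun y : ℝ × M => TotalSpace.mk' F y.2 (s y.2)) := s.contMDiff.comp contMDiff_snd
  have h := ContMDiffOn.clm_bundle_apply₂ (F₁ := F) (F₂ := F) (F₃ := ℝ)
    (E₃ := Bundle.Trivial M ℝ) h1.contMDiffOn (hγ.contMDiffOn a b) h2.contMDiffOn
  intro y hy
  exact (Bundle.contMDiffWithinAt_totalSpace.1 (h y hy)).2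

/-- A path is controlled only over `[0, 1]`. Composed with a smooth function into `[0, 1]`, such as
`ramp`, it becomes a family on the whole parameter space. -/
theorem IsSmoothPath.isSmoothFamily {γ : ℝ → A.EConnection} {D₀ D₁ : A.EConnection}
    (hγ : IsSmoothPath γ D₀ D₁) {κ : P → ℝ} (hκ : ContDiff ℝ ∞ κ)
    (hmem : ∀ p, κ p ∈ Icc (0 : ℝ) 1) :
    IsSmoothFamily (fun p => γ (κ p)) := by
  intro a b s
  have h : ContMDiff (𝓘(ℝ, P).prod (𝓡 n)) (𝓘(ℝ, ℝ).prod (𝓡 n)) ∞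
      (fun y : P × M => (κ y.1, y.2)) :=
    (hκ.contMDiff.comp contMDiff_fst).prodMk contMDiff_snd
  rw [← contMDiffOn_univ] at h ⊢
  exact (hγ.contMDiffOn_pairing a b s).comp h fun y _ => ⟨hmem y.1, mem_univ _⟩

theorem IsSmoothPath.differentiableWithinAt_pairing {γ : ℝ → A.EConnection} {D₀ D₁ : A.EConnection}
    (hγ : IsSmoothPath γ D₀ D₁) (a b s : Sections n F E) (x : M) {t : ℝ} (ht : t ∈ Icc (0 : ℝ) 1) :
    DifferentiableWithinAt ℝ (fun r => A.pairing x (γ r a b x) (s x)) (Icc 0 1) t := by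
  have h1 : ContMDiffOn 𝓘(ℝ, ℝ) (𝓘(ℝ, ℝ).prod (𝓡 n)) ∞ (fun r : ℝ => (r, x)) (Icc 0 1) :=
    (contMDiff_id.prodMk contMDiff_const).contMDiffOn
  have h2 := (hγ.contMDiffOn_pairing a b s).comp h1 fun r hr => ⟨hr, mem_univ _⟩
  exact (contMDiffOn_iff_contDiffOn.1 h2).differentiableOn (by simp) t ht

theorem IsSmoothPath.pairing_derivWithin {γ : ℝ → A.EConnection} {D₀ D₁ : A.EConnection}
    (hγ : IsSmoothPath γ D₀ D₁) (a b s : Sections n F E) (x : M) {t : ℝ} (ht : t ∈ Icc (0 : ℝ) 1) :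
    A.pairing x (derivWithin (fun r => γ r a b x) (Icc 0 1) t) (s x) =
      derivWithin (fun r => A.pairing x (γ r a b x) (s x)) (Icc 0 1) t := by
  obtain ⟨f⟩ := A.nonempty_dualFrame x
  let c : ℝ → f.ι → ℝ := fun r i => A.pairing x (γ r a b x) (f.s' i x)
  have hc : DifferentiableWithinAt ℝ c (Icc 0 1) t :=
    differentiableWithinAt_pi.2 fun i => hγ.differentiableWithinAt_pairing a b (f.s' i) x ht
  -- A dual frame recovers the curve in the fibre from finitely many scalar functions; this gives
  -- its differentiability.
  let ℓ : (f.ι → ℝ) →L[ℝ] E x :=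
    ⟨∑ i, LinearMap.smulRight (LinearMap.proj i) (f.s i x), by
      simp only [AddHom.toFun_eq_coe, LinearMap.coe_toAddHom]
      fun_prop⟩
  have hℓ : (fun r => ℓ (c r)) = fun r => γ r a b x := by
    funext r
    have h1 : ℓ (c r) = ∑ i, c r i • f.s i x := by
      change (∑ i, LinearMap.smulRight (LinearMap.proj i) (f.s i x) : (f.ι → ℝ) →ₗ[ℝ] E x) (c r) = _
      simp only [LinearMap.sum_apply, LinearMap.smulRight_apply, LinearMap.proj_apply]
    have h2 := f.expand x (γ r a b x)
    rw [f.χ_self, one_smul] at h2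
    rw [h1, h2]
    simp only [c, A.pairing_symm x (f.s' _ x)]
  have hd : DifferentiableWithinAt ℝ (fun r => γ r a b x) (Icc 0 1) t := by
    rw [← hℓ]
    exact ⟨_, HasFDerivWithinAt.clm_comp_tvs hc.hasFDerivWithinAt ℓ⟩
  have h := HasFDerivWithinAt.clm_comp_tvs hd.hasFDerivWithinAt (A.pairing x (s x))
  simp only [A.pairing_symm x _ (s x)]
  have h2 := h.fderivWithin (uniqueDiffOn_Icc_zero_one t ht)
  exact (congrArg (fun L : ℝ →L[ℝ] ℝ => L 1) h2).symm

theorem IsSmoothPath.pairing_velocity {γ : ℝ → A.EConnection} {D₀ D₁ : A.EConnection}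
    (hγ : IsSmoothPath γ D₀ D₁) (e : Fin 1 → Sections n F E) (b s : Sections n F E) (x : M) {t : ℝ}
    (ht : t ∈ Icc (0 : ℝ) 1) :
    A.pairing x (velocity γ t e x (b x)) (s x) =
      derivWithin (fun r => A.pairing x (γ r (e 0) b x) (s x)) (Icc 0 1) t := by
  have hu := uniqueDiffOn_Icc_zero_one t ht
  have hd := fun b s => hγ.differentiableWithinAt_pairing (e 0) b s x ht
  obtain ⟨φ, hφ⟩ := exists_fiber_map (n := n) (F := F) (E := E) x
    (fun b => derivWithin (fun r => γ r (e 0) b x) (Icc 0 1) t)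
    (fun b b' => by
      refine A.eq_of_pairing fun w => ?_
      obtain ⟨s, rfl⟩ := exists_section_eq (n := n) (F := F) x w
      rw [map_add, _root_.add_apply, hγ.pairing_derivWithin _ _ _ _ ht,
        hγ.pairing_derivWithin _ _ _ _ ht, hγ.pairing_derivWithin _ _ _ _ ht,
        ← derivWithin_fun_add (hd b s) (hd b' s)]
      simp)
    (fun f b => by
      refine A.eq_of_pairing fun w => ?_
      obtain ⟨s, rfl⟩ := exists_section_eq (n := n) (F := F) x w
      rw [map_smul, _root_.smul_apply, hγ.pairing_derivWithin _ _ _ _ ht,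
        hγ.pairing_derivWithin _ _ _ _ ht, smul_eq_mul, ← derivWithin_const_mul _ (hd b s)]
      simp only [EConnection.leibniz, map_add, map_smul, _root_.add_apply, _root_.smul_apply,
        smul_eq_mul]
      -- The Leibniz term `ρ(e₀)(f) b` does not depend on time, so the velocity is linear over
      -- functions.
      rw [derivWithin_add_const])
  have h : velocity γ t e x = φ := fiberEnd_eq fun b => hφ b
  rw [h, hφ, hγ.pairing_derivWithin _ _ _ _ ht]

/-- After the substitution `t = ramp u`, the Jacobian combines with the velocity of `γ` to the
velocity of `γ ∘ ramp`, and `k` is the factor produced by contracting `tr(F^k)`. -/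
theorem IsSmoothPath.csForm_eq {γ : ℝ → A.EConnection} {D₀ D₁ : A.EConnection}
    (hγ : IsSmoothPath γ D₀ D₁) (hΔ : IsSmoothFamily (fun u : ℝ => γ (ramp u))) (k : ℕ) (hk : 0 < k)
    (e : Fin (2 * k - 1) → Sections n F E) (x : M) :
    csForm k hk γ e x = ∫ u in Icc (0 : ℝ) 1,
      Form.contract (0, (1 : ℝ)) ((familyConnection hΔ).chern (A.timeTrace ℝ).toAddMonoidHom k)
        ((List.ofFn e).map fun a => (a, (0 : ℝ))) (u, x) := by
  obtain ⟨k, rfl⟩ : ∃ m, k = m + 1 := ⟨k - 1, by omega⟩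
  rw [csForm, integral_ramp, ← integral_const_mul]
  refine setIntegral_congr_fun measurableSet_Icc fun u hu => ?_
  have hφ : ∀ a s t : Sections n F E,
      A.pairing x (((Real.pi * Real.sin (Real.pi * u) / 2) • velocity γ (ramp u) ![a] x) (s x)) (t x) =
        fderiv ℝ (fun q => A.pairing x (γ (ramp q) a s x) (t x)) u 1 := by
    intro a s t
    have h1 := (hγ.differentiableWithinAt_pairing a s t x (ramp_mem u)).hasDerivWithinAt
    have h2 : HasDerivAt (fun q => A.pairing x (γ (ramp q) a s x) (t x)) _ u :=
      h1.scomp_hasDerivAt u (hasDerivAt_ramp u) fun q => ramp_mem q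
    rw [fderiv_eq_smul_deriv, h2.deriv, LinearMap.smul_apply, map_smul, _root_.smul_apply,
      hγ.pairing_velocity ![a] s t x (ramp_mem u)]
    simp
  rw [contract_chern_apply hΔ hφ, cup_curvaturePow_apply]
  have h3 : (Form.ofFun fun e : Fin 1 → Sections n F E =>
      (Real.pi * Real.sin (Real.pi * u) / 2) • velocity γ (ramp u) ![e 0] x) =
      (Real.pi * Real.sin (Real.pi * u) / 2) •
        Form.ofFun fun e : Fin 1 → Sections n F E => velocity γ (ramp u) e x := by
    refine Form.ext' fun l => ?_
    rw [Form.smul_apply]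
    by_cases h : l.length = 1
    · obtain ⟨a, rfl⟩ := List.length_eq_one_iff.1 h
      have h1 : ∀ f : (Fin 1 → Sections n F E) → Module.End ℝ (E x),
          Form.ofFun f [a] = f ![a] := fun f => Form.ofFun_ofFn f ![a]
      rw [h1, h1]
      rfl
    · rw [Form.ofFun_of_length _ h, Form.ofFun_of_length _ h, smul_zero]
  rw [h3, Form.smul_mul, Form.smul_apply, map_smul, smul_eq_mul]
  push_cast
  ring

end CourantAlgebroid

end Courant

end

/-! ### Affine combinations, transgression formulas and adjoint families -/

noncomputable section

namespace Courant

variable {n : ℕ} {M : Type*} [TopologicalSpace M] [ChartedSpace (EuclideanSpace ℝ (Fin n)) M]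
  [IsManifold (𝓡 n) ∞ M]
  {F : Type*} [NormedAddCommGroup F] [NormedSpace ℝ F]
  {E : M → Type*} [TopologicalSpace (TotalSpace F E)] [∀ x, AddCommGroup (E x)]
  [∀ x, Module ℝ (E x)] [∀ x, TopologicalSpace (E x)] [∀ x, IsTopologicalAddGroup (E x)]
  [∀ x, ContinuousSMul ℝ (E x)] [FiberBundle F E] [VectorBundle ℝ F E]
  [ContMDiffVectorBundle ∞ F E (𝓡 n)]
  [FiniteDimensional ℝ F] [T2Space M]
  {P : Type*} [NormedAddCommGroup P] [NormedSpace ℝ P]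


variable {A : CourantAlgebroid n F E}

namespace CourantAlgebroid

/-! ### Affine combinations of connections -/

theorem EConnection.ext_apply {D D' : A.EConnection} (h : ∀ a b x, D a b x = D' a b x) : D = D' := by
  obtain ⟨T, _, _⟩ := D
  obtain ⟨T', _, _⟩ := D'
  congr
  ext a b x
  exact h a b x

/-- The connection `D + c (D₁ - D₀)`. -/
def EConnection.shift (D D₁ D₀ : A.EConnection) (c : ℝ) : A.EConnection where
  toFun := D.toFun + c • (D₁.toFun - D₀.toFun)
  leibniz a b f x := by
    change D a (f • b) x + c • (D₁ a (f • b) x - D₀ a (f • b) x) =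
      f x • (D a b x + c • (D₁ a b x - D₀ a b x)) + A.lieDeriv a f x • b x
    rw [D.leibniz, D₁.leibniz, D₀.leibniz, add_sub_add_right_eq_sub, ← smul_sub, smul_comm c,
      smul_add]
    abel
  smul_left a b f := by
    ext x
    change D (f • a) b x + c • (D₁ (f • a) b x - D₀ (f • a) b x) =
      f x • (D a b x + c • (D₁ a b x - D₀ a b x))
    rw [D.smul_left, D₁.smul_left, D₀.smul_left, smul_sections_apply, smul_sections_apply,
      smul_sections_apply, ← smul_sub, smul_comm c, smul_add]

theorem EConnection.shift_apply (D D₁ D₀ : A.EConnection) (c : ℝ) (a b : Sections n F E) (x : M) :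
    D.shift D₁ D₀ c a b x = D a b x + c • (D₁ a b x - D₀ a b x) := rfl

@[simp] theorem EConnection.shift_zero (D D₁ D₀ : A.EConnection) : D.shift D₁ D₀ 0 = D :=
  EConnection.ext_apply fun a b x => by rw [shift_apply, zero_smul, add_zero]

@[simp] theorem EConnection.shift_one (D D₁ : A.EConnection) : D.shift D₁ D 1 = D₁ :=
  EConnection.ext_apply fun a b x => by rw [shift_apply, one_smul, add_sub_cancel]

@[simp] theorem EConnection.shift_self (D D₁ : A.EConnection) (c : ℝ) : D.shift D₁ D₁ c = D :=
  EConnection.ext_apply fun a b x => by rw [shift_apply, sub_self, smul_zero, add_zero]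

theorem EConnection.PreservesPairing.shift {D D₁ D₀ : A.EConnection} (h : D.PreservesPairing)
    (h₁ : D₁.PreservesPairing) (h₀ : D₀.PreservesPairing) (c : ℝ) :
    (D.shift D₁ D₀ c).PreservesPairing := by
  intro e v w x
  have e1 := h e v w x
  have e2 := h₁ e v w x
  have e3 := h₀ e v w x
  simp only [shift_apply, map_add, map_smul, map_sub, _root_.add_apply, _root_.smul_apply,
    _root_.sub_apply, smul_eq_mul]
  linear_combination e1 + c * (e2 - e3)

theorem IsSmoothFamily.shift {Δ Δ₁ Δ₀ : P → A.EConnection} (h : IsSmoothFamily Δ)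
    (h₁ : IsSmoothFamily Δ₁) (h₀ : IsSmoothFamily Δ₀) {c : P → ℝ} (hc : ContDiff ℝ ∞ c) :
    IsSmoothFamily fun p => (Δ p).shift (Δ₁ p) (Δ₀ p) (c p) := by
  intro a b s
  have hc' : ContMDiff (𝓘(ℝ, P).prod (𝓡 n)) 𝓘(ℝ, ℝ) ∞ (fun y : P × M => c y.1) :=
    hc.contMDiff.comp contMDiff_fst
  refine ((h a b s).add (hc'.mul ((h₁ a b s).sub (h₀ a b s)))).congr fun y => ?_
  simp only [EConnection.shift_apply, map_add, map_smul, map_sub, _root_.add_apply,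
    _root_.smul_apply, _root_.sub_apply, smul_eq_mul]
  rfl

theorem IsSmoothFamily.comp {Q : Type*} [NormedAddCommGroup Q] [NormedSpace ℝ Q]
    {Δ : P → A.EConnection} (h : IsSmoothFamily Δ) {κ : Q → P} (hκ : ContDiff ℝ ∞ κ) :
    IsSmoothFamily fun q => Δ (κ q) := fun a b s =>
  (h a b s).comp ((hκ.contMDiff.comp contMDiff_fst).prodMk contMDiff_snd)

theorem isSmoothFamily_const (D : A.EConnection) : IsSmoothFamily fun _ : P => D :=
  fun a b s => (A.pairFun (D a b) s).contMDiff.comp contMDiff_snd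

theorem exists_isSmoothPath (D₀ D₁ : A.EConnection) : ∃ γ, IsSmoothPath γ D₀ D₁ := by
  refine ⟨fun t => D₀.shift D₁ D₀ t, fun a b => ContMDiff.contMDiffOn fun y => ?_,
    D₀.shift_zero D₁ D₀, D₀.shift_one D₁⟩
  have hs : ∀ s : Sections n F E, ContMDiffAt (𝓘(ℝ, ℝ).prod (𝓡 n)) ((𝓡 n).prod 𝓘(ℝ, F)) ∞
      (fun p : ℝ × M => TotalSpace.mk' F p.2 (s p.2)) y := fun s =>
    (s.contMDiff.comp contMDiff_snd).contMDiffAt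
  rw [Bundle.contMDiffAt_totalSpace]
  refine ⟨contMDiff_snd.contMDiffAt, ?_⟩
  have h0 := (Bundle.contMDiffAt_totalSpace.1 (hs (D₀ a b))).2
  have h1 := (Bundle.contMDiffAt_totalSpace.1 (hs (D₁ a b))).2
  have ht : ContMDiffAt (𝓘(ℝ, ℝ).prod (𝓡 n)) 𝓘(ℝ, ℝ) ∞ (fun p : ℝ × M => p.1) y :=
    contMDiff_fst.contMDiffAt
  -- The affine path is affine also in a trivialisation, which is linear on the fibres over its base
  -- set.
  refine (h0.add (ht.smul (h1.sub h0))).congr_of_eventuallyEq ?_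
  have hU : ∀ᶠ p : ℝ × M in 𝓝 y, p.2 ∈ (trivializationAt F E y.2).baseSet :=
    continuous_snd.continuousAt ((trivializationAt F E y.2).open_baseSet.mem_nhds
      (FiberBundle.mem_baseSet_trivializationAt F E y.2))
  filter_upwards [hU] with p hp
  have hl := (trivializationAt F E y.2).linear ℝ hp
  change (trivializationAt F E y.2 ⟨p.2, D₀ a b p.2 + p.1 • (D₁ a b p.2 - D₀ a b p.2)⟩).2 =
    (trivializationAt F E y.2 ⟨p.2, D₀ a b p.2⟩).2 + p.1 •
      ((trivializationAt F E y.2 ⟨p.2, D₁ a b p.2⟩).2 - (trivializationAt F E y.2 ⟨p.2, D₀ a b p.2⟩).2)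
  rw [hl.map_add, hl.map_smul, hl.map_sub]

/-! ### Chern forms of families -/

variable {Δ : P → A.EConnection} (hΔ : IsSmoothFamily Δ)

/-- The form `tr(F^k)` of a smooth family of connections, regarded as a connection over `P × M`. -/
abbrev familyChern (k : ℕ) : Form (Sections n F E × P) (TimeFun n M P) :=
  (familyConnection hΔ).chern (A.timeTrace P).toAddMonoidHom k

theorem timeTrace_smul (f : TimeFun n M P) (T : Module.End (TimeFun n M P) (A.TimeSec P)) :
    (A.timeTrace P).toAddMonoidHom (f • T) = f * (A.timeTrace P).toAddMonoidHom T :=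
  map_smul (A.timeTrace P) f T

theorem hasDerivationSymbol_familyChern (k : ℕ) :
    Form.HasDerivationSymbol ℝ (constHom P) (fun u v : Sections n F E × P => A.pairFun u.1 v.1)
      (familyChern hΔ k) :=
  ((hasDerivationSymbol_familyCurv hΔ).pow k).comp _ timeTrace_smul

theorem isLastLinear_familyChern (k : ℕ) :
    Form.IsLastLinear (constHom (n := n) (M := M) P) (fun a : Sections n F E => (a, (0 : P)))
      (familyChern hΔ k) :=
  ((isLastLinear_familyCurv hΔ).pow k).comp _ timeTrace_smul

theorem bracket_zero_left (a : Sections n F E) : A.bracket 0 a = 0 := by simp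

theorem bracket_zero_right (a : Sections n F E) : A.bracket a 0 = 0 := by simp

theorem vanishesAtZero_curv (D : LeibnizConnection (A.timeAction (P := P)) (A.TimeSec P)) :
    Form.VanishesAtZero D.curv := by
  intro u v
  by_cases h : (u ++ (0 : Sections n F E × P) :: v).length = 2
  · match u, v with
    | [], [b] =>
      ext1 w
      have h1 : (A.timeAction (P := P)).br 0 b = 0 := Prod.ext (A.bracket_zero_left b.1) rfl
      simp [h1]
    | [b], [] =>
      ext1 w
      have h1 : (A.timeAction (P := P)).br b 0 = 0 := Prod.ext (A.bracket_zero_right b.1) rfl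
      simp [h1]
    | [], [] => simp at h
    | [], _ :: _ :: _ => simp at h
    | [_], _ :: _ => simp at h
    | _ :: _ :: _, _ => simp at h
  · exact D.curv_of_length h

theorem vanishesAtZero_familyChern (k : ℕ) :
    Form.VanishesAtZero (familyChern hΔ k) :=
  ((vanishesAtZero_curv _).pow k).comp _

end CourantAlgebroid

end Courant

end

noncomputable section

namespace Courant

variable {n : ℕ} {M : Type*} [TopologicalSpace M] [ChartedSpace (EuclideanSpace ℝ (Fin n)) M]
  [IsManifold (𝓡 n) ∞ M]
  {F : Type*} [NormedAddCommGroup F] [NormedSpace ℝ F]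
  {E : M → Type*} [TopologicalSpace (TotalSpace F E)] [∀ x, AddCommGroup (E x)]
  [∀ x, Module ℝ (E x)] [∀ x, TopologicalSpace (E x)] [∀ x, IsTopologicalAddGroup (E x)]
  [∀ x, ContinuousSMul ℝ (E x)] [FiberBundle F E] [VectorBundle ℝ F E]
  [ContMDiffVectorBundle ∞ F E (𝓡 n)]
  [FiniteDimensional ℝ F] [T2Space M]
  {P : Type*} [NormedAddCommGroup P] [NormedSpace ℝ P]


variable {A : CourantAlgebroid n F E}

open MeasureTheory

namespace LeibnizConnection

/-- The forms `tr(F^k)` of connections that agree along `Γ` agree along `Γ`. -/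
theorem chern_map_of_agree {G S V Γ : Type*} [AddCommGroup G] [CommRing S]
    {𝒜 : LeibnizAction G S} [AddCommGroup V] [Module S V] {D D' : LeibnizConnection 𝒜 V} {j : Γ → G}
    (tr : Module.End S V →+ S) (hj : ∀ a, D (j a) = D' (j a))
    (hbr : ∀ a b, ∃ c, 𝒜.br (j a) (j b) = j c) (k : ℕ) (l : List Γ) :
    D.chern tr k (l.map j) = D'.chern tr k (l.map j) := by
  let φ : Form G (Module.End S V) →+* Form Γ (Module.End S V) := Form.mapHom j (RingHom.id _)
  have hφ : ∀ α l, φ α l = α (l.map j) := fun _ _ => rfl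
  have h1 : φ D.curv = φ D'.curv := by
    refine Form.ext' fun l => ?_
    rw [hφ, hφ]
    by_cases hl : l.length = 2
    · obtain ⟨a, b, rfl⟩ := List.length_eq_two.1 hl
      obtain ⟨c, hc⟩ := hbr a b
      ext v
      simp [hj, hc]
    · rw [D.curv_of_length (by simpa using hl), D'.curv_of_length (by simpa using hl)]
  change tr ((D.curv ^ k) (l.map j)) = tr ((D'.curv ^ k) (l.map j))
  rw [← hφ, ← hφ, map_pow, map_pow, h1]

end LeibnizConnection

namespace CourantAlgebroid

variable {Δ : P → A.EConnection} (hΔ : IsSmoothFamily Δ)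

/-! ### The transgression formulas -/

theorem act_section_time (a : Sections n F E) (f : TimeFun n M P) (y : P × M) :
    A.timeAction.act (a, 0) f y = A.lieDeriv a (fun x => f (y.1, x)) y.2 := by
  change fderiv ℝ (fun p => f (p, y.2)) y.1 0 + A.lieDeriv a (fun x => f (y.1, x)) y.2 = _
  rw [map_zero, zero_add]

theorem act_time (τ : P) (f : TimeFun n M P) (y : P × M) :
    A.timeAction.act (0, τ) f y = fderiv ℝ (fun p => f (p, y.2)) y.1 τ := by
  change fderiv ℝ (fun p => f (p, y.2)) y.1 τ + A.lieDeriv 0 (fun x => f (y.1, x)) y.2 = _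
  rw [A.lieDeriv_zero_left, add_zero]

theorem br_time (τ : P) (a : Sections n F E) :
    (A.timeAction (P := P)).br (0, τ) (a, 0) = 0 := Prod.ext (A.bracket_zero_left a) rfl

theorem diff_familyChern (k : ℕ) : Form.diff (A.timeAction (P := P)).br A.timeAction.act
    (familyChern hΔ (k + 1)) = 0 :=
  (familyConnection hΔ).diff_chern _ (timeTrace_ad (familyConnection hΔ)) k

/-- `∂_τ tr(F^k) = d ι_τ tr(F^k)`. -/
theorem diff_contract_familyChern (k : ℕ) (τ : P) (l : List (Sections n F E)) :
    Form.diff (A.timeAction (P := P)).br A.timeAction.act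
      (Form.contract (0, τ) (familyChern hΔ (k + 1))) (l.map fun a => (a, (0 : P))) =
      A.timeAction.act (0, τ) (familyChern hΔ (k + 1) (l.map fun a => (a, (0 : P)))) := by
  have h := congrArg (fun α => α ((0, τ) :: l.map fun a => (a, (0 : P)))) (diff_familyChern hΔ k)
  simp only [Form.diff_cons, Form.zero_apply] at h
  -- Cartan's formula for the closed form `tr(F^k)`, with the Lie derivative reduced to `∂_τ`.
  rw [(vanishesAtZero_familyChern hΔ (k + 1)).lie_of_central (br_time τ), sub_eq_zero] at h
  exact h.symm

/-- `∂_σ ι_τ tr(F^k) - ∂_τ ι_σ tr(F^k) + d ι_τ ι_σ tr(F^k) = 0`. -/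
theorem diff_contract_contract_familyChern (k : ℕ) (σ τ : P) (l : List (Sections n F E)) :
    A.timeAction.act (0, σ) (Form.contract (0, τ) (familyChern hΔ (k + 1))
        (l.map fun a => (a, (0 : P)))) -
      A.timeAction.act (0, τ) (Form.contract (0, σ) (familyChern hΔ (k + 1))
        (l.map fun a => (a, (0 : P)))) +
      Form.diff (A.timeAction (P := P)).br A.timeAction.act
        (Form.contract (0, τ) (Form.contract (0, σ) (familyChern hΔ (k + 1))))
        (l.map fun a => (a, (0 : P))) = 0 := by
  have hv := vanishesAtZero_familyChern hΔ (k + 1)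
  have h := congrArg (fun α => α ((0, σ) :: (0, τ) :: l.map fun a => (a, (0 : P))))
    (diff_familyChern hΔ k)
  -- Parameter directions also commute with each other, so no bracket term survives when both are
  -- contracted.
  have hbr : (A.timeAction (P := P)).br (0, σ) (0, τ) = 0 := Prod.ext (A.bracket_zero_left 0) rfl
  simp only [Form.diff_cons, Form.lie_cons, hbr, Form.zero_apply] at h
  have h0 : familyChern hΔ (k + 1) (0 :: l.map fun a => (a, (0 : P))) = 0 := hv [] _
  rw [(hv.contract _).lie_of_central (br_time σ), (hv.contract _).lie_of_central (br_time τ),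
    h0] at h
  rw [← h]
  abel

theorem familyChern_apply (k : ℕ) (l : List (Sections n F E)) (p : P) (x : M) :
    familyChern hΔ k (l.map fun a => (a, (0 : P))) (p, x) =
      LinearMap.trace ℝ (E x) ((curvForm (Δ p) x ^ k) l) := chern_apply hΔ k l p x

/-- The contraction of `tr(F^k)` with a tangent vector of the parameter space depends only on the
restriction of the family to a curve. -/
theorem contract_familyChern_curve {Δ' : ℝ → A.EConnection} (hΔ' : IsSmoothFamily Δ')
    {κ : ℝ → P} (h : ∀ t, Δ' t = Δ (κ t)) {t : ℝ} {τ : P} (hκ : HasDerivAt κ τ t) (k : ℕ)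
    (l : List (Sections n F E)) (x : M) :
    Form.contract (0, (1 : ℝ)) (familyChern hΔ' (k + 1)) (l.map fun a => (a, (0 : ℝ))) (t, x) =
      Form.contract (0, τ) (familyChern hΔ (k + 1)) (l.map fun a => (a, (0 : P))) (κ t, x) := by
  let φ : Sections n F E → Module.End ℝ (E x) := fun a =>
    fib ((familyConnection hΔ).curvEnd (0, τ) (a, 0)) (κ t, x)
  have hφ : ∀ a s s' : Sections n F E, A.pairing x (φ a (s x)) (s' x) =
      fderiv ℝ (fun q => A.pairing x (Δ q a s x) (s' x)) (κ t) τ := fun a s s' =>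
    pairing_fib_curvEnd_time hΔ τ a s s' (κ t, x)
  have hφ' : ∀ a s s' : Sections n F E, A.pairing x (φ a (s x)) (s' x) =
      fderiv ℝ (fun q => A.pairing x (Δ' q a s x) (s' x)) t 1 := by
    intro a s s'
    have h1 : HasDerivAt (fun q => A.pairing x (Δ (κ q) a s x) (s' x))
        (fderiv ℝ (fun q => A.pairing x (Δ q a s x) (s' x)) (κ t) τ) t :=
      (differentiable_time (hΔ a s s') x (κ t)).hasFDerivAt.comp_hasDerivAt t hκ
    simp only [h]
    rw [hφ, fderiv_eq_smul_deriv, h1.deriv, one_smul]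
  change Form.contract _ ((familyConnection hΔ').chern _ _) _ _ =
    Form.contract _ ((familyConnection hΔ).chern _ _) _ _
  rw [contract_chern_apply hΔ' hφ', contract_chern_apply hΔ hφ, h]

/-! ### Families that preserve a form -/

theorem familyChern_eq_zero (h : ∀ p, (Δ p).PreservesPairing) {k : ℕ} (hk : Odd k) :
    familyChern hΔ k = 0 :=
  chern_eq_zero_of_skew (A.timePairing P) (familyConnection_skew hΔ h) hk

/-- The adjoint `D'` is formed over `P × M` with respect to the moving form `B`. Along `Γ(E)` it is
the family of adjoints `Δ'`, but in the parameter directions it also sees the derivative of `B`. Its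
odd traces vanish since those of the skew connection do. -/
theorem exists_adjoint_family {Δ : P → A.EConnection} (hΔ : IsSmoothFamily Δ)
    (B : TimeForm n F E P) (h : ∀ p, (Δ p).PreservesPairing) :
    ∃ (Δ' : P → A.EConnection) (hΔ' : IsSmoothFamily Δ')
      (D' : LeibnizConnection (A.timeAction (P := P)) (A.TimeSec P)),
      (∀ a, familyConnection hΔ' (a, 0) = D' (a, 0)) ∧
      (∀ k, Odd k → D'.chern (A.timeTrace P).toAddMonoidHom k = 0) ∧
      ∀ p (a v w : Sections n F E) x, B.toFun (p, x) (Δ p a v x) (w x) +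
        B.toFun (p, x) (v x) (Δ' p a w x) =
          A.lieDeriv a (fun y => B.toFun (p, y) (v y) (w y)) x := by
  obtain ⟨D', hD'⟩ := B.exists_adjoint (familyConnection hΔ) timeAction_act_add
  -- Linearity over `C^∞(M)` in the direction `a` passes to the adjoint; it is needed for `D'` to
  -- restrict to `E`-connections.
  have hD : ∀ (f : C^∞⟮𝓡 n, M; ℝ⟯) (a : Sections n F E) (v : A.TimeSec P),
      D' (f • a, 0) v = TimeFun.const P f • D' (a, 0) v := by
    intro f a v
    refine B.eq_of_bilin fun u => ?_
    have h1 := hD' (f • a, 0) u v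
    have h2 := hD' (a, 0) u v
    have h3 : A.timeAction.act (f • a, 0) (B.bilin A u v) =
        TimeFun.const P f * A.timeAction.act (a, 0) (B.bilin A u v) := by
      ext y
      change _ = f y.2 * A.timeAction.act (a, 0) (B.bilin A u v) y
      rw [act_section_time, act_section_time, lieDeriv_smul_left]
    rw [familyConnection_smul_left, map_smul, LinearMap.smul_apply, h3, ← h2] at h1
    rw [map_smul]
    simp only [smul_eq_mul] at h1 ⊢
    linear_combination h1
  refine ⟨underlying hD, isSmoothFamily_underlying hD, D', familyConnection_underlying hD, ?_, ?_⟩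
  · intro k hk
    refine Form.ext' fun l => ?_
    rw [TimeForm.chern_adjoint hD' hk]
    have : (familyConnection hΔ).chern (A.timeTrace P).toAddMonoidHom k = 0 :=
      familyChern_eq_zero hΔ h hk
    rw [this]
    simp
  · intro p a v w x
    have h1 := congrArg (fun f : TimeFun n M P => f (p, x))
      (hD' (a, 0) (A.constSec P v) (A.constSec P w))
    rw [underlying_apply, slice_apply]
    simp only [act_section_time] at h1
    have h2 : (familyConnection hΔ (a, 0) (A.constSec P v)).1 (p, x) = Δ p a v x := by
      rw [← slice_apply, slice_familyConnection, slice_constSec]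
    rw [← h2]
    exact h1

end CourantAlgebroid

end Courant

end

/-! ### Integrated cochains and the Chern–Simons cocycle -/

noncomputable section

namespace Courant

variable {n : ℕ} {M : Type*} [TopologicalSpace M] [ChartedSpace (EuclideanSpace ℝ (Fin n)) M]
  [IsManifold (𝓡 n) ∞ M]
  {F : Type*} [NormedAddCommGroup F] [NormedSpace ℝ F]
  {E : M → Type*} [TopologicalSpace (TotalSpace F E)] [∀ x, AddCommGroup (E x)]
  [∀ x, Module ℝ (E x)] [∀ x, TopologicalSpace (E x)] [∀ x, IsTopologicalAddGroup (E x)]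
  [∀ x, ContinuousSMul ℝ (E x)] [FiberBundle F E] [VectorBundle ℝ F E]
  [ContMDiffVectorBundle ∞ F E (𝓡 n)]
  [FiniteDimensional ℝ F] [T2Space M]
  {P : Type*} [NormedAddCommGroup P] [NormedSpace ℝ P]


variable {A : CourantAlgebroid n F E}

open MeasureTheory

namespace CourantAlgebroid

/-! ### Cochains defined by integrals -/

section Integral

variable [FiniteDimensional ℝ P] [MeasurableSpace P] [BorelSpace P] {μ : Measure P}
  [IsFiniteMeasure μ] {K : Set P}

variable (μ) in
/-- The integral over `P` of a form on `P × M`, restricted to `M`. -/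
def integralCochain (α : Form (Sections n F E × P) (TimeFun n M P)) (k : ℕ)
    (e : Fin k → Sections n F E) (x : M) : ℝ :=
  ∫ p, α ((List.ofFn e).map fun a => (a, (0 : P))) (p, x) ∂μ

theorem isCochain_integralCochain (hK : IsCompact K) (hμ : μ Kᶜ = 0)
    {α : Form (Sections n F E × P) (TimeFun n M P)}
    (h : Form.HasDerivationSymbol ℝ (constHom P)
      (fun u v : Sections n F E × P => A.pairFun u.1 v.1) α)
    (h' : Form.IsLastLinear (constHom (n := n) (M := M) P)
      (fun a : Sections n F E => (a, (0 : P))) α) (k : ℕ) :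
    A.IsCochain k (integralCochain μ α k) := by
  have ht : ∀ (f : C^∞⟮𝓡 n, M; ℝ⟯) (r : TimeFun n M P), timeIntegral μ hK hμ (constHom P f • r) =
      RingHom.id C^∞⟮𝓡 n, M; ℝ⟯ f • timeIntegral μ hK hμ r := fun f r =>
    timeIntegral_const_mul hK hμ f r
  exact isCochain_ofFn
    (h.pull (j := fun a => (a, (0 : P))) (t := timeIntegral μ hK hμ) (fun _ _ => rfl) ht)
    (Form.IsLastLinear.pull (j := fun a => (a, (0 : P))) (t := timeIntegral μ hK hμ) (i := id)
      h' ht) k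

/-- Integration over the parameter commutes with `ρ(a)`, and brackets within `Γ(E)` do not involve
the parameter. -/
theorem d_integralCochain (hK : IsCompact K) (hμ : μ Kᶜ = 0)
    (α : Form (Sections n F E × P) (TimeFun n M P)) (k : ℕ) :
    A.d k (integralCochain μ α k) =
      integralCochain μ (Form.diff A.timeAction.br A.timeAction.act α) (k + 1) := by
  have h := d_ofFn (A := A) (Form.pull (fun a => (a, (0 : P))) (timeIntegral μ hK hμ) α) k
  refine h.trans ?_
  rw [Form.diff_pull (br := A.timeAction.br) (L := A.timeAction.act) (fun a b => rfl)
    (fun a r => timeIntegral_act A hK hμ a r)]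
  rfl

end Integral

theorem restrict_compl_unit : (volume : Measure ℝ).restrict (Icc 0 1) (Icc 0 1)ᶜ = 0 := by
  rw [Measure.restrict_apply measurableSet_Icc.compl, compl_inter_self, measure_empty]

theorem restrict_compl_square : ((volume : Measure ℝ).restrict (Icc 0 1)).prod
    ((volume : Measure ℝ).restrict (Icc 0 1)) (Icc (0 : ℝ) 1 ×ˢ Icc (0 : ℝ) 1)ᶜ = 0 := by
  rw [Measure.prod_restrict, Measure.restrict_apply (measurableSet_Icc.prod measurableSet_Icc).compl,
    compl_inter_self, measure_empty]

theorem integral_unit_deriv {h h' : ℝ → ℝ} (hd : ∀ t, HasDerivAt h (h' t) t) (hc : Continuous h') :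
    ∫ t in Icc (0 : ℝ) 1, h' t = h 1 - h 0 := by
  rw [integral_Icc_eq_integral_Ioc, ← intervalIntegral.integral_of_le zero_le_one]
  exact intervalIntegral.integral_eq_sub_of_hasDerivAt (fun t _ => hd t)
    (hc.intervalIntegrable 0 1)

theorem hasDerivAt_curve (f : TimeFun n M P) (x : M) {κ : ℝ → P} {τ : P} {t : ℝ}
    (hκ : HasDerivAt κ τ t) :
    HasDerivAt (fun t => f (κ t, x)) (A.timeAction.act (0, τ) f (κ t, x)) t := by
  rw [act_time]
  exact (differentiable_time f.contMDiff x (κ t)).hasFDerivAt.comp_hasDerivAt t hκ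

theorem integral_act_unit (f : TimeFun n M ℝ) (x : M) :
    ∫ t in Icc (0 : ℝ) 1, A.timeAction.act (0, 1) f (t, x) = f (1, x) - f (0, x) :=
  integral_unit_deriv (fun t => hasDerivAt_curve f x (hasDerivAt_id t))
    (contDiff_time (A.timeAction.act (0, 1) f).contMDiff x).continuous

theorem integral_act_square_fst (f : TimeFun n M (ℝ × ℝ)) (x : M) :
    ∫ p, A.timeAction.act (0, (1, 0)) f (p, x) ∂((volume : Measure ℝ).restrict (Icc 0 1)).prod
      ((volume : Measure ℝ).restrict (Icc 0 1)) =
      ∫ t in Icc (0 : ℝ) 1, (f ((1, t), x) - f ((0, t), x)) := by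
  have hc := (contDiff_time (A.timeAction.act (0, ((1 : ℝ), (0 : ℝ))) f).contMDiff x).continuous
  rw [integral_prod_symm _ (integrable_of_continuous (isCompact_Icc.prod isCompact_Icc)
    restrict_compl_square hc)]
  congr 1
  funext t
  exact integral_unit_deriv (h := fun s => f ((s, t), x)) (fun s => hasDerivAt_curve f x
    ((hasDerivAt_id s).prodMk (hasDerivAt_const s t))) (hc.comp (by fun_prop))

theorem integral_act_square_snd (f : TimeFun n M (ℝ × ℝ)) (x : M) :
    ∫ p, A.timeAction.act (0, (0, 1)) f (p, x) ∂((volume : Measure ℝ).restrict (Icc 0 1)).prod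
      ((volume : Measure ℝ).restrict (Icc 0 1)) =
      ∫ s in Icc (0 : ℝ) 1, (f ((s, 1), x) - f ((s, 0), x)) := by
  have hc := (contDiff_time (A.timeAction.act (0, ((0 : ℝ), (1 : ℝ))) f).contMDiff x).continuous
  rw [integral_prod _ (integrable_of_continuous (isCompact_Icc.prod isCompact_Icc)
    restrict_compl_square hc)]
  congr 1
  funext s
  exact integral_unit_deriv (h := fun t => f ((s, t), x)) (fun t => hasDerivAt_curve f x
    ((hasDerivAt_const t s).prodMk (hasDerivAt_id t))) (hc.comp (by fun_prop))

/-! ### The Chern–Simons cocycle -/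

/-- All components of `tr(F^k)` vanish. -/
def EConnection.ChernVanishes (D : A.EConnection) (k : ℕ) : Prop :=
  ∀ (l : List (Sections n F E)) (x : M), LinearMap.trace ℝ (E x) ((curvForm D x ^ k) l) = 0

theorem IsSmoothPath.csForm_eq_integralCochain {γ : ℝ → A.EConnection} {D₀ D₁ : A.EConnection}
    (hγ : IsSmoothPath γ D₀ D₁) (hΔ : IsSmoothFamily (fun u : ℝ => γ (ramp u))) (k : ℕ)
    (hk : 0 < k) : csForm k hk γ = integralCochain ((volume : Measure ℝ).restrict (Icc 0 1))
      (Form.contract (0, 1) (familyChern hΔ k)) (2 * k - 1) := by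
  funext e x
  exact hγ.csForm_eq hΔ k hk e x

/-- By transgression and the fundamental theorem of calculus, `d cs_k` is the difference of
`tr(F^k)` at the two ends. -/
theorem IsSmoothPath.csForm_mem_cocycles {γ : ℝ → A.EConnection} {D₀ D₁ : A.EConnection}
    (hγ : IsSmoothPath γ D₀ D₁) {k : ℕ} (hk : 0 < k) (h₀ : D₀.ChernVanishes k)
    (h₁ : D₁.ChernVanishes k) : csForm k hk γ ∈ A.cocycles (2 * k - 1) := by
  have hΔ := hγ.isSmoothFamily contDiff_ramp ramp_mem
  rw [hγ.csForm_eq_integralCochain hΔ]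
  refine ⟨isCochain_integralCochain isCompact_Icc restrict_compl_unit
    ((hasDerivationSymbol_familyChern hΔ k).contract _)
    ((isLastLinear_familyChern hΔ k).contract _) _, ?_⟩
  rw [d_integralCochain isCompact_Icc restrict_compl_unit]
  obtain ⟨k, rfl⟩ : ∃ m, k = m + 1 := ⟨k - 1, by omega⟩
  funext e x
  rw [integralCochain]
  simp only [diff_contract_familyChern]
  rw [integral_act_unit, familyChern_apply, familyChern_apply, ramp_one, ramp_zero, hγ.source,
    hγ.target, h₀, h₁, sub_zero]
  rfl

/-! ### Independence of the choices -/

/-- The path `(1 - θ) g₀ + θ g₁` of metrics. -/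
def metricPath (g₀ g₁ : ContMDiffRiemannianMetric (𝓡 n) ∞ F E) : TimeForm n F E ℝ where
  toFun y := g₀.inner y.2 + ramp y.1 • (g₁.inner y.2 - g₀.inner y.2)
  contMDiff s t := by
    have h₀ := (contMDiff_form (n := n) (F := F) g₀.contMDiff s t).comp
      (contMDiff_snd (I := 𝓘(ℝ, ℝ)) (J := 𝓡 n) (M := ℝ) (N := M))
    have h₁ := (contMDiff_form (n := n) (F := F) g₁.contMDiff s t).comp
      (contMDiff_snd (I := 𝓘(ℝ, ℝ)) (J := 𝓡 n) (M := ℝ) (N := M))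
    have hr : ContMDiff (𝓘(ℝ, ℝ).prod (𝓡 n)) 𝓘(ℝ, ℝ) ∞ (fun y : ℝ × M => ramp y.1) :=
      contDiff_ramp.contMDiff.comp contMDiff_fst
    exact h₀.add (hr.mul (h₁.sub h₀))
  symm y v w := by
    simp only [_root_.add_apply, _root_.smul_apply, _root_.sub_apply, g₀.symm y.2 v w,
      g₁.symm y.2 v w]
  -- A convex combination of positive definite forms is positive definite; `ramp` keeps the weight
  -- in `[0, 1]` at all times.
  nondegenerate y v h := by
    by_contra hv
    have h1 := h v
    have hp₀ := g₀.pos y.2 v hv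
    have hp₁ := g₁.pos y.2 v hv
    obtain ⟨hr₀, hr₁⟩ := ramp_mem y.1
    simp only [_root_.add_apply, _root_.smul_apply, _root_.sub_apply, smul_eq_mul] at h1
    have h2 : (1 - ramp y.1) * g₀.inner y.2 v v + ramp y.1 * g₁.inner y.2 v v = 0 := by
      linear_combination h1
    rcases hr₀.eq_or_lt with hr | hr
    · rw [← hr] at h2
      simp at h2
      exact hp₀.ne' h2
    · have := mul_pos hr hp₁
      have := mul_nonneg (sub_nonneg.2 hr₁) hp₀.le
      linarith

theorem metricPath_zero (g₀ g₁ : ContMDiffRiemannianMetric (𝓡 n) ∞ F E) (x : M)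
    (v w : E x) : (metricPath g₀ g₁).toFun (0, x) v w = g₀.inner x v w := by
  change g₀.inner x v w + ramp 0 * (g₁.inner x v w - g₀.inner x v w) = _
  rw [ramp_zero, zero_mul, add_zero]

theorem metricPath_one (g₀ g₁ : ContMDiffRiemannianMetric (𝓡 n) ∞ F E) (x : M)
    (v w : E x) : (metricPath g₀ g₁).toFun (1, x) v w = g₁.inner x v w := by
  change g₀.inner x v w + ramp 1 * (g₁.inner x v w - g₀.inner x v w) = _
  rw [ramp_one, one_mul, add_sub_cancel]

theorem EConnection.eq_adjoint (D D' : A.EConnection) (g : ContMDiffRiemannianMetric (𝓡 n) ∞ F E)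
    (h : ∀ (a v w : Sections n F E) x, g.inner x (D a v x) (w x) + g.inner x (v x) (D' a w x) =
      A.lieDeriv a (fun y => g.inner y (v y) (w y)) x) : D' = D.adjoint g := by
  refine EConnection.ext_apply fun a b x => eq_of_metric g fun u => ?_
  obtain ⟨s, rfl⟩ := exists_section_eq (n := n) (F := F) x u
  rw [g.symm x _ (s x), g.symm x _ (s x)]
  have h1 := h a s b x
  have h2 := D.adjoint_spec g a s b x
  linarith

/-- A family of connections preserving the pairing that joins `D₀` to `D₁`, and a family of
adjoints with respect to a path of metrics. -/
theorem exists_adjoint_homotopy {D₀ D₁ : A.EConnection} (h₀ : D₀.PreservesPairing)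
    (h₁ : D₁.PreservesPairing) (g₀ g₁ : ContMDiffRiemannianMetric (𝓡 n) ∞ F E) :
    ∃ (Δ : ℝ → A.EConnection) (hΔ : IsSmoothFamily Δ)
      (D' : LeibnizConnection (A.timeAction (P := ℝ)) (A.TimeSec ℝ)),
      (∀ a, familyConnection hΔ (a, 0) = D' (a, 0)) ∧
      (∀ k, Odd k → D'.chern (A.timeTrace ℝ).toAddMonoidHom k = 0) ∧
      Δ 0 = D₀.adjoint g₀ ∧ Δ 1 = D₁.adjoint g₁ := by
  obtain ⟨Δ, hΔ, D', hj, hch, hspec⟩ := exists_adjoint_family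
    (((isSmoothFamily_const (P := ℝ) D₀).shift (isSmoothFamily_const D₁) (isSmoothFamily_const D₀)
      contDiff_ramp)) (metricPath g₀ g₁) (fun p => h₀.shift h₁ h₀ _)
  refine ⟨Δ, hΔ, D', hj, hch, EConnection.eq_adjoint _ _ _ ?_, EConnection.eq_adjoint _ _ _ ?_⟩
  · intro a v w x
    have := hspec 0 a v w x
    simpa only [metricPath_zero, ramp_zero, EConnection.shift_zero] using this
  · intro a v w x
    have := hspec 1 a v w x
    simpa only [metricPath_one, ramp_one, EConnection.shift_one] using this

theorem EConnection.PreservesPairing.chernVanishes {D : A.EConnection} (h : D.PreservesPairing)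
    {k : ℕ} (hk : Odd k) : D.ChernVanishes k := by
  intro l x
  rw [← familyChern_apply (isSmoothFamily_const (P := ℝ) D) k l 0 x,
    familyChern_eq_zero _ (fun _ => h) hk]
  rfl

theorem br_section (a b : Sections n F E) :
    ∃ c, (A.timeAction (P := P)).br (a, 0) (b, 0) = (c, 0) := ⟨_, rfl⟩

/-- The constant homotopy from `D` to itself has `D.adjoint g` as its adjoint at time `0`, and along
`Γ(E)` its traces are those of `D'`, which vanish. -/
theorem EConnection.PreservesPairing.chernVanishes_adjoint {D : A.EConnection}
    (h : D.PreservesPairing) (g : ContMDiffRiemannianMetric (𝓡 n) ∞ F E) {k : ℕ} (hk : Odd k) :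
    (D.adjoint g).ChernVanishes k := by
  obtain ⟨Δ, hΔ, D', hj, hch, h0, -⟩ := exists_adjoint_homotopy h h g g
  intro l x
  rw [← h0, ← familyChern_apply hΔ k l 0 x]
  have := LeibnizConnection.chern_map_of_agree (A.timeTrace ℝ).toAddMonoidHom hj br_section k l
  rw [familyChern, this, hch k hk]
  rfl

end CourantAlgebroid

end Courant

end

/-! ### Independence of the choices and the main theorem -/

noncomputable section

namespace Courant

variable {n : ℕ} {M : Type*} [TopologicalSpace M] [ChartedSpace (EuclideanSpace ℝ (Fin n)) M]
  [IsManifold (𝓡 n) ∞ M]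
  {F : Type*} [NormedAddCommGroup F] [NormedSpace ℝ F]
  {E : M → Type*} [TopologicalSpace (TotalSpace F E)] [∀ x, AddCommGroup (E x)]
  [∀ x, Module ℝ (E x)] [∀ x, TopologicalSpace (E x)] [∀ x, IsTopologicalAddGroup (E x)]
  [∀ x, ContinuousSMul ℝ (E x)] [FiberBundle F E] [VectorBundle ℝ F E]
  [ContMDiffVectorBundle ∞ F E (𝓡 n)]
  [FiniteDimensional ℝ F] [T2Space M]
  {P : Type*} [NormedAddCommGroup P] [NormedSpace ℝ P]


variable {A : CourantAlgebroid n F E}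

open MeasureTheory

namespace CourantAlgebroid

/-- A family that differs from an adjoint family only in the direction of the parameter has an
exact Chern–Simons form. -/
theorem exists_contract_familyChern_eq {Δ : P → A.EConnection} (hΔ : IsSmoothFamily Δ)
    {D' : LeibnizConnection (A.timeAction (P := P)) (A.TimeSec P)}
    (hj : ∀ a, familyConnection hΔ (a, 0) = D' (a, 0)) {k : ℕ}
    (hD' : D'.chern (A.timeTrace P).toAddMonoidHom (k + 1) = 0) (τ : P) :
    ∃ ξ : Form (Sections n F E × P) (TimeFun n M P),
      Form.HasDerivationSymbol ℝ (constHom P)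
        (fun u v : Sections n F E × P => A.pairFun u.1 v.1) ξ ∧
      Form.IsLastLinear (constHom (n := n) (M := M) P) (fun a : Sections n F E => (a, (0 : P))) ξ ∧
      ∀ l : List (Sections n F E),
        Form.contract (0, τ) (familyChern hΔ (k + 1)) (l.map fun a => (a, (0 : P))) =
          (k + 1) • Form.diff A.timeAction.br A.timeAction.act ξ (l.map fun a => (a, (0 : P))) := by
  -- The primitive is `tr(u F^k)`, where `u` measures the discrepancy in the parameter direction.
  obtain ⟨u, hu⟩ := exists_difference (familyConnection hΔ) D' (0, τ)
  refine ⟨Form.comp (A.timeTrace P).toAddMonoidHom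
    (Form.ofDegreeZero u * (familyConnection hΔ).curv ^ k), ?_, ?_, fun l => ?_⟩
  · exact ((Form.HasDerivationSymbol.ofDegreeZero u).mul
      ((hasDerivationSymbol_familyCurv hΔ).pow k)).comp _ timeTrace_smul
  · exact ((Form.IsLastLinear.ofDegreeZero u).mul
      ((isLastLinear_familyCurv hΔ).pow k)).comp _ timeTrace_smul
  · have h := (familyConnection hΔ).contract_chern_of_agree (A.timeTrace P).toAddMonoidHom
      timeTrace_mul_comm (timeTrace_ad (familyConnection hΔ)) hj br_section (0, τ)
      (br_time τ) u hu k l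
    rw [hD', map_zero, Form.zero_apply, zero_add] at h
    exact h

/-- Chern–Simons forms of paths from connections preserving the pairing to their adjoints are
cohomologous. -/
theorem exists_primitive {D₀ D₁ : A.EConnection} (h₀ : D₀.PreservesPairing)
    (h₁ : D₁.PreservesPairing) {g₀ g₁ : ContMDiffRiemannianMetric (𝓡 n) ∞ F E}
    {γ₀ γ₁ : ℝ → A.EConnection}
    (hγ₀ : IsSmoothPath γ₀ D₀ (D₀.adjoint g₀)) (hγ₁ : IsSmoothPath γ₁ D₁ (D₁.adjoint g₁)) {k : ℕ}
    (hk : Odd (k + 1)) :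
    ∃ η ∈ A.cochains (2 * k), A.d (2 * k) η =
      csForm (k + 1) k.succ_pos γ₁ - csForm (k + 1) k.succ_pos γ₀ := by
  -- The family `Δs` of adjoints will be the top side of the square.
  obtain ⟨Δs, hΔs, D', hj, hch, hs0, hs1⟩ := exists_adjoint_homotopy h₀ h₁ g₀ g₁
  obtain ⟨ξ, hξ, hξ', hW⟩ := exists_contract_familyChern_eq hΔs hj (hch _ hk) 1
  have hΔ₀ := hγ₀.isSmoothFamily contDiff_ramp ramp_mem
  have hΔ₁ := hγ₁.isSmoothFamily contDiff_ramp ramp_mem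
  have hfst : ContDiff ℝ ∞ (Prod.fst : ℝ × ℝ → ℝ) := contDiff_fst
  have hsnd : ContDiff ℝ ∞ (Prod.snd : ℝ × ℝ → ℝ) := contDiff_snd
  let Δb : ℝ → A.EConnection := fun s => D₀.shift D₁ D₀ (ramp s)
  have hΔb : IsSmoothFamily Δb := (isSmoothFamily_const (P := ℝ) D₀).shift
    (isSmoothFamily_const D₁) (isSmoothFamily_const D₀) contDiff_ramp
  -- The square is filled by interpolation: `X` joins the two given paths affinely in the first
  -- variable, `Y` is the value of `X` at height `1`, and adding `ramp t (Δs - Y)` corrects the top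
  -- side without changing the other three.
  let X : ℝ × ℝ → A.EConnection := fun p =>
    (γ₀ (ramp p.2)).shift (γ₁ (ramp p.2)) (γ₀ (ramp p.2)) (ramp p.1)
  let Y : ℝ × ℝ → A.EConnection := fun p => (γ₀ 1).shift (γ₁ 1) (γ₀ 1) (ramp p.1)
  let Δ : ℝ × ℝ → A.EConnection := fun p => (X p).shift (Δs p.1) (Y p) (ramp p.2)
  have hΔ : IsSmoothFamily Δ := by
    refine IsSmoothFamily.shift ?_ (hΔs.comp hfst) ?_ (contDiff_ramp.comp hsnd)
    · exact (hΔ₀.comp hsnd).shift (hΔ₁.comp hsnd) (hΔ₀.comp hsnd) (contDiff_ramp.comp hfst)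
    · exact (isSmoothFamily_const _).shift (isSmoothFamily_const _) (isSmoothFamily_const _)
        (contDiff_ramp.comp hfst)
  have e₀ : ∀ t, γ₀ (ramp t) = Δ (0, t) := fun t => by
    simp only [Δ, X, Y, ramp_zero, EConnection.shift_zero, hs0, hγ₀.target, EConnection.shift_self]
  have e₁ : ∀ t, γ₁ (ramp t) = Δ (1, t) := fun t => by
    simp only [Δ, X, Y, ramp_one, EConnection.shift_one, hs1, hγ₁.target, EConnection.shift_self]
  have eb : ∀ s, Δb s = Δ (s, 0) := fun s => by
    simp only [Δ, X, Δb, ramp_zero, EConnection.shift_zero, hγ₀.source, hγ₁.source]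
  have es : ∀ s, Δs s = Δ (s, 1) := fun s => by
    simp only [Δ, X, Y, ramp_one, EConnection.shift_one]
  let μ : Measure ℝ := volume.restrict (Icc 0 1)
  -- The component of `tr(F^{k+1})` with both parameter directions inserted, of degree `2 * k` on
  -- `Γ(E)`.
  let ζ := Form.contract (0, ((0 : ℝ), (1 : ℝ))) (Form.contract (0, ((1 : ℝ), (0 : ℝ)))
    (familyChern hΔ (k + 1)))
  have hζ : A.IsCochain (2 * k) (integralCochain (μ.prod μ) ζ (2 * k)) :=
    isCochain_integralCochain (isCompact_Icc.prod isCompact_Icc) restrict_compl_square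
      (((hasDerivationSymbol_familyChern hΔ (k + 1)).contract _).contract _)
      (((isLastLinear_familyChern hΔ (k + 1)).contract _).contract _) _
  have hβ : A.IsCochain (2 * k) (integralCochain μ ξ (2 * k)) :=
    isCochain_integralCochain isCompact_Icc restrict_compl_unit hξ hξ' _
  have hζ' : (-1 : ℝ) • integralCochain (μ.prod μ) ζ (2 * k) ∈ A.cochains (2 * k) :=
    Submodule.smul_mem _ _ hζ
  have hβ' : ((k : ℝ) + 1) • integralCochain μ ξ (2 * k) ∈ A.cochains (2 * k) :=
    Submodule.smul_mem _ _ hβ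
  -- The primitive is `(k + 1) ∫ ξ - ∫∫ ζ`: the first term accounts for the top side, the second for
  -- the interior of the square.
  refine ⟨_, add_mem hβ' hζ', ?_⟩
  rw [A.d_add hβ' hζ', A.d_smul _ hβ, A.d_smul _ hζ,
    d_integralCochain isCompact_Icc restrict_compl_unit,
    d_integralCochain (isCompact_Icc.prod isCompact_Icc) restrict_compl_square,
    hγ₀.csForm_eq_integralCochain hΔ₀, hγ₁.csForm_eq_integralCochain hΔ₁]
  funext e x
  let l : List (Sections n F E) := List.ofFn e
  let Wσ : TimeFun n M (ℝ × ℝ) := Form.contract (0, ((1 : ℝ), (0 : ℝ))) (familyChern hΔ (k + 1))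
    (l.map fun a => (a, 0))
  let Wτ : TimeFun n M (ℝ × ℝ) := Form.contract (0, ((0 : ℝ), (1 : ℝ))) (familyChern hΔ (k + 1))
    (l.map fun a => (a, 0))
  let c₀ : TimeFun n M ℝ := Form.contract (0, 1) (familyChern hΔ₀ (k + 1)) (l.map fun a => (a, 0))
  let c₁ : TimeFun n M ℝ := Form.contract (0, 1) (familyChern hΔ₁ (k + 1)) (l.map fun a => (a, 0))
  let ω' : TimeFun n M ℝ := Form.diff A.timeAction.br A.timeAction.act ξ (l.map fun a => (a, 0))
  have hint : ∀ f : TimeFun n M ℝ, Integrable (fun t => f (t, x)) μ := fun f =>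
    integrable_of_continuous isCompact_Icc restrict_compl_unit (contDiff_time f.contMDiff x).continuous
  have hint2 : ∀ f : TimeFun n M (ℝ × ℝ), Integrable (fun p => f (p, x)) (μ.prod μ) := fun f =>
    integrable_of_continuous (isCompact_Icc.prod isCompact_Icc) restrict_compl_square
      (contDiff_time f.contMDiff x).continuous
  have hdiff : ∀ p, Form.diff A.timeAction.br A.timeAction.act ζ (l.map fun a => (a, 0)) (p, x) =
      A.timeAction.act (0, (0, 1)) Wσ (p, x) - A.timeAction.act (0, (1, 0)) Wτ (p, x) := by
    intro p
    have h : A.timeAction.act (0, ((1 : ℝ), (0 : ℝ))) Wτ (p, x) -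
        A.timeAction.act (0, ((0 : ℝ), (1 : ℝ))) Wσ (p, x) +
        Form.diff A.timeAction.br A.timeAction.act ζ (l.map fun a => (a, 0)) (p, x) = 0 :=
      congrArg (fun f : TimeFun n M (ℝ × ℝ) => f (p, x))
        (diff_contract_contract_familyChern hΔ k (1, 0) (0, 1) l)
    linear_combination h
  -- On the top side the contracted form is exact, by comparison with the adjoint connection `D'`.
  have hσ₁ : ∀ s, Wσ ((s, 1), x) = (k + 1) * ω' (s, x) := by
    intro s
    have h1 := contract_familyChern_curve hΔ hΔs es
      ((hasDerivAt_id s).prodMk (hasDerivAt_const s (1 : ℝ))) k l x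
    refine h1.symm.trans ?_
    rw [hW l, ← Nat.cast_smul_eq_nsmul ℝ]
    change ((k + 1 : ℕ) : ℝ) * ω' (s, x) = _
    push_cast
    rfl
  -- The bottom side preserves the pairing throughout, so its form `tr(F^{k+1})` vanishes over `ℝ ×
  -- M`, also in the parameter direction.
  have hσ₀ : ∀ s, Wσ ((s, 0), x) = 0 := by
    intro s
    have h1 := contract_familyChern_curve hΔ hΔb eb
      ((hasDerivAt_id s).prodMk (hasDerivAt_const s (0 : ℝ))) k l x
    refine h1.symm.trans ?_
    rw [familyChern_eq_zero hΔb (fun s => h₀.shift h₁ h₀ _) hk]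
    rfl
  have hτ₁ : ∀ t, Wτ ((1, t), x) = c₁ (t, x) := fun t =>
    (contract_familyChern_curve hΔ hΔ₁ e₁
      ((hasDerivAt_const t (1 : ℝ)).prodMk (hasDerivAt_id t)) k l x).symm
  have hτ₀ : ∀ t, Wτ ((0, t), x) = c₀ (t, x) := fun t =>
    (contract_familyChern_curve hΔ hΔ₀ e₀
      ((hasDerivAt_const t (0 : ℝ)).prodMk (hasDerivAt_id t)) k l x).symm
  change (k + 1) * ∫ s, ω' (s, x) ∂μ + (-1) * ∫ p, Form.diff A.timeAction.br A.timeAction.act ζ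
    (l.map fun a => (a, 0)) (p, x) ∂(μ.prod μ) = ∫ t, c₁ (t, x) ∂μ - ∫ t, c₀ (t, x) ∂μ
  simp only [hdiff]
  -- Stokes' theorem on the square leaves only the four sides.
  rw [integral_sub (hint2 _) (hint2 _), integral_act_square_fst, integral_act_square_snd]
  simp only [hσ₁, hσ₀, hτ₁, hτ₀, sub_zero]
  rw [integral_const_mul, integral_sub (hint c₁) (hint c₀)]
  ring

end CourantAlgebroid

end Courant

end

theorem mainTheorem3 {n : ℕ} {M : Type*} [TopologicalSpace M]
    [ChartedSpace (EuclideanSpace ℝ (Fin n)) M] [IsManifold (𝓡 n) ∞ M] [T2Space M]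
    [SecondCountableTopology M]
    {F : Type*} [NormedAddCommGroup F] [NormedSpace ℝ F] [FiniteDimensional ℝ F]
    {E : M → Type*} [TopologicalSpace (TotalSpace F E)] [∀ x, AddCommGroup (E x)]
    [∀ x, Module ℝ (E x)] [∀ x, TopologicalSpace (E x)] [∀ x, IsTopologicalAddGroup (E x)]
    [∀ x, ContinuousSMul ℝ (E x)] [FiberBundle F E] [VectorBundle ℝ F E]
    [ContMDiffVectorBundle ∞ F E (𝓡 n)]
    (A : Courant.CourantAlgebroid n F E) (k : ℕ) (hk : Odd k) :
    ∃ c : A.Cohomology (2 * k - 1),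
      ∀ (cov : CovariantDerivative (𝓡 n) F E)
        [CovariantDerivative.ContMDiffCovariantDerivative cov ∞]
        (g : ContMDiffRiemannianMetric (𝓡 n) ∞ F E),
        Courant.CourantAlgebroid.IsChernSimonsClass k hk.pos (A.bott cov)
          ((A.bott cov).adjoint g) c := by
  obtain ⟨m, rfl⟩ : ∃ m, k = m + 1 := ⟨k - 1, (Nat.sub_add_cancel hk.pos).symm⟩
  have hmem : ∀ (cov : CovariantDerivative (𝓡 n) F E)
      [CovariantDerivative.ContMDiffCovariantDerivative cov ∞]
      (g : ContMDiffRiemannianMetric (𝓡 n) ∞ F E) (γ : ℝ → A.EConnection),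
      Courant.CourantAlgebroid.IsSmoothPath γ (A.bott cov) ((A.bott cov).adjoint g) →
      Courant.CourantAlgebroid.csForm (m + 1) hk.pos γ ∈ A.cocycles (2 * (m + 1) - 1) :=
    fun cov _ g γ hγ => hγ.csForm_mem_cocycles hk.pos
      ((Courant.CourantAlgebroid.preservesPairing_bott A cov).chernVanishes hk)
      ((Courant.CourantAlgebroid.preservesPairing_bott A cov).chernVanishes_adjoint g hk)
  -- The class is defined by one choice of `∇`, `g` and path. If there were no such choice, the
  -- claim would be vacuous and any class would do.
  by_cases h : ∃ (cov : CovariantDerivative (𝓡 n) F E)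
      (_ : CovariantDerivative.ContMDiffCovariantDerivative cov ∞),
      Nonempty (ContMDiffRiemannianMetric (𝓡 n) ∞ F E)
  · obtain ⟨cov₀, _, ⟨g₀⟩⟩ := h
    obtain ⟨γ₀, hγ₀⟩ := Courant.CourantAlgebroid.exists_isSmoothPath (A.bott cov₀)
      ((A.bott cov₀).adjoint g₀)
    refine ⟨Submodule.Quotient.mk ⟨_, hmem cov₀ g₀ γ₀ hγ₀⟩, fun cov _ g =>
      ⟨Courant.CourantAlgebroid.exists_isSmoothPath _ _, fun γ hγ => ⟨hmem cov g γ hγ, ?_⟩⟩⟩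
    rw [Submodule.Quotient.eq]
    obtain ⟨η, hη, hd⟩ := Courant.CourantAlgebroid.exists_primitive
      (Courant.CourantAlgebroid.preservesPairing_bott A cov₀)
      (Courant.CourantAlgebroid.preservesPairing_bott A cov) hγ₀ hγ hk
    -- The degree `2 * (m + 1) - 1` is `2 * m + 1` by definition, so exactness unfolds to a
    -- primitive of degree `2 * m`.
    exact ⟨(sub_mem (hmem cov g γ hγ) (hmem cov₀ g₀ γ₀ hγ₀)).1, η, hη, hd⟩
  · exact ⟨0, fun cov hcov g => absurd ⟨cov, hcov, ⟨g⟩⟩ h⟩
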